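/- Theorem 1.3. Let $p=3$. There is a germ at $0$ of a real analytic submanifold $M\subset\mathbf C^{6}$ of real dimension $6$, $$M\colon\ z_{p+j}=E_j(z',\bar z'),\qquad E_j(z',\bar z')=h_j(z',\bar z')+q_j(\bar z')+O(|(z',\bar z')|^3),\qquad 1\le j\le p,\ z'=(z_1,\dots,z_p),$$ where $E_j$ is a convergent power series, $h_j$ is a quadratic form without holomorphic or anti-holomorphic terms and $q_j$ is a quadratic form, such that $q^{-1}(0)=\{0\}$ and the following hold. (i) Let $(z',w')\in\mathbf C^{2p}$ be the coordinates on the complexification $z_{p+j}=E_j(z',w')$, $w_{p+j}=\overline{E_j}(w',z')$ of $M$, and let $\pi_1(z',w')=(z',E(z',w'))$. Then $\pi_1$ admits the maximum number $2^p=8$ of deck transformations, that is, of germs of biholomorphic maps $\tau$ with $\tau(0)=0$ and $\pi_1\circ\tau=\pi_1$. They form a group generated by $p$ commuting involutions $\tau_{11},\dots,\tau_{1p}$, each of which fixes a hypersurface. Put $\tau_1=\tau_{11}\cdots\tau_{1p}$, $\rho_0(z',w')=(\overline{w'},\overline{z'})$, $\tau_2=\rho_0\tau_1\rho_0$ and $\sigma=\tau_1\tau_2$.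 (ii) $M$ is non-resonant: the eigenvalues of the linear part of $\sigma$ at $0$ are $\mu_1,\dots,\mu_p,\mu_1^{-1},\dots,\mu_p^{-1}$ with $\mu^Q\ne1$ for all $Q\in\mathbf Z^p$, $Q\neq0$. (iii) The complex tangent of $M$ at $0$ is purely elliptic: in suitable linear coordinates $(\xi,\eta)$ of $\mathbf C^{2p}$ one has $\rho_0(\xi,\eta)=(\bar\eta,\bar\xi)$, and the linear part of $\tau_1$ is $\xi_j'=\lambda_j\eta_j$, $\eta_j'=\lambda_j^{-1}\xi_j$ with $\lambda_j>1$, $1\le j\le p$. (iv) Every Poincaré–Dulac normal form of $\sigma$ diverges: if $\Psi$ is a formal biholomorphic map of $(\mathbf C^{2p},0)$ and $\sigma^*=\Psi^{-1}\sigma\Psi$ commutes with the linear part of $\sigma$ at $0$, then $\sigma^*$ is divergent. -/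

import Mathlib

noncomputable section

namespace CRSing

/-- A formal map of `ℂ^ι` into itself, given by its power series components. -/
abbrev FormalMap (ι : Type) : Type := ι → MvPowerSeries ι ℂ

variable {ι : Type}

/-- The formal map sends the origin to the origin. -/
def FixesOrigin (F : FormalMap ι) : Prop :=
  ∀ i, MvPowerSeries.constantCoeff (F i) = 0

/-- The power series converges: it is absolutely convergent on some polydisc of positive radius
around the origin. -/
def Converges (f : MvPowerSeries ι ℂ) : Prop :=
  ∃ r : ℝ, 0 < r ∧ Summable fun m : ι →₀ ℕ => ‖MvPowerSeries.coeff m f‖ * r ^ m.degree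

/-- The formal map is convergent, i.e. it is the Taylor expansion of a germ of holomorphic map. -/
def IsConvergent (F : FormalMap ι) : Prop :=
  ∀ i, Converges (F i)

/-- The composition `F ∘ G` (meaningful when `G` fixes the origin). -/
def comp (F G : FormalMap ι) : FormalMap ι :=
  fun i => MvPowerSeries.subst G (F i)

/-- The identity map. -/
def idMap (ι : Type) : FormalMap ι :=
  fun i => MvPowerSeries.X i

/-- `F` and `G` are formal maps fixing the origin which are inverse to each other. -/
def AreInverse (F G : FormalMap ι) : Prop :=
  FixesOrigin F ∧ FixesOrigin G ∧ comp F G = idMap ι ∧ comp G F = idMap ι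

/-- `F` is a formal biholomorphic map at the origin. -/
def IsFormalBiholomorphic (F : FormalMap ι) : Prop :=
  ∃ G, AreInverse F G

/-- The composition `F₁ ∘ F₂ ∘ ⋯ ∘ Fₖ` of a list of maps. -/
def compList (l : List (FormalMap ι)) : FormalMap ι :=
  l.foldr comp (idMap ι)

/-- The Jacobian matrix at the origin. -/
def jacobian (F : FormalMap ι) : Matrix ι ι ℂ :=
  Matrix.of fun i j => MvPowerSeries.coeff (Finsupp.single j 1) (F i)

/-- The linear part `LF : x ↦ F'(0) x`, as a map. -/
def linearPart [Fintype ι] (F : FormalMap ι) : FormalMap ι :=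
  fun i => ∑ j, MvPowerSeries.C (jacobian F i j) * MvPowerSeries.X j

/-- The fixed point set of `τ` is a hypersurface germ `{g = 0}`: the ideals of the germs
`Fix τ = {τ(x) - x = 0}` and `{g = 0}` have the same radical, for some `g ≠ 0` vanishing at the
origin. -/
def FixesHypersurface (τ : FormalMap ι) : Prop :=
  ∃ g : MvPowerSeries ι ℂ, g ≠ 0 ∧ MvPowerSeries.constantCoeff g = 0 ∧
    (Ideal.span (Set.range fun i => τ i - MvPowerSeries.X i)).radical =
      (Ideal.span {g}).radical

/-! In what follows the coordinates of `ℂ^{2p}` are indexed by `Fin p ⊕ Fin p`. A tuple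
`E : Fin p → MvPowerSeries (Fin p ⊕ Fin p) ℂ` stands for the power series `E_j(z', w')`, where
`z'_i` is the variable `Sum.inl i` and `w'_i` is the variable `Sum.inr i`. -/

variable {p : ℕ}

/-- `M` is the germ at the origin of the `2p`-dimensional real analytic submanifold
`z_{p+j} = E_j(z', z̄')`, `1 ≤ j ≤ p`, of `ℂ^{2p}`, realized over a polydisc `|z_i| < r` on which
the power series `E_j` converge. Here
`E_j(z', z̄') = h_j(z', z̄') + q_j(z̄') + O(3)`, where `h_j` is a quadratic form without holomorphic
or anti-holomorphic terms, and `q_j` is a quadratic form; thus the tangent space of `M` at the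
origin is the complex `p`-plane `z'' = 0`. A point of `ℂ^{2p}` is `z = (z', z'')`, with
`z_i = z (Sum.inl i)` and `z_{p+j} = z (Sum.inr j)`. -/
def IsRealAnalyticSubmanifold (M : Set (Fin p ⊕ Fin p → ℂ))
    (E : Fin p → MvPowerSeries (Fin p ⊕ Fin p) ℂ) : Prop :=
  (∀ j, ∀ m : Fin p ⊕ Fin p →₀ ℕ, m.degree < 2 → MvPowerSeries.coeff m (E j) = 0) ∧
  (∀ j, ∀ m : Fin p →₀ ℕ, m.degree = 2 →
    MvPowerSeries.coeff (Finsupp.sumElim m (0 : Fin p →₀ ℕ)) (E j) = 0) ∧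
  ∃ r : ℝ, 0 < r ∧
    (∀ j, Summable fun m : Fin p ⊕ Fin p →₀ ℕ =>
      ‖MvPowerSeries.coeff m (E j)‖ * r ^ m.degree) ∧
    M = {z | (∀ i, ‖z (Sum.inl i)‖ < r) ∧
      ∀ j, HasSum (fun m : Fin p ⊕ Fin p →₀ ℕ =>
        MvPowerSeries.coeff m (E j) *
          ((∏ i, z (Sum.inl i) ^ m (Sum.inl i)) *
            ∏ i, (starRingEnd ℂ) (z (Sum.inl i)) ^ m (Sum.inr i)))
        (z (Sum.inr j))}

/-- The quadratic form `q_j(w')`: the part of `E_j(z', w')` which is quadratic in `w'` alone. -/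
def antiholQuad (E : Fin p → MvPowerSeries (Fin p ⊕ Fin p) ℂ) (j : Fin p) (w : Fin p → ℂ) : ℂ :=
  ∑ m ∈ Finset.finsuppAntidiag (Finset.univ : Finset (Fin p)) 2,
    MvPowerSeries.coeff (Finsupp.sumElim (0 : Fin p →₀ ℕ) m) (E j) * ∏ i, w i ^ m i

/-- Condition B: `q⁻¹(0) = 0`. -/
def ConditionB (E : Fin p → MvPowerSeries (Fin p ⊕ Fin p) ℂ) : Prop :=
  ∀ w : Fin p → ℂ, (∀ j, antiholQuad E j w = 0) → w = 0

/-- The complexification of `M` is the complex submanifold `z_{p+j} = E_j(z', w')`,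
`w_{p+j} = Ē_j(w', z')` of `ℂ^{2p} × ℂ^{2p}`, with coordinates `(z', w') ∈ ℂ^{2p}`. In these
coordinates the projection `π₁ : (z, w) ↦ z` is `(z', w') ↦ (z', E(z', w'))`. -/
def proj₁ (E : Fin p → MvPowerSeries (Fin p ⊕ Fin p) ℂ) : FormalMap (Fin p ⊕ Fin p) :=
  Sum.elim (fun i => MvPowerSeries.X (Sum.inl i)) E

/-- `τ` is a (holomorphic) deck transformation of `π₁`: a germ of biholomorphic map with
`τ(0) = 0` and `π₁ ∘ τ = π₁`. -/
def IsDeckTransformation (E : Fin p → MvPowerSeries (Fin p ⊕ Fin p) ℂ)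
    (τ : FormalMap (Fin p ⊕ Fin p)) : Prop :=
  IsConvergent τ ∧ IsFormalBiholomorphic τ ∧ comp (proj₁ E) τ = proj₁ E

/-- Condition D: `π₁` admits the maximum number, `2 ^ p`, of deck transformations. -/
def ConditionD (E : Fin p → MvPowerSeries (Fin p ⊕ Fin p) ℂ) : Prop :=
  {τ | IsDeckTransformation E τ}.ncard = 2 ^ p

/-- `τ₁₁, …, τ₁ₚ` are the Moser–Webster involutions of `π₁`: pairwise commuting involutions which
generate the group of deck transformations of `π₁`, each of which fixes a hypersurface. -/
def IsMoserWebsterFamily (E : Fin p → MvPowerSeries (Fin p ⊕ Fin p) ℂ)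
    (t : Fin p → FormalMap (Fin p ⊕ Fin p)) : Prop :=
  (∀ j, IsDeckTransformation E (t j) ∧ comp (t j) (t j) = idMap _ ∧ FixesHypersurface (t j)) ∧
  (∀ j k, comp (t j) (t k) = comp (t k) (t j)) ∧
  ∀ τ, IsDeckTransformation E τ → ∃ l : List (Fin p), τ = compList (l.map t)

/-- `τ₁ = τ₁₁ ⋯ τ₁ₚ`. -/
def tau₁ (t : Fin p → FormalMap (Fin p ⊕ Fin p)) : FormalMap (Fin p ⊕ Fin p) :=
  compList (List.ofFn t)

/-- The conjugate `ρ₀ ∘ F ∘ ρ₀` by the anti-holomorphic involution `ρ₀(z', w') = (w̄', z̄')`: the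
coefficients of `F` are conjugated, and both its variables and its components are swapped. -/
def conjRho (F : FormalMap (Fin p ⊕ Fin p)) : FormalMap (Fin p ⊕ Fin p) :=
  fun i => MvPowerSeries.subst (fun k : Fin p ⊕ Fin p => MvPowerSeries.X (R := ℂ) k.swap)
    (MvPowerSeries.map (starRingEnd ℂ) (F i.swap))

/-- `σ = τ₁ ∘ τ₂` with `τ₂ = ρ₀ ∘ τ₁ ∘ ρ₀`. -/
def sigma (t : Fin p → FormalMap (Fin p ⊕ Fin p)) : FormalMap (Fin p ⊕ Fin p) :=
  comp (tau₁ t) (conjRho (tau₁ t))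

/-- `σ` is non-resonant: the eigenvalues of its linear part are
`μ₁, …, μₚ, μ₁⁻¹, …, μₚ⁻¹`, where `μ^Q ≠ 1` for every nonzero `Q ∈ ℤ^p`. -/
def IsNonResonant (σ : FormalMap (Fin p ⊕ Fin p)) : Prop :=
  ∃ μ : Fin p → ℂ, (∀ j, μ j ≠ 0) ∧
    (jacobian σ).charpoly =
      ∏ j, (Polynomial.X - Polynomial.C (μ j)) * (Polynomial.X - Polynomial.C (μ j)⁻¹) ∧
    ∀ Q : Fin p → ℤ, Q ≠ 0 → ∏ j, μ j ^ Q j ≠ 1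

/-- The complex tangent is purely elliptic (there are no hyperbolic and no complex components):
in suitable linear coordinates `(ξ, η)` of `ℂ^{2p}`, given by `(z', w') = A (ξ, η)`, the involution
`ρ₀` is `(ξ, η) ↦ (η̄, ξ̄)`, and the linear part of `τ₁` is
`ξ'_j = λ_j η_j`, `η'_j = λ_j⁻¹ ξ_j` with `λ_j > 1`. -/
def IsPurelyElliptic (τ₁ : FormalMap (Fin p ⊕ Fin p)) : Prop :=
  ∃ (lam : Fin p → ℝ) (A : Matrix (Fin p ⊕ Fin p) (Fin p ⊕ Fin p) ℂ),
    (∀ j, 1 < lam j) ∧ IsUnit A ∧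
    Matrix.fromBlocks 0 1 1 0 * A.map (starRingEnd ℂ) = A * Matrix.fromBlocks 0 1 1 0 ∧
    jacobian τ₁ * A = A * Matrix.fromBlocks 0 (Matrix.diagonal fun j => (lam j : ℂ))
      (Matrix.diagonal fun j => ((lam j)⁻¹ : ℂ)) 0

/-- `σ'` is a Poincaré–Dulac normal form of `σ`: it is formally conjugate to `σ`, i.e.
`σ' = Ψ⁻¹ ∘ σ ∘ Ψ` for a formal biholomorphic map `Ψ`, and it commutes with the linear part
of `σ`. -/
def IsPoincareDulacNormalForm [Fintype ι] (σ σ' : FormalMap ι) : Prop :=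
  (∃ Ψ Φ : FormalMap ι, AreInverse Ψ Φ ∧ σ' = comp Φ (comp σ Ψ)) ∧
    comp σ' (linearPart σ) = comp (linearPart σ) σ'

end CRSing

end

/-! The example is a skew product. Take `E_j = w_j² - S_j z_j w_j` with `S_j(0) = λ_j + λ_j⁻¹` and
`λ = (2, 3, 5)`. If `S_j` is a function of `π₁`, then `w_j ↦ S_j z_j - w_j` exchanges the two roots
of a quadratic equation and is a deck transformation, and `σ` makes two steps of the recurrence
`x_{n+1} + x_{n-1} = S_j x_n` started at `(z_j, w_j)`.

For the first two pairs `S_j = λ_j + λ_j⁻¹ + J_j`, where `J_j` (`inva`) is itself a first integral.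
These pairs are explicitly normalizable: with `ζ_j = ξ_j η_j` and `ℓ_j + ℓ_j⁻¹ = λ_j + λ_j⁻¹ + ζ_j`,
a half step is `ξ_j ↦ ℓ_j(ζ_j) ξ_j`, `η_j ↦ ℓ_j(ζ_j)⁻¹ η_j` (`kap`). For the third pair `S_3 = λ_3 +
λ_3⁻¹ + F(z_1, z_2)`: a linear second order difference equation whose potential `F` is sampled along
the orbit of the first two pairs. Its Bloch solutions `Λ⁻ⁿ κⁿ β`, where `κ` is the half step, are
described by `IsEigen`, with a multiplier `Λ(ζ_1, ζ_2)`.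

If a Poincaré–Dulac normal form converges, then so does `Λ` (`exists_convergent_isEigen`). Indeed
the normalizing coordinate of multiplier 25 vanishes for `z_3 = w_3 = 0`, and its first order part
there is an eigenfunction over the full step; a square root of the multiplier turns it into one over
the half step. The multiplier is first known as a function of the products of the normalizing
coordinates, and the passage to `ζ` converges because the multipliers of the first two pairs do
(`exists_convergent_inverse`).

It remains to choose `F` with bounded real coefficients and divergent `Λ`
(`exists_divergent_potential`). Second order perturbation theory in a term `± z_1^a z_2^b` gives, in
the coefficient of `ζ_2^b` of `Λ + Λ⁻¹`, a second difference that does not depend on the remaining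
terms of `F` (`strip_second_difference`). Its denominators include `ℓ_1(ζ_1)^a 3^{-b} - 25`, and
this produces a genuine pole (`nrm_sser_eq_top`). As odd powers of numbers close to 2 can equal `25
* 3^b`, there are poles arbitrarily close to the origin (`exists_pole`). For each of infinitely many
sparse exponents, one of the coefficients `0, 1, -1` must therefore make the trace diverge at the
corresponding pole, and terms added later do not spoil this. -/

noncomputable section

namespace CRSing

open MvPowerSeries
open scoped ENNReal NNReal

/-! ### Formal substitution and order of vanishing. -/

section Substitution

variable {ι τ υ : Type}

/-- The components of `F` vanish at the origin. -/
def NoConst (F : ι → MvPowerSeries τ ℂ) : Prop := ∀ i, constantCoeff (F i) = 0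

theorem NoConst.hasSubst [Finite ι] {F : ι → MvPowerSeries τ ℂ} (h : NoConst F) : HasSubst F :=
  hasSubst_of_constantCoeff_zero h

open Classical in
/-- Substitution of `F` as an algebra homomorphism (evaluation at the origin if `F` cannot be
substituted). -/
def pull (F : ι → MvPowerSeries τ ℂ) : MvPowerSeries ι ℂ →ₐ[ℂ] MvPowerSeries τ ℂ :=
  if h : HasSubst F then substAlgHom h else
    (Algebra.ofId ℂ _).comp
      { (constantCoeff : MvPowerSeries ι ℂ →+* ℂ) with
        commutes' := fun r => by simp [MvPowerSeries.algebraMap_apply] }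

theorem pull_eq_subst [Finite ι] {F : ι → MvPowerSeries τ ℂ} (h : NoConst F) (f : MvPowerSeries ι
    ℂ) :
    pull F f = subst F f := by
  rw [pull, dif_pos h.hasSubst, substAlgHom_apply]

@[simp] theorem pull_X [Finite ι] {F : ι → MvPowerSeries τ ℂ} (h : NoConst F) (i : ι) :
    pull F (X i) = F i := by
  rw [pull_eq_subst h, subst_X h.hasSubst]

@[simp] theorem pull_C (F : ι → MvPowerSeries τ ℂ) (c : ℂ) : pull F (C c) = C c := by
  have := (pull F).commutes c
  simpa [MvPowerSeries.algebraMap_apply] using this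

/-- The monomial `F^d`. -/
def mon (F : ι → MvPowerSeries τ ℂ) (d : ι →₀ ℕ) : MvPowerSeries τ ℂ :=
  d.prod fun i n => F i ^ n

@[simp] theorem mon_zero (F : ι → MvPowerSeries τ ℂ) : mon F 0 = 1 := by simp [mon]

theorem mon_add (F : ι → MvPowerSeries τ ℂ) (d e : ι →₀ ℕ) :
    mon F (d + e) = mon F d * mon F e := by
  classical
  exact Finsupp.prod_add_index' (by simp) (by simp [pow_add])

@[simp] theorem mon_single (F : ι → MvPowerSeries τ ℂ) (i : ι) (n : ℕ) :
    mon F (Finsupp.single i n) = F i ^ n := by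
  simp [mon]

theorem coeff_pull [Finite ι] {F : ι → MvPowerSeries τ ℂ} (h : NoConst F) (f : MvPowerSeries ι ℂ)
    (m : τ →₀ ℕ) : coeff m (pull F f) = ∑ᶠ d, coeff d f * coeff m (mon F d) := by
  rw [pull_eq_subst h, coeff_subst h.hasSubst]; rfl

theorem coeff_pull_finite [Finite ι] {F : ι → MvPowerSeries τ ℂ} (h : NoConst F) (f : MvPowerSeries
    ι ℂ)
    (m : τ →₀ ℕ) : (Function.support fun d => coeff d f * coeff m (mon F d)).Finite := by
  have := coeff_subst_finite h.hasSubst f m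
  exact this

theorem finsupp_induction_add_single {P : (ι →₀ ℕ) → Prop} (h0 : P 0)
    (hs : ∀ i d, P d → P (d + Finsupp.single i 1)) (d : ι →₀ ℕ) : P d := by
  classical
  induction hn : d.degree generalizing d with
  | zero =>
    exact (Finsupp.degree_eq_zero_iff d).mp hn ▸ h0
  | succ n ih =>
    have hd : d ≠ 0 := by rintro rfl; simp at hn
    obtain ⟨i, hi⟩ := Finsupp.ne_iff.mp hd
    have hle : Finsupp.single i 1 ≤ d := by
      rw [Finsupp.single_le_iff]
      exact Nat.one_le_iff_ne_zero.mpr hi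
    have he : d = (d - Finsupp.single i 1) + Finsupp.single i 1 := (tsub_add_cancel_of_le hle).symm
    rw [he]
    apply hs
    apply ih
    have := congrArg Finsupp.degree he
    rw [map_add, Finsupp.degree_single] at this
    omega

theorem finsupp_degree_eq_one_iff (d : ι →₀ ℕ) :
    d.degree = 1 ↔ ∃ i, Finsupp.single i 1 = d := by
  constructor
  · induction d using finsupp_induction_add_single with
    | h0 => simp
    | hs i d _ =>
      intro h
      rw [map_add, Finsupp.degree_single] at h
      have : d = 0 := (Finsupp.degree_eq_zero_iff d).mp (by omega)
      exact ⟨i, by rw [this, zero_add]⟩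
  · rintro ⟨i, rfl⟩; simp

/-- `f` vanishes to order `n` at the origin. -/
def Ord (n : ℕ) (f : MvPowerSeries τ ℂ) : Prop := ∀ m, m.degree < n → coeff m f = 0

theorem Ord.zero (f : MvPowerSeries τ ℂ) : Ord 0 f := fun m hm => absurd hm (by simp)

theorem Ord.of_zero (n : ℕ) : Ord n (0 : MvPowerSeries τ ℂ) := fun m _ => by simp

theorem Ord.mono {n k : ℕ} {f : MvPowerSeries τ ℂ} (h : Ord n f) (hk : k ≤ n) : Ord k f :=
  fun m hm => h m (by omega)

theorem Ord.add {n : ℕ} {f g : MvPowerSeries τ ℂ} (hf : Ord n f) (hg : Ord n g) :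
    Ord n (f + g) := fun m hm => by simp [hf m hm, hg m hm]

theorem Ord.sub {n : ℕ} {f g : MvPowerSeries τ ℂ} (hf : Ord n f) (hg : Ord n g) :
    Ord n (f - g) := fun m hm => by simp [hf m hm, hg m hm]

theorem Ord.mul {n k : ℕ} {f g : MvPowerSeries τ ℂ} (hf : Ord n f) (hg : Ord k g) :
    Ord (n + k) (f * g) := by
  classical
  intro m hm
  rw [coeff_mul]
  refine Finset.sum_eq_zero fun p hp => ?_
  rw [Finset.HasAntidiagonal.mem_antidiagonal] at hp
  have := congrArg Finsupp.degree hp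
  rw [map_add] at this
  by_cases h : p.1.degree < n
  · simp [hf _ h]
  · simp [hg p.2 (by omega)]

theorem ord_one_iff {f : MvPowerSeries τ ℂ} : Ord 1 f ↔ constantCoeff f = 0 := by
  constructor
  · intro h; simpa using h 0 (by simp)
  · intro h m hm
    have : m = 0 := (Finsupp.degree_eq_zero_iff m).mp (by omega)
    subst this; simpa using h

theorem Ord.mon {F : ι → MvPowerSeries τ ℂ} (h : NoConst F) (d : ι →₀ ℕ) :
    Ord d.degree (mon F d) := by
  induction d using finsupp_induction_add_single with
  | h0 => exact (Ord.zero _).mono (by simp)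
  | hs i d ih =>
    rw [mon_add, map_add, mon_single, pow_one, Finsupp.degree_single]
    exact ih.mul (ord_one_iff.mpr (h i))

theorem coeff_pull_eq_sum [Finite ι] {F : ι → MvPowerSeries τ ℂ} (h : NoConst F) (f : MvPowerSeries
    ι ℂ)
    (m : τ →₀ ℕ) (s : Finset (ι →₀ ℕ))
    (hs : ∀ d, coeff d f * coeff m (mon F d) ≠ 0 → d ∈ s) :
    coeff m (pull F f) = ∑ d ∈ s, coeff d f * coeff m (mon F d) := by
  rw [coeff_pull h]
  exact finsum_eq_sum_of_support_subset _ (fun d hd => hs d hd)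

theorem Ord.pull [Finite ι] {F : ι → MvPowerSeries τ ℂ} (h : NoConst F) {n : ℕ} {f : MvPowerSeries
    ι ℂ}
    (hf : Ord n f) : Ord n (pull F f) := by
  intro m hm
  rw [coeff_pull_eq_sum h f m ∅, Finset.sum_empty]
  intro d hd
  exfalso
  apply hd
  by_cases hdn : d.degree < n
  · simp [hf d hdn]
  · rw [Ord.mon h d m (by omega), mul_zero]

@[simp] theorem constantCoeff_pull [Finite ι] {F : ι → MvPowerSeries τ ℂ} (h : NoConst F)
    (f : MvPowerSeries ι ℂ) : constantCoeff (CRSing.pull F f) = constantCoeff f := by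
  have h1 : Ord 1 (f - C (constantCoeff f)) := ord_one_iff.mpr (by simp)
  have h2 := ord_one_iff.mp (h1.pull h)
  rw [map_sub, map_sub, pull_C, constantCoeff_C, sub_eq_zero] at h2
  exact h2

theorem NoConst.pull [Finite τ] {F : ι → MvPowerSeries τ ℂ} {G : τ → MvPowerSeries υ ℂ}
    (hF : NoConst F) (hG : NoConst G) : NoConst fun i => CRSing.pull G (F i) :=
  fun i => by rw [constantCoeff_pull hG, hF i]

theorem pull_pull [Finite ι] [Finite τ] {F : ι → MvPowerSeries τ ℂ} {G : τ → MvPowerSeries υ ℂ}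
    (hF : NoConst F) (hG : NoConst G) (f : MvPowerSeries ι ℂ) :
    CRSing.pull G (CRSing.pull F f) = CRSing.pull (fun i => CRSing.pull G (F i)) f := by
  rw [pull_eq_subst hF, pull_eq_subst hG, pull_eq_subst (hF.pull hG),
    subst_comp_subst_apply hF.hasSubst hG.hasSubst]
  simp only [pull_eq_subst hG]

theorem noConst_X : NoConst (X : ι → MvPowerSeries ι ℂ) := fun i => by simp

@[simp] theorem pull_X_self [Finite ι] (f : MvPowerSeries ι ℂ) : CRSing.pull X f = f := by
  rw [pull_eq_subst noConst_X, subst_self]; rfl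

theorem coeff_single_mul (i : τ) (f g : MvPowerSeries τ ℂ) :
    coeff (Finsupp.single i 1) (f * g) = constantCoeff f * coeff (Finsupp.single i 1) g +
      coeff (Finsupp.single i 1) f * constantCoeff g := by
  classical
  rw [coeff_mul, Finsupp.antidiagonal_single]
  simp [Finset.Nat.antidiagonal_succ]

theorem coeff_single_eq_zero_of_ord {f : MvPowerSeries τ ℂ} (h : Ord 2 f) (i : τ) :
    coeff (Finsupp.single i 1) f = 0 := h _ (by simp)

/-- The linear part of a composition. -/
theorem coeff_single_pull [Fintype ι] {F : ι → MvPowerSeries τ ℂ} (h : NoConst F)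
    (f : MvPowerSeries ι ℂ) (i : τ) :
    coeff (Finsupp.single i 1) (CRSing.pull F f) =
      ∑ j, coeff (Finsupp.single j 1) f * coeff (Finsupp.single i 1) (F j) := by
  classical
  set g : MvPowerSeries ι ℂ :=
    C (constantCoeff f) + ∑ j, C (coeff (Finsupp.single j 1) f) * X j with hg
  have h2 : Ord 2 (f - g) := by
    intro m hm
    by_cases hm0 : m = 0
    · subst hm0
      simp [hg]
    · have hm1 : m.degree = 1 := by
        have : m.degree ≠ 0 := fun h => hm0 ((Finsupp.degree_eq_zero_iff m).mp h)
        omega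
      obtain ⟨j, hj⟩ := (finsupp_degree_eq_one_iff m).mp hm1
      subst hj
      rw [map_sub, hg, map_add, map_sum, coeff_C_of_ne_zero (by simp)]
      simp [coeff_C_mul, coeff_index_single_X]
  have h3 := coeff_single_eq_zero_of_ord (h2.pull h) i
  rw [map_sub, map_sub, sub_eq_zero] at h3
  rw [h3, hg, map_add, map_sum, map_add, map_sum, pull_C, coeff_C_of_ne_zero (by simp), zero_add]
  refine Finset.sum_congr rfl fun j _ => ?_
  rw [map_mul, pull_C, pull_X h, coeff_C_mul]

/-- Substitution respects agreement to a given order, with a gain for series of order two. -/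
theorem Ord.mon_sub {U V : ι → MvPowerSeries τ ℂ} (hU : NoConst U) (hV : NoConst V) {n : ℕ}
    (h : ∀ i, Ord n (U i - V i)) (d : ι →₀ ℕ) :
    ∀ k, k + 1 ≤ n + d.degree → Ord k (CRSing.mon U d - CRSing.mon V d) := by
  induction d using finsupp_induction_add_single with
  | h0 => intro k _; simpa using Ord.of_zero k
  | hs i d ih =>
    intro k hk
    rw [map_add, Finsupp.degree_single] at hk
    have he : CRSing.mon U (d + Finsupp.single i 1) - CRSing.mon V (d + Finsupp.single i 1) =
      CRSing.mon U d * (U i - V i) + (CRSing.mon U d - CRSing.mon V d) * V i := by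
      simp only [mon_add, mon_single]; ring
    rw [he]
    refine Ord.add (((Ord.mon hU d).mul (h i)).mono (by omega)) ?_
    rcases Nat.eq_zero_or_pos k with rfl | hk0
    · exact Ord.zero _
    · exact ((ih (k - 1) (by omega)).mul (ord_one_iff.mpr (hV i))).mono (by omega)

/-- The gain of one order makes `U ↦ α + f(U)` a contraction for the adic topology, which drives all
the fixed point arguments. -/
theorem Ord.pull_sub_pull [Finite ι] {U V : ι → MvPowerSeries τ ℂ} (hU : NoConst U) (hV : NoConst
    V) {n : ℕ}
    (h : ∀ i, Ord n (U i - V i)) {f : MvPowerSeries ι ℂ} (hf : Ord 2 f) :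
    Ord (n + 1) (CRSing.pull U f - CRSing.pull V f) := by
  intro m hm
  rw [map_sub, coeff_pull hU, coeff_pull hV, sub_eq_zero]
  refine finsum_congr fun d => ?_
  by_cases hd : d.degree < 2
  · simp [hf d hd]
  · have := Ord.mon_sub hU hV h d (n + 1) (by omega) m hm
    rw [map_sub, sub_eq_zero] at this
    rw [this]

end Substitution

/-! ### Convergence through weighted `ℓ¹` norms, and an analytic fixed point theorem. -/

section Convergence

variable {ι τ : Type}

/-- The weighted `ℓ¹` norm on the polydisc of radius `r`. -/
def nrm (r : ℝ≥0) (f : MvPowerSeries τ ℂ) : ℝ≥0∞ := ∑' m, ‖coeff m f‖ₑ * (r : ℝ≥0∞) ^ m.degree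

theorem converges_iff {f : MvPowerSeries τ ℂ} : Converges f ↔ ∃ r : ℝ≥0, 0 < r ∧ nrm r f ≠ ∞ := by
  have key : ∀ r : ℝ≥0, (Summable fun m : τ →₀ ℕ => ‖coeff m f‖ * (r : ℝ) ^ m.degree) ↔
      nrm r f ≠ ∞ := by
    intro r
    have : (fun m : τ →₀ ℕ => ‖coeff m f‖ * (r : ℝ) ^ m.degree) =
        fun m => ((‖coeff m f‖₊ * r ^ m.degree : ℝ≥0) : ℝ) := by ext m; simp
    rw [this, NNReal.summable_coe, ← ENNReal.tsum_coe_ne_top_iff_summable, nrm]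
    simp only [ENNReal.coe_mul, ENNReal.coe_pow]; rfl
  constructor
  · rintro ⟨r, hr, h⟩
    refine ⟨⟨r, hr.le⟩, hr, (key _).mp h⟩
  · rintro ⟨r, hr, h⟩
    exact ⟨r, hr, (key r).mpr h⟩

theorem nrm_mono {r s : ℝ≥0} (h : r ≤ s) (f : MvPowerSeries τ ℂ) : nrm r f ≤ nrm s f := by
  unfold nrm; gcongr

theorem nrm_add_le (r : ℝ≥0) (f g : MvPowerSeries τ ℂ) : nrm r (f + g) ≤ nrm r f + nrm r g := by
  unfold nrm
  rw [← ENNReal.tsum_add]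
  refine ENNReal.tsum_le_tsum fun m => ?_
  rw [← add_mul, map_add]
  gcongr
  exact enorm_add_le _ _

theorem nrm_mul_le (r : ℝ≥0) (f g : MvPowerSeries τ ℂ) : nrm r (f * g) ≤ nrm r f * nrm r g := by
  classical
  have h1 : nrm r f * nrm r g = ∑' p : (τ →₀ ℕ) × (τ →₀ ℕ),
      (‖coeff p.1 f‖ₑ * (r : ℝ≥0∞) ^ p.1.degree) * (‖coeff p.2 g‖ₑ * (r : ℝ≥0∞) ^ p.2.degree) := by
    rw [ENNReal.tsum_prod', nrm, nrm, ← ENNReal.tsum_mul_right]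
    simp_rw [ENNReal.tsum_mul_left]
  rw [h1, ← Finset.HasAntidiagonal.sigmaAntidiagonalEquivProd.tsum_eq, ENNReal.tsum_sigma']
  refine ENNReal.tsum_le_tsum fun m => ?_
  rw [tsum_fintype, coeff_mul]
  calc ‖∑ p ∈ Finset.HasAntidiagonal.antidiagonal m, coeff p.1 f * coeff p.2 g‖ₑ * (r : ℝ≥0∞) ^
      m.degree
      ≤ (∑ p ∈ Finset.HasAntidiagonal.antidiagonal m, ‖coeff p.1 f * coeff p.2 g‖ₑ) * (r : ℝ≥0∞) ^
          m.degree := by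
        gcongr; exact enorm_sum_le _ _
    _ = ∑ p ∈ Finset.HasAntidiagonal.antidiagonal m, (‖coeff p.1 f‖ₑ * (r : ℝ≥0∞) ^ p.1.degree) *
          (‖coeff p.2 g‖ₑ * (r : ℝ≥0∞) ^ p.2.degree) := by
        rw [Finset.sum_mul]
        refine Finset.sum_congr rfl fun p hp => ?_
        rw [← Finset.HasAntidiagonal.mem_antidiagonal.mp hp, map_add, pow_add, enorm_mul]; ring
    _ ≤ _ := by
        rw [← Finset.sum_coe_sort]
        rfl

theorem nrm_C (r : ℝ≥0) (c : ℂ) : nrm r (C c : MvPowerSeries τ ℂ) = ‖c‖ₑ := by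
  rw [nrm, tsum_eq_single 0]
  · simp
  · intro m hm; rw [coeff_C_of_ne_zero hm]; simp

theorem nrm_X (r : ℝ≥0) (i : τ) : nrm r (X i : MvPowerSeries τ ℂ) = r := by
  classical
  rw [nrm, tsum_eq_single (Finsupp.single i 1)]
  · simp
  · intro m hm; rw [coeff_X, if_neg hm]; simp

theorem nrm_mon_le {F : ι → MvPowerSeries τ ℂ} {r s : ℝ≥0} (h : ∀ i, nrm r (F i) ≤ s)
    (d : ι →₀ ℕ) : nrm r (mon F d) ≤ (s : ℝ≥0∞) ^ d.degree := by
  induction d using finsupp_induction_add_single with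
  | h0 => rw [mon_zero, ← map_one C, nrm_C]; simp
  | hs i d ih =>
    rw [mon_add, map_add, mon_single, pow_one, Finsupp.degree_single, pow_add, pow_one]
    exact (nrm_mul_le _ _ _).trans (mul_le_mul' ih (h i))

/-- Since the norm is submultiplicative, `F^d` has norm at most `s ^ |d|`; it remains to exchange
the two summations. -/
theorem nrm_pull_le [Finite ι] {F : ι → MvPowerSeries τ ℂ} (hF : NoConst F) {r s : ℝ≥0}
    (h : ∀ i, nrm r (F i) ≤ s) (f : MvPowerSeries ι ℂ) : nrm r (pull F f) ≤ nrm s f := by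
  calc nrm r (pull F f)
      ≤ ∑' m : τ →₀ ℕ, ∑' d, (‖coeff d f‖ₑ * ‖coeff m (mon F d)‖ₑ) * (r : ℝ≥0∞) ^ m.degree := by
        unfold nrm
        refine ENNReal.tsum_le_tsum fun m => ?_
        rw [ENNReal.tsum_mul_right]
        gcongr
        rw [coeff_pull hF, finsum_eq_sum _ (coeff_pull_finite hF f m)]
        refine (enorm_sum_le _ _).trans ?_
        simp_rw [enorm_mul]
        exact ENNReal.sum_le_tsum _
    _ = ∑' d, ‖coeff d f‖ₑ * nrm r (mon F d) := by
        rw [ENNReal.tsum_comm]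
        simp_rw [nrm, ← ENNReal.tsum_mul_left, mul_assoc]
    _ ≤ nrm s f := by
        unfold nrm
        refine ENNReal.tsum_le_tsum fun d => ?_
        gcongr
        exact nrm_mon_le h d

/-- Shrinking the radius makes the norm of a series of order `n` small. -/
theorem nrm_mul_le_of_ord {n : ℕ} {f : MvPowerSeries τ ℂ} (h : Ord n f) (r : ℝ≥0) {t : ℝ≥0}
    (ht : t ≤ 1) : nrm (t * r) f ≤ (t : ℝ≥0∞) ^ n * nrm r f := by
  unfold nrm
  rw [← ENNReal.tsum_mul_left]
  refine ENNReal.tsum_le_tsum fun m => ?_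
  by_cases hm : m.degree < n
  · simp [h m hm]
  · rw [ENNReal.coe_mul, mul_pow]
    have : (t : ℝ≥0∞) ^ m.degree ≤ (t : ℝ≥0∞) ^ n :=
      pow_le_pow_right_of_le_one' (by exact_mod_cast ht) (by omega)
    calc _ = (t : ℝ≥0∞) ^ m.degree * (‖coeff m f‖ₑ * (r : ℝ≥0∞) ^ m.degree) := by ring
      _ ≤ _ := by gcongr

theorem Converges.exists_nrm_le {f : MvPowerSeries τ ℂ} (hf : Converges f)
    (h0 : constantCoeff f = 0) {s : ℝ≥0} (hs : 0 < s) :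
    ∃ r : ℝ≥0, 0 < r ∧ ∀ r' ≤ r, nrm r' f ≤ s := by
  obtain ⟨r, hr, h⟩ := converges_iff.mp hf
  obtain ⟨K, hK⟩ : ∃ K : ℝ≥0, (K : ℝ≥0∞) = nrm r f := ⟨_, ENNReal.coe_toNNReal h⟩
  set t : ℝ≥0 := min 1 (s / (K + 1))
  have ht : 0 < t := lt_min one_pos (by positivity)
  refine ⟨t * r, by positivity, fun r' hr' => (nrm_mono hr' f).trans ?_⟩
  refine (nrm_mul_le_of_ord (ord_one_iff.mpr h0) r (min_le_left _ _)).trans ?_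
  rw [← hK, pow_one]
  have : t * K ≤ s := by
    calc t * K ≤ s / (K + 1) * (K + 1) := by gcongr; exact min_le_right _ _; simp
      _ = s := by field_simp
  exact_mod_cast this

theorem exists_common_radius [Finite ι] {P : ι → ℝ≥0 → Prop}
    (h : ∀ i, ∃ r : ℝ≥0, 0 < r ∧ ∀ r' ≤ r, P i r') :
    ∃ r : ℝ≥0, 0 < r ∧ ∀ r' ≤ r, ∀ i, P i r' := by
  classical
  have := Fintype.ofFinite ι
  choose r hr hP using h
  by_cases hne : Nonempty ι
  · refine ⟨Finset.univ.inf' Finset.univ_nonempty r, ?_, fun r' hr' i => hP i r' ?_⟩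
    · rw [Finset.lt_inf'_iff]; exact fun i _ => hr i
    · exact hr'.trans (Finset.inf'_le _ (Finset.mem_univ i))
  · exact ⟨1, one_pos, fun r' _ i => absurd ⟨i⟩ hne⟩

theorem Converges.add {f g : MvPowerSeries τ ℂ} (hf : Converges f) (hg : Converges g) :
    Converges (f + g) := by
  obtain ⟨r, hr, h⟩ := converges_iff.mp hf
  obtain ⟨s, hs, h'⟩ := converges_iff.mp hg
  refine converges_iff.mpr ⟨min r s, lt_min hr hs, ne_top_of_le_ne_top ?_ (nrm_add_le _ _ _)⟩
  exact ENNReal.add_ne_top.mpr ⟨ne_top_of_le_ne_top h (nrm_mono (min_le_left _ _) _),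
    ne_top_of_le_ne_top h' (nrm_mono (min_le_right _ _) _)⟩

theorem Converges.mul {f g : MvPowerSeries τ ℂ} (hf : Converges f) (hg : Converges g) :
    Converges (f * g) := by
  obtain ⟨r, hr, h⟩ := converges_iff.mp hf
  obtain ⟨s, hs, h'⟩ := converges_iff.mp hg
  refine converges_iff.mpr ⟨min r s, lt_min hr hs, ne_top_of_le_ne_top ?_ (nrm_mul_le _ _ _)⟩
  exact ENNReal.mul_ne_top (ne_top_of_le_ne_top h (nrm_mono (min_le_left _ _) _))
    (ne_top_of_le_ne_top h' (nrm_mono (min_le_right _ _) _))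

theorem converges_C (c : ℂ) : Converges (C c : MvPowerSeries τ ℂ) :=
  converges_iff.mpr ⟨1, one_pos, by rw [nrm_C]; simp⟩

theorem converges_X (i : τ) : Converges (X i : MvPowerSeries τ ℂ) :=
  converges_iff.mpr ⟨1, one_pos, by rw [nrm_X]; simp⟩

theorem Converges.neg {f : MvPowerSeries τ ℂ} (hf : Converges f) : Converges (-f) := by
  have := (converges_C (τ := τ) (-1)).mul hf
  simpa using this

theorem Converges.sub {f g : MvPowerSeries τ ℂ} (hf : Converges f) (hg : Converges g) :
    Converges (f - g) := by
  rw [sub_eq_add_neg]; exact hf.add hg.neg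

theorem Converges.pow {f : MvPowerSeries τ ℂ} (hf : Converges f) (n : ℕ) : Converges (f ^ n) := by
  induction n with
  | zero => simpa using converges_C (τ := τ) 1
  | succ n ih => rw [pow_succ]; exact ih.mul hf

theorem Converges.pull [Finite ι] {F : ι → MvPowerSeries τ ℂ} (hF : NoConst F)
    (hc : ∀ i, Converges (F i)) {f : MvPowerSeries ι ℂ} (hf : Converges f) :
    Converges (CRSing.pull F f) := by
  obtain ⟨s, hs, h⟩ := converges_iff.mp hf
  obtain ⟨r, hr, hr'⟩ := exists_common_radius fun i => (hc i).exists_nrm_le (hF i) hs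
  exact converges_iff.mpr ⟨r, hr, ne_top_of_le_ne_top h (nrm_pull_le hF (hr' r le_rfl) f)⟩

/-- A formal solution of `U = α + h(U)`, where `h` has order two, exists. -/
theorem exists_fixedPoint [Finite ι] {α : ι → MvPowerSeries τ ℂ} (hα : NoConst α)
    {h : ι → MvPowerSeries ι ℂ} (hh : ∀ i, Ord 2 (h i)) :
    ∃ U : ι → MvPowerSeries τ ℂ, NoConst U ∧ ∀ i, U i = α i + pull U (h i) := by
  -- Picard iteration: the `n`-th iterate is correct up to degree `n`, so the coefficient at `m` of
  -- the limit is read off the iterate of index `m.degree`.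
  let S : ℕ → ι → MvPowerSeries τ ℂ := fun n =>
    Nat.rec (fun _ => 0) (fun _ U i => α i + pull U (h i)) n
  have hS : ∀ n i, S (n + 1) i = α i + pull (S n) (h i) := fun n i => rfl
  have hS0 : ∀ n, NoConst (S n) := by
    intro n
    induction n with
    | zero => intro i; simp [S]
    | succ n ih =>
      intro i
      rw [hS, map_add, hα i, constantCoeff_pull ih, zero_add]
      exact ord_one_iff.mp ((hh i).mono (by norm_num))
  have hstep : ∀ n i, Ord (n + 1) (S (n + 1) i - S n i) := by
    intro n
    induction n with
    | zero =>
      intro i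
      rw [zero_add, ord_one_iff, map_sub, hS0 1 i, hS0 0 i, sub_zero]
    | succ n ih =>
      intro i
      have := Ord.pull_sub_pull (hS0 (n + 1)) (hS0 n) ih (hh i)
      rw [hS (n + 1), hS n]
      simpa using this
  have hagree : ∀ n k i, n ≤ k → Ord (n + 1) (S k i - S n i) := by
    intro n k i hk
    induction k, hk using Nat.le_induction with
    | base => simpa using Ord.of_zero _
    | succ k hk ih =>
      have := ((hstep k i).mono (by omega : n + 1 ≤ k + 1)).add ih
      simpa using this
  let U : ι → MvPowerSeries τ ℂ := fun i m => coeff m (S m.degree i)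
  have hU : ∀ i m, coeff m (U i) = coeff m (S m.degree i) := fun i m => rfl
  have hUS : ∀ n i, Ord (n + 1) (U i - S n i) := by
    intro n i m hm
    have := hagree m.degree n i (by omega) m (by omega)
    rw [map_sub, sub_eq_zero] at this
    rw [map_sub, hU, this, sub_self]
  have hU0 : NoConst U := fun i => by
    have := ord_one_iff.mp ((hUS 0 i).mono (by omega))
    rw [map_sub, hS0, sub_zero] at this
    exact this
  refine ⟨U, hU0, fun i => ?_⟩
  ext m
  have h1 := hUS (m.degree + 1) i m (by omega)
  have h2 := Ord.pull_sub_pull hU0 (hS0 m.degree) (hUS m.degree) (hh i) m (by omega)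
  rw [map_sub, sub_eq_zero] at h1 h2
  rw [h1, hS, map_add, map_add, h2]

/-- A formal solution of `U = α + h(U)` converges when `α` and `h` do. -/
theorem converges_of_fixedPoint [Finite ι] {α : ι → MvPowerSeries τ ℂ}
    {h : ι → MvPowerSeries ι ℂ} (hh : ∀ i, Ord 2 (h i)) (cα : ∀ i, Converges (α i))
    (ch : ∀ i, Converges (h i)) {U : ι → MvPowerSeries τ ℂ} (hU : NoConst U)
    (hUeq : ∀ i, U i = α i + pull U (h i)) (i : ι) : Converges (U i) := by
  have hα : NoConst α := fun i => by
    have := congrArg constantCoeff (hUeq i)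
    rw [hU, map_add, constantCoeff_pull hU, ord_one_iff.mp ((hh i).mono (by norm_num)),
      add_zero] at this
    exact this.symm
  -- As `h` has order two, its norm on the polydisc of radius `s` is `O(s²)`, which is below `s / 2`
  -- for small `s`.
  have hs : ∃ s : ℝ≥0, 0 < s ∧ ∀ i, nrm s (h i) ≤ (s / 2 : ℝ≥0) := by
    have hs1 : ∀ i, ∃ t : ℝ≥0, 0 < t ∧ ∀ t' ≤ t, nrm t' (h i) ≤ (t' / 2 : ℝ≥0) := by
      intro i
      obtain ⟨r, hr, hfin⟩ := converges_iff.mp (ch i)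
      obtain ⟨K, hK⟩ : ∃ K : ℝ≥0, (K : ℝ≥0∞) = nrm r (h i) := ⟨_, ENNReal.coe_toNNReal hfin⟩
      refine ⟨min r (r ^ 2 / (2 * (K + 1))), lt_min hr (by positivity), fun t' ht' => ?_⟩
      have h1 : t' / r ≤ 1 := by
        rw [div_le_one hr]; exact ht'.trans (min_le_left _ _)
      have := nrm_mul_le_of_ord (hh i) r h1
      rw [div_mul_cancel₀ _ hr.ne', ← hK] at this
      refine this.trans ?_
      have h2 : t' ≤ r ^ 2 / (2 * (K + 1)) := ht'.trans (min_le_right _ _)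
      have h3 : (t' / r) ^ 2 * K ≤ t' / 2 := by
        calc (t' / r) ^ 2 * K ≤ (t' / r) ^ 2 * (K + 1) := by gcongr; simp
          _ = t' * (K + 1) / r ^ 2 * t' := by field_simp
          _ ≤ t' * (K + 1) / r ^ 2 * (r ^ 2 / (2 * (K + 1))) := by gcongr
          _ = t' / 2 := by field_simp
      exact_mod_cast h3
    obtain ⟨s, hs, h⟩ := exists_common_radius hs1
    exact ⟨s, hs, h s le_rfl⟩
  obtain ⟨s, hs, hsh⟩ := hs
  obtain ⟨r, hr, hrα⟩ := exists_common_radius fun i =>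
    (cα i).exists_nrm_le (hα i) (s := s / 2) (by positivity)
  -- The Taylor polynomials of `U` stay in the ball of radius `s`: each is a truncation of `α + h`
  -- of the preceding one, of norm at most `s / 2 + s / 2`. The bound passes to `U` through finite
  -- partial sums.
  let T : ℕ → ι → MvPowerSeries τ ℂ := fun n i m => if m.degree < n + 1 then coeff m (U i) else 0
  have hT : ∀ n i m, coeff m (T n i) = if m.degree < n + 1 then coeff m (U i) else 0 :=
    fun n i m => rfl
  have hT0 : ∀ n, NoConst (T n) := by
    intro n i
    rw [← coeff_zero_eq_constantCoeff_apply, hT]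
    simp [hU i]
  have hbound : ∀ n i, nrm r (T n i) ≤ s := by
    intro n
    induction n with
    | zero =>
      intro i
      have : T 0 i = 0 := by
        ext m
        rw [hT]
        split_ifs with hm
        · exact ord_one_iff.mpr (hU i) m (by omega)
        · simp
      rw [this]; simp [nrm]
    | succ n ih =>
      intro i
      have hle : nrm r (T (n + 1) i) ≤ nrm r (α i + pull (T n) (h i)) := by
        unfold nrm
        refine ENNReal.tsum_le_tsum fun m => ?_
        rw [hT]
        split_ifs with hm
        · have hd : ∀ i, Ord (n + 1) (U i - T n i) := by
            intro i m hm
            rw [map_sub, hT, if_pos hm, sub_self]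
          have := Ord.pull_sub_pull hU (hT0 n) hd (hh i) m hm
          rw [map_sub, sub_eq_zero] at this
          rw [hUeq i, map_add, map_add, this]
        · simp
      calc nrm r (T (n + 1) i) ≤ nrm r (α i + pull (T n) (h i)) := hle
        _ ≤ nrm r (α i) + nrm r (pull (T n) (h i)) := nrm_add_le _ _ _
        _ ≤ (s / 2 : ℝ≥0) + (s / 2 : ℝ≥0) := by
            gcongr
            · exact hrα r le_rfl i
            · exact (nrm_pull_le (hT0 n) ih _).trans (hsh i)
        _ = s := by rw [← ENNReal.coe_add, add_halves]
  refine converges_iff.mpr ⟨r, hr, ne_top_of_le_ne_top ENNReal.coe_ne_top (b := (s : ℝ≥0∞)) ?_⟩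
  rw [nrm, ENNReal.tsum_eq_iSup_sum]
  refine iSup_le fun A => le_trans ?_ (hbound (A.sup Finsupp.degree) i)
  refine le_trans (le_of_eq ?_) (ENNReal.sum_le_tsum A)
  refine Finset.sum_congr rfl fun m hm => ?_
  rw [hT, if_pos (Nat.lt_succ_of_le (Finset.le_sup (f := Finsupp.degree) hm))]

end Convergence

end CRSing
end

noncomputable section

namespace CRSing

open MvPowerSeries
open scoped ENNReal NNReal

/-! ### Inverses, square roots and inverse maps of convergent series. -/

section Analytic

variable {ι τ : Type}

/-- After normalization `f` and `g` become `1 + t` and `1 + y`, and `y = -t - y t` is a fixed point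
equation. Adjoining `t` as a second unknown makes its nonlinear part a series in the unknowns only.
-/
theorem Converges.of_mul_eq_one {f g : MvPowerSeries τ ℂ} (hf : Converges f) (h : f * g = 1) :
    Converges g := by
  have h0 : constantCoeff f * constantCoeff g = 1 := by
    rw [← map_mul, h, map_one]
  have hf0 : constantCoeff f ≠ 0 := left_ne_zero_of_mul_eq_one h0
  set a := constantCoeff f
  set b := constantCoeff g
  have hab : (C a : MvPowerSeries τ ℂ) * C b = 1 := by rw [← map_mul, h0, map_one]
  set t : MvPowerSeries τ ℂ := C b * f - 1 with ht
  set y : MvPowerSeries τ ℂ := C a * g - 1 with hy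
  have ht0 : constantCoeff t = 0 := by rw [ht]; simp [b]; rw [mul_comm]; exact sub_eq_zero.mpr h0
  have hy0 : constantCoeff y = 0 := by rw [hy]; simp [a]; exact sub_eq_zero.mpr h0
  have hty : y = -t + -(y * t) := by
    have : (1 + t) * (1 + y) = 1 := by
      rw [ht, hy]
      linear_combination (C a * C b) * h + hab
    linear_combination this
  have ct : Converges t := ((converges_C b).mul hf).sub (by simpa using converges_C (τ := τ) 1)
  have hU : NoConst ![y, t] := fun i => by fin_cases i <;> simp [ht0, hy0]
  have cy : Converges y := by
    refine converges_of_fixedPoint (ι := Fin 2) (α := ![-t, t])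
      (h := ![-(X 0 * X 1), 0]) ?_ ?_ ?_ hU ?_ 0
    · intro i
      fin_cases i
      · have : Ord 2 ((X 0 : MvPowerSeries (Fin 2) ℂ) * X 1) :=
          Ord.mul (ord_one_iff.mpr (by simp)) (ord_one_iff.mpr (by simp))
        simpa using (Ord.of_zero 2).sub this
      · exact Ord.of_zero 2
    · intro i; fin_cases i
      · exact ct.neg
      · exact ct
    · intro i; fin_cases i
      · exact ((converges_X 0).mul (converges_X 1)).neg
      · simpa using converges_C (τ := Fin 2) 0
    · intro i
      fin_cases i
      · simpa [pull_X hU] using hty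
      · simp
  have hg : g = C b * (1 + y) := by
    rw [hy]; linear_combination -g * hab
  rw [hg]
  exact (converges_C b).mul ((by simpa using converges_C (τ := τ) 1 : Converges 1).add cy)

theorem ord_two_C_mul_X_sq (c : ℂ) : Ord 2 (C c * X () ^ 2 : MvPowerSeries Unit ℂ) := by
  have h : Ord 1 (X () : MvPowerSeries Unit ℂ) := ord_one_iff.mpr (by simp)
  have := (Ord.zero (C c : MvPowerSeries Unit ℂ)).mul (h.mul h)
  simpa [pow_two] using this

/-- The root is `s₀ (1 + U)`, where `U = u - U² / 2` and `1 + 2 u = a / s₀²`. -/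
theorem exists_sqrt {a : MvPowerSeries τ ℂ} {s₀ : ℂ} (h0 : s₀ ≠ 0)
    (ha : constantCoeff a = s₀ ^ 2) : ∃ s, s ^ 2 = a ∧ constantCoeff s = s₀ := by
  set u : MvPowerSeries τ ℂ := C (1 / (2 * s₀ ^ 2)) * a - C (1 / 2) with hu
  have hu0 : constantCoeff u = 0 := by rw [hu]; simp [ha]; field_simp; norm_num
  obtain ⟨U, hU, hUe⟩ := exists_fixedPoint (ι := Unit) (α := fun _ => u) (fun _ => hu0)
    (h := fun _ => C (-1 / 2) * X () ^ 2) (fun _ => ord_two_C_mul_X_sq _)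
  have h1 := hUe ()
  rw [map_mul, map_pow, pull_C, pull_X hU] at h1
  refine ⟨C s₀ * (1 + U ()), ?_, by simp [hU ()]⟩
  have e1 : (C (-1 / 2) : MvPowerSeries τ ℂ) * C (2 : ℂ) = -1 := by rw [← map_mul]; norm_num
  have e2 : (C (1 / 2) : MvPowerSeries τ ℂ) * C (2 : ℂ) = 1 := by rw [← map_mul]; norm_num
  have e3 : (C (1 / (2 * s₀ ^ 2)) : MvPowerSeries τ ℂ) * (C (2 : ℂ) * C s₀ ^ 2) = 1 := by
    rw [← map_pow, ← map_mul, ← map_mul, one_div_mul_cancel (by simp [h0]), map_one]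
  have e4 : (C (2 : ℂ) : MvPowerSeries τ ℂ) = 2 := map_ofNat _ 2
  rw [e4] at e1 e2 e3
  rw [hu] at h1
  linear_combination (2 * C s₀ ^ 2) * h1 + (a) * e3 - C s₀ ^ 2 * e2 + C s₀ ^ 2 * U () ^ 2 * e1

/-- The given root solves the same fixed point equation as in `exists_sqrt`, so it inherits
convergence from its square. -/
theorem Converges.of_sq {s : MvPowerSeries τ ℂ} (h0 : constantCoeff s ≠ 0)
    (h : Converges (s ^ 2)) : Converges s := by
  set s₀ := constantCoeff s with hs₀
  have e0 : (C s₀⁻¹ : MvPowerSeries τ ℂ) * C s₀ = 1 := by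
    rw [← map_mul, inv_mul_cancel₀ h0, map_one]
  have e2 : (C (1 / 2) : MvPowerSeries τ ℂ) * 2 = 1 := by
    have : (C (2 : ℂ) : MvPowerSeries τ ℂ) = 2 := map_ofNat _ 2
    rw [← this, ← map_mul]; norm_num
  have e3 : (C (-1 / 2) : MvPowerSeries τ ℂ) = - C (1 / 2) := by rw [← map_neg]; norm_num
  set t := C s₀⁻¹ * s - 1 with ht
  have ht0 : NoConst fun _ : Unit => t := fun _ => by
    rw [ht]; simp [← hs₀, inv_mul_cancel₀ h0]
  have c1 : Converges (1 : MvPowerSeries τ ℂ) := by simpa using converges_C (τ := τ) 1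
  have ct : Converges t := by
    refine converges_of_fixedPoint (ι := Unit)
      (α := fun _ => C (1 / 2) * (C s₀⁻¹ ^ 2 * s ^ 2 - 1))
      (h := fun _ => C (-1 / 2) * X () ^ 2) (fun _ => ord_two_C_mul_X_sq _)
      (fun _ => (converges_C _).mul ((((converges_C _).pow 2).mul h).sub c1))
      (fun _ => (converges_C _).mul ((converges_X _).pow 2)) ht0 (fun _ => ?_) ()
    rw [map_mul, map_pow, pull_C, pull_X ht0, e3, ht]
    linear_combination -(C s₀⁻¹ * s - 1) * e2
  have hs : s = C s₀ * (1 + t) := by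
    rw [ht]; linear_combination -s * e0
  rw [hs]
  exact (converges_C _).mul (c1.add ct)

/-- The root `ℓ` of `ℓ² - (λ + λ⁻¹ + x) ℓ + 1 = 0` with `ℓ(0) = λ`. -/
theorem exists_ell {lam : ℂ} (h0 : lam ≠ 0) (h1 : lam ^ 2 ≠ 1) :
    ∃ l : MvPowerSeries Unit ℂ, l ^ 2 - (C (lam + lam⁻¹) + X ()) * l + 1 = 0 ∧
      constantCoeff l = lam ∧ Converges l := by
  have hd : lam - lam⁻¹ ≠ 0 := by
    intro h
    apply h1
    field_simp at h
    linear_combination h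
  -- The quadratic formula; at the origin the discriminant is `(λ - λ⁻¹)²`, which is nonzero.
  obtain ⟨s, hs, hs0⟩ := exists_sqrt (a := (C (lam + lam⁻¹) + X () : MvPowerSeries Unit ℂ) ^ 2 - C
      4)
    hd (by simp; field_simp; ring)
  have cb : Converges (C (lam + lam⁻¹) + X () : MvPowerSeries Unit ℂ) :=
    (converges_C _).add (converges_X _)
  have cs : Converges s := by
    refine Converges.of_sq (by rw [hs0]; exact hd) ?_
    rw [hs]
    exact (cb.pow 2).sub (converges_C _)
  refine ⟨C (1 / 2) * (C (lam + lam⁻¹) + X () + s), ?_, ?_, (converges_C _).mul (cb.add cs)⟩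
  · have e2 : (C (1 / 2) : MvPowerSeries Unit ℂ) * 2 = 1 := by
      have : (C (2 : ℂ) : MvPowerSeries Unit ℂ) = 2 := map_ofNat _ 2
      rw [← this, ← map_mul]; norm_num
    have e4 : (C (4 : ℂ) : MvPowerSeries Unit ℂ) = 4 := map_ofNat _ 4
    rw [e4] at hs
    generalize (C (lam + lam⁻¹) + X () : MvPowerSeries Unit ℂ) = b at *
    generalize (C (1 / 2) : MvPowerSeries Unit ℂ) = c at *
    linear_combination c ^ 2 * hs + (c * b ^ 2 + c * b * s - 2 * c - 1) * e2
  · simp [hs0]; ring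

/-- The inverse of a formal map whose linear part is diagonal and invertible. -/
theorem exists_inverse [Fintype ι] {D : ι → MvPowerSeries ι ℂ} {c : ι → ℂ}
    (hc : ∀ i, c i ≠ 0) (hlin : ∀ i, Ord 2 (D i - C (c i) * X i)) :
    ∃ V : ι → MvPowerSeries ι ℂ, NoConst V ∧ (∀ i, pull V (D i) = X i) ∧
      (∀ i, Ord 2 (V i - C (c i)⁻¹ * X i)) ∧
      ((∀ i, Converges (D i)) → ∀ i, Converges (V i)) := by
  set h : ι → MvPowerSeries ι ℂ := fun i => -(C (c i)⁻¹ * (D i - C (c i) * X i)) with hh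
  have hh2 : ∀ i, Ord 2 (h i) := fun i => by
    have := (Ord.of_zero 2).sub ((Ord.zero (C (c i)⁻¹)).mul (hlin i))
    simpa [hh] using this
  have hcc : ∀ i, (C (c i) : MvPowerSeries ι ℂ) * C (c i)⁻¹ = 1 := fun i => by
    rw [← map_mul, mul_inv_cancel₀ (hc i), map_one]
  obtain ⟨V, hV, hVe⟩ := exists_fixedPoint (α := fun i => C (c i)⁻¹ * X i)
    (fun i => by simp) hh2
  refine ⟨V, hV, fun i => ?_, fun i => ?_, fun cD i => ?_⟩
  · have := hVe i
    simp only [hh, map_neg, map_mul, map_sub, pull_C, pull_X hV] at this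
    linear_combination (C (c i)) * this + (X i - pull V (D i) + C (c i) * V i) * hcc i
  · have := (hh2 i).pull hV
    rw [hVe i]
    simpa using this
  · refine converges_of_fixedPoint hh2 (fun i => (converges_C _).mul (converges_X _)) (fun i => ?_)
      hV hVe i
    exact ((converges_C _).mul ((cD i).sub ((converges_C _).mul (converges_X _)))).neg

/-- The one-sided inverse `V` has again a diagonal linear part, so it has a one-sided inverse too;
by associativity the latter is `D`. -/
theorem exists_two_sided_inverse [Fintype ι] {D : ι → MvPowerSeries ι ℂ}
    {c : ι → ℂ} (hc : ∀ i, c i ≠ 0) (hlin : ∀ i, Ord 2 (D i - C (c i) * X i)) :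
    ∃ V : ι → MvPowerSeries ι ℂ, NoConst V ∧ (∀ i, pull V (D i) = X i) ∧
      (∀ i, pull D (V i) = X i) ∧ ((∀ i, Converges (D i)) → ∀ i, Converges (V i)) := by
  obtain ⟨V, hV, hVD, hVl, hVc⟩ := exists_inverse hc hlin
  obtain ⟨W, hW, hWV, -, -⟩ := exists_inverse (D := V) (c := fun i => (c i)⁻¹)
    (fun i => inv_ne_zero (hc i)) hVl
  have : W = D := by
    funext i
    have h1 := congrArg (pull W) (hVD i)
    rw [pull_pull hV hW, pull_X hW, show (fun i => pull W (V i)) = X from funext hWV,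
      pull_X_self] at h1
    exact h1.symm
  exact ⟨V, hV, hVD, fun i => by rw [← this]; exact hWV i, hVc⟩

end Analytic

/-! ### Maps of the form `x_i ↦ x_i u_i(x)` and the multipliers of monomials. -/

section Diagonal

variable {ι : Type}

theorem mon_X (d : ι →₀ ℕ) : mon (X : ι → MvPowerSeries ι ℂ) d = monomial d 1 := by
  induction d using finsupp_induction_add_single with
  | h0 => simp
  | hs i d ih =>
    rw [mon_add, ih, mon_single, pow_one, X_def, monomial_mul_monomial, one_mul]

theorem mon_mul {τ : Type} (F G : ι → MvPowerSeries τ ℂ) (d : ι →₀ ℕ) :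
    mon (fun i => F i * G i) d = mon F d * mon G d := by
  simp only [mon, mul_pow, Finsupp.prod_mul]

/-- The components of `F` are `x_i u_i(x)`. -/
theorem noConst_diag (u : ι → MvPowerSeries ι ℂ) : NoConst fun i => X i * u i := fun i => by simp

theorem coeff_pull_diag [Finite ι] [DecidableEq ι] (u : ι → MvPowerSeries ι ℂ) (f : MvPowerSeries ι
    ℂ)
    (m : ι →₀ ℕ) : coeff m (pull (fun i => X i * u i) f) =
      ∑ p ∈ Finset.HasAntidiagonal.antidiagonal m, coeff p.1 f * coeff p.2 (mon u p.1) := by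
  have key : ∀ d, coeff m (mon (fun i => X i * u i) d) =
      if d ≤ m then coeff (m - d) (mon u d) else 0 := fun d => by
    rw [mon_mul, mon_X, coeff_monomial_mul]; simp
  rw [coeff_pull_eq_sum (noConst_diag u) f m
    ((Finset.HasAntidiagonal.antidiagonal m).image Prod.fst)]
  · rw [Finset.sum_image]
    · refine Finset.sum_congr rfl fun p hp => ?_
      rw [Finset.HasAntidiagonal.mem_antidiagonal] at hp
      rw [key, ← hp, if_pos (by simp)]
      simp
    · intro p hp q hq h
      simp only [Finset.mem_coe, Finset.HasAntidiagonal.mem_antidiagonal] at hp hq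
      refine Prod.ext h ?_
      rw [← hp, h] at hq
      exact (add_left_cancel hq).symm
  · intro d hd
    have : d ≤ m := by
      by_contra hn
      rw [key, if_neg hn, mul_zero] at hd
      exact hd rfl
    simp only [Finset.mem_image, Finset.HasAntidiagonal.mem_antidiagonal]
    exact ⟨(d, m - d), by simpa using add_tsub_cancel_of_le this, rfl⟩

/-- The multiplier of the monomial `x^m` under the linear map `diag ν`. -/
def mult (ν : ι → ℂ) (m : ι →₀ ℕ) : ℂ := m.prod fun i n => ν i ^ n

theorem constantCoeff_mon {τ : Type} (u : ι → MvPowerSeries τ ℂ) (m : ι →₀ ℕ) :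
    constantCoeff (mon u m) = mult (fun i => constantCoeff (u i)) m := by
  simp [mon, mult, Finsupp.prod]

/-- A map of this form sends `x^d` to a series of multiples of `x^d`. Hence at a minimal monomial it
acts by a scalar, which turns uniqueness questions into comparisons of multipliers. -/
theorem coeff_pull_diag_of_leading [Finite ι] (u : ι → MvPowerSeries ι ℂ)
    (f : MvPowerSeries ι ℂ) (m : ι →₀ ℕ) (h : ∀ d ≤ m, d ≠ m → coeff d f = 0) :
    coeff m (pull (fun i => X i * u i) f) =
      mult (fun i => constantCoeff (u i)) m * coeff m f := by
  classical
  rw [coeff_pull_diag, Finset.sum_eq_single (m, 0)]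
  · simp [constantCoeff_mon, mul_comm]
  · rintro ⟨a, b⟩ hp hne
    rw [Finset.HasAntidiagonal.mem_antidiagonal] at hp
    simp only at hp
    rw [h a (by rw [← hp]; simp), zero_mul]
    rintro rfl
    apply hne
    have : b = 0 := by simpa using hp
    rw [this]
  · intro hn
    exact absurd (by simp) hn

theorem coeff_mul_of_leading (g f : MvPowerSeries ι ℂ) (m : ι →₀ ℕ)
    (h : ∀ d ≤ m, d ≠ m → coeff d f = 0) : coeff m (g * f) = constantCoeff g * coeff m f := by
  classical
  rw [coeff_mul, Finset.sum_eq_single (0, m)]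
  · simp
  · rintro ⟨a, b⟩ hp hne
    rw [Finset.HasAntidiagonal.mem_antidiagonal] at hp
    simp only at hp
    rw [h b (by rw [← hp]; simp), mul_zero]
    rintro rfl
    apply hne
    have : a = 0 := by simpa using hp
    rw [this]
  · intro hn
    exact absurd (by simp) hn

theorem exists_minimal_degree {P : (ι →₀ ℕ) → Prop} (h : ∃ m, P m) :
    ∃ m, P m ∧ ∀ d ≤ m, d ≠ m → ¬ P d := by
  obtain ⟨m, hm, hmin⟩ := WellFounded.has_min (measure (Finsupp.degree (σ := ι) (R := ℕ))).wf
    {m | P m} h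
  refine ⟨m, hm, fun d hd hne hP => hmin d hP ?_⟩
  change d.degree < m.degree
  obtain ⟨e, rfl⟩ := le_iff_exists_add.mp hd
  have : e ≠ 0 := by rintro rfl; simp at hne
  have : e.degree ≠ 0 := fun h => this ((Finsupp.degree_eq_zero_iff e).mp h)
  rw [map_add]; omega

/-- An eigenfunction whose monomials all have the wrong multiplier vanishes. -/
theorem eq_zero_of_pull_diag_eq_mul [Finite ι] (u : ι → MvPowerSeries ι ℂ)
    {f g : MvPowerSeries ι ℂ} (hfg : pull (fun i => X i * u i) f = g * f)
    (h : ∀ m, coeff m f ≠ 0 → mult (fun i => constantCoeff (u i)) m ≠ constantCoeff g) :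
    f = 0 := by
  by_contra hf
  have : ∃ m, coeff m f ≠ 0 := by
    by_contra! hn
    exact hf (by ext m; simpa using hn m)
  obtain ⟨m, hm, hmin⟩ := exists_minimal_degree this
  simp only [not_not] at hmin
  have h1 := congrArg (coeff m) hfg
  rw [coeff_pull_diag_of_leading u f m hmin, coeff_mul_of_leading g f m hmin] at h1
  exact h m hm (mul_right_cancel₀ hm h1)

end Diagonal

/-! ### The grading by weights; series of weight zero are series in the products `ζ_j`. -/

section Weights

variable {n : ℕ}

/-- The weight of a monomial `ξ^a η^b` is `a - b`. -/
def wt (m : Fin n ⊕ Fin n →₀ ℕ) (j : Fin n) : ℤ := (m (Sum.inl j) : ℤ) - m (Sum.inr j)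

theorem wt_add (m k : Fin n ⊕ Fin n →₀ ℕ) : wt (m + k) = wt m + wt k := by
  funext j; simp [wt]; ring

@[simp] theorem wt_zero : wt (0 : Fin n ⊕ Fin n →₀ ℕ) = 0 := by funext j; simp [wt]

theorem wt_single_inl (j : Fin n) : wt (Finsupp.single (Sum.inl j) 1) = Pi.single j 1 := by
  classical
  funext k
  by_cases h : j = k
  · subst h; simp [wt]
  · simp [wt, Ne.symm h]

theorem wt_single_inr (j : Fin n) : wt (Finsupp.single (Sum.inr j) 1) = -Pi.single j 1 := by
  classical
  funext k
  by_cases h : j = k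
  · subst h; simp [wt]
  · simp [wt, Ne.symm h]

/-- All monomials of `f` have weight `q`. -/
def HasWt (q : Fin n → ℤ) (f : MvPowerSeries (Fin n ⊕ Fin n) ℂ) : Prop :=
  ∀ m, coeff m f ≠ 0 → wt m = q

theorem HasWt.mul {p q : Fin n → ℤ} {f g : MvPowerSeries (Fin n ⊕ Fin n) ℂ} (hf : HasWt p f)
    (hg : HasWt q g) : HasWt (p + q) (f * g) := by
  classical
  intro m hm
  rw [coeff_mul] at hm
  obtain ⟨x, hx, hne⟩ := Finset.exists_ne_zero_of_sum_ne_zero hm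
  rw [Finset.HasAntidiagonal.mem_antidiagonal] at hx
  rw [← hx, wt_add, hf _ (left_ne_zero_of_mul hne), hg _ (right_ne_zero_of_mul hne)]

theorem HasWt.add {q : Fin n → ℤ} {f g : MvPowerSeries (Fin n ⊕ Fin n) ℂ} (hf : HasWt q f)
    (hg : HasWt q g) : HasWt q (f + g) := by
  intro m hm
  by_cases h : coeff m f = 0
  · exact hg m (by intro h'; apply hm; simp [h, h'])
  · exact hf m h

theorem hasWt_C (c : ℂ) : HasWt (0 : Fin n → ℤ) (C c) := by
  intro m hm
  have : m = 0 := by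
    by_contra h
    exact hm (coeff_C_of_ne_zero h c)
  rw [this, wt_zero]

theorem HasWt.mon {u : Fin n ⊕ Fin n → MvPowerSeries (Fin n ⊕ Fin n) ℂ}
    (hu : ∀ i, HasWt 0 (u i)) (d : Fin n ⊕ Fin n →₀ ℕ) : HasWt 0 (mon u d) := by
  induction d using finsupp_induction_add_single with
  | h0 => simpa using hasWt_C (n := n) 1
  | hs i d ih =>
    rw [mon_add, mon_single, pow_one]
    simpa using ih.mul (hu i)

open Classical in
/-- The part of `f` of weight `q`. -/
def wproj (q : Fin n → ℤ) (f : MvPowerSeries (Fin n ⊕ Fin n) ℂ) :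
    MvPowerSeries (Fin n ⊕ Fin n) ℂ := fun m => if wt m = q then coeff m f else 0

open Classical in
theorem coeff_wproj (q : Fin n → ℤ) (f : MvPowerSeries (Fin n ⊕ Fin n) ℂ)
    (m : Fin n ⊕ Fin n →₀ ℕ) : coeff m (wproj q f) = if wt m = q then coeff m f else 0 := rfl

theorem hasWt_wproj (q : Fin n → ℤ) (f : MvPowerSeries (Fin n ⊕ Fin n) ℂ) :
    HasWt q (wproj q f) := by
  intro m hm
  by_contra h
  exact hm (by rw [coeff_wproj, if_neg h])

theorem HasWt.wproj_eq {q : Fin n → ℤ} {f : MvPowerSeries (Fin n ⊕ Fin n) ℂ} (h : HasWt q f) :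
    wproj q f = f := by
  ext m
  rw [coeff_wproj]
  split_ifs with hm
  · rfl
  · by_contra hne
    exact hm (h m (Ne.symm hne))

theorem wproj_add (q : Fin n → ℤ) (f g : MvPowerSeries (Fin n ⊕ Fin n) ℂ) :
    wproj q (f + g) = wproj q f + wproj q g := by
  ext m
  simp only [map_add, coeff_wproj]
  split_ifs <;> simp

theorem wproj_sub (q : Fin n → ℤ) (f g : MvPowerSeries (Fin n ⊕ Fin n) ℂ) :
    wproj q (f - g) = wproj q f - wproj q g := by
  ext m
  simp only [map_sub, coeff_wproj]
  split_ifs <;> simp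

theorem wproj_mul {h : MvPowerSeries (Fin n ⊕ Fin n) ℂ} (hh : HasWt 0 h) (q : Fin n → ℤ)
    (f : MvPowerSeries (Fin n ⊕ Fin n) ℂ) : wproj q (h * f) = h * wproj q f := by
  classical
  ext m
  have key : ∀ p ∈ Finset.HasAntidiagonal.antidiagonal m, coeff p.1 h * coeff p.2 (wproj q f) =
      if wt m = q then coeff p.1 h * coeff p.2 f else 0 := by
    intro p hp
    rw [Finset.HasAntidiagonal.mem_antidiagonal] at hp
    by_cases h0 : coeff p.1 h = 0
    · simp [h0]
    · rw [coeff_wproj, ← hp, wt_add, hh _ h0, zero_add]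
      split_ifs <;> simp
  rw [coeff_wproj, coeff_mul, coeff_mul, Finset.sum_congr rfl key]
  split_ifs <;> simp

/-- Multiplying each variable by a series of weight zero does not change the weight of a monomial.
-/
theorem wproj_pull {u : Fin n ⊕ Fin n → MvPowerSeries (Fin n ⊕ Fin n) ℂ}
    (hu : ∀ i, HasWt 0 (u i)) (q : Fin n → ℤ) (f : MvPowerSeries (Fin n ⊕ Fin n) ℂ) :
    wproj q (pull (fun i => X i * u i) f) = pull (fun i => X i * u i) (wproj q f) := by
  classical
  ext m
  have key : ∀ p ∈ Finset.HasAntidiagonal.antidiagonal m,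
      coeff p.1 (wproj q f) * coeff p.2 (mon u p.1) =
      if wt m = q then coeff p.1 f * coeff p.2 (mon u p.1) else 0 := by
    intro p hp
    rw [Finset.HasAntidiagonal.mem_antidiagonal] at hp
    by_cases h0 : coeff p.2 (mon u p.1) = 0
    · simp [h0]
    · rw [coeff_wproj, ← hp, wt_add, HasWt.mon hu _ _ h0, add_zero]
      split_ifs <;> simp
  rw [coeff_wproj, coeff_pull_diag, coeff_pull_diag, Finset.sum_congr rfl key]
  split_ifs <;> simp

/-- The products `ζ_j = ξ_j η_j`. -/
def zeta (n : ℕ) (j : Fin n) : MvPowerSeries (Fin n ⊕ Fin n) ℂ := X (Sum.inl j) * X (Sum.inr j)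

theorem noConst_zeta : NoConst (zeta n) := fun j => by simp [zeta]

/-- The series `g` with `f = g(ζ)`, when `f` has weight zero. -/
def dg (f : MvPowerSeries (Fin n ⊕ Fin n) ℂ) : MvPowerSeries (Fin n) ℂ :=
  fun k => coeff (Finsupp.sumElim k k) f

theorem coeff_dg (f : MvPowerSeries (Fin n ⊕ Fin n) ℂ) (k : Fin n →₀ ℕ) :
    coeff k (dg f) = coeff (Finsupp.sumElim k k) f := rfl

theorem mon_zeta (k : Fin n →₀ ℕ) : mon (zeta n) k = monomial (Finsupp.sumElim k k) 1 := by
  induction k using finsupp_induction_add_single with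
  | h0 =>
    rw [mon_zero]
    have : Finsupp.sumElim (0 : Fin n →₀ ℕ) (0 : Fin n →₀ ℕ) = 0 := by ext (i | i) <;> simp
    rw [this]; simp
  | hs i d ih =>
    rw [mon_add, ih, mon_single, pow_one, zeta, X_def, X_def, monomial_mul_monomial,
      monomial_mul_monomial, one_mul, one_mul]
    congr 1
    ext (j | j) <;> simp

theorem coeff_pull_zeta (g : MvPowerSeries (Fin n) ℂ) (k : Fin n →₀ ℕ) :
    coeff (Finsupp.sumElim k k) (pull (zeta n) g) = coeff k g := by
  classical
  rw [coeff_pull_eq_sum noConst_zeta g _ {k}]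
  · simp [mon_zeta]
  · intro d hd
    rw [mon_zeta, coeff_monomial] at hd
    have : Finsupp.sumElim k k = Finsupp.sumElim d d := by
      by_contra h
      simp [h] at hd
    rw [Finset.mem_singleton]
    ext j
    simpa using (DFunLike.congr_fun this (Sum.inl j)).symm

theorem hasWt_pull_zeta (g : MvPowerSeries (Fin n) ℂ) : HasWt 0 (pull (zeta n) g) := by
  classical
  intro m hm
  rw [coeff_pull noConst_zeta] at hm
  obtain ⟨d, hd⟩ : ∃ d, coeff d g * coeff m (mon (zeta n) d) ≠ 0 := by
    by_contra! h
    exact hm (finsum_eq_zero_of_forall_eq_zero h)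
  rw [mon_zeta, coeff_monomial] at hd
  have : m = Finsupp.sumElim d d := by
    by_contra h
    simp [h] at hd
  rw [this]; funext j; simp [wt]

theorem dg_pull_zeta (g : MvPowerSeries (Fin n) ℂ) : dg (pull (zeta n) g) = g := by
  ext k; rw [coeff_dg, coeff_pull_zeta]

theorem HasWt.pull_zeta_dg {f : MvPowerSeries (Fin n ⊕ Fin n) ℂ} (h : HasWt 0 f) :
    pull (zeta n) (dg f) = f := by
  ext m
  by_cases hm : wt m = 0
  · have : m = Finsupp.sumElim (Finsupp.comapDomain Sum.inl m Sum.inl_injective.injOn)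
        (Finsupp.comapDomain Sum.inl m Sum.inl_injective.injOn) := by
      ext (j | j)
      · simp
      · have := congrFun hm j
        simp only [wt, Pi.zero_apply, sub_eq_zero, Nat.cast_inj] at this
        simp [this]
    rw [this, coeff_pull_zeta, coeff_dg]
  · have h1 : coeff m f = 0 := by
      by_contra hne; exact hm (h m hne)
    have h2 : coeff m (pull (zeta n) (dg f)) = 0 := by
      by_contra hne; exact hm (hasWt_pull_zeta _ m hne)
    rw [h1, h2]

theorem Converges.dg {f : MvPowerSeries (Fin n ⊕ Fin n) ℂ} (h : Converges f) :
    Converges (dg f) := by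
  obtain ⟨r, hr, hfin⟩ := converges_iff.mp h
  refine converges_iff.mpr ⟨r ^ 2, by positivity, ne_top_of_le_ne_top hfin ?_⟩
  have hinj : Function.Injective fun k : Fin n →₀ ℕ => Finsupp.sumElim k k := by
    intro a b hab
    ext j
    simpa using DFunLike.congr_fun hab (Sum.inl j)
  refine le_trans (le_of_eq ?_) (ENNReal.tsum_comp_le_tsum_of_injective hinj _)
  unfold nrm
  refine tsum_congr fun k => ?_
  have : (Finsupp.sumElim k k).degree = 2 * k.degree := by
    simp [Finsupp.degree_eq_sum, two_mul]
  rw [coeff_dg, this, ENNReal.coe_pow, pow_mul]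

end Weights

end CRSing
end

noncomputable section

namespace CRSing

open MvPowerSeries
open scoped ENNReal NNReal

/-! ### The first two pairs of coordinates in normal form, and the half step. -/

section Coordinates

/-- The numbers `λ_j`. -/
def lam : Fin 3 → ℂ := ![2, 3, 5]

theorem lam_ne_zero (j : Fin 3) : lam j ≠ 0 := by fin_cases j <;> simp [lam]

theorem lam_sq_ne_one (j : Fin 3) : lam j ^ 2 ≠ 1 := by fin_cases j <;> norm_num [lam]

/-- The trace `λ_j + λ_j⁻¹`. -/
def tr (j : Fin 3) : ℂ := lam j + (lam j)⁻¹

/-- The multiplier `ℓ_j(x)`, with `ℓ_j + ℓ_j⁻¹ = λ_j + λ_j⁻¹ + x`. -/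
def ell (j : Fin 3) : MvPowerSeries Unit ℂ :=
  Classical.choose (exists_ell (lam_ne_zero j) (lam_sq_ne_one j))

theorem ell_eq (j : Fin 3) : ell j ^ 2 - (C (tr j) + X ()) * ell j + 1 = 0 :=
  (Classical.choose_spec (exists_ell (lam_ne_zero j) (lam_sq_ne_one j))).1

@[simp] theorem constantCoeff_ell (j : Fin 3) : constantCoeff (ell j) = lam j :=
  (Classical.choose_spec (exists_ell (lam_ne_zero j) (lam_sq_ne_one j))).2.1

theorem converges_ell (j : Fin 3) : Converges (ell j) :=
  (Classical.choose_spec (exists_ell (lam_ne_zero j) (lam_sq_ne_one j))).2.2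

/-- The inverse of `ℓ_j`. -/
def elli (j : Fin 3) : MvPowerSeries Unit ℂ := C (tr j) + X () - ell j

theorem ell_mul_elli (j : Fin 3) : ell j * elli j = 1 := by
  rw [elli]; linear_combination -(ell_eq j)

@[simp] theorem constantCoeff_elli (j : Fin 3) : constantCoeff (elli j) = (lam j)⁻¹ := by
  simp [elli, tr]

theorem constantCoeff_ell_sub_elli_ne (j : Fin 3) : constantCoeff (ell j - elli j) ≠ 0 := by
  fin_cases j <;> norm_num [lam]

/-- The inverse of `ℓ_j - ℓ_j⁻¹`. -/
def bser (j : Fin 3) : MvPowerSeries Unit ℂ := (ell j - elli j)⁻¹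

theorem bser_mul (j : Fin 3) : (ell j - elli j) * bser j = 1 :=
  MvPowerSeries.mul_inv_cancel _ (constantCoeff_ell_sub_elli_ne j)

/-- Substitution of `ζ_j` in a power series of one variable. -/
def sz (j : Fin 2) : MvPowerSeries Unit ℂ →ₐ[ℂ] MvPowerSeries (Fin 2 ⊕ Fin 2) ℂ :=
  pull fun _ => zeta 2 j

theorem noConst_sz (j : Fin 2) : NoConst fun _ : Unit => zeta 2 j := fun _ => noConst_zeta j

@[simp] theorem constantCoeff_sz (j : Fin 2) (f : MvPowerSeries Unit ℂ) :
    constantCoeff (sz j f) = constantCoeff f := constantCoeff_pull (noConst_sz j) f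

theorem sz_eq_pull_zeta (j : Fin 2) (f : MvPowerSeries Unit ℂ) :
    sz j f = pull (zeta 2) (pull (fun _ => X j) f) := by
  rw [pull_pull (fun _ => by simp) noConst_zeta]
  simp [sz, pull_X noConst_zeta]

theorem hasWt_sz (j : Fin 2) (f : MvPowerSeries Unit ℂ) : HasWt 0 (sz j f) := by
  rw [sz_eq_pull_zeta]; exact hasWt_pull_zeta _

/-- The multipliers of the normal form of the half step of the first two pairs of coordinates. -/
def kapu : Fin 2 ⊕ Fin 2 → MvPowerSeries (Fin 2 ⊕ Fin 2) ℂ :=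
  Sum.elim (fun j => sz j (ell j.castSucc)) (fun j => sz j (elli j.castSucc))

/-- Composition with the half step `ξ_j ↦ ℓ_j(ζ_j) ξ_j`, `η_j ↦ ℓ_j(ζ_j)⁻¹ η_j`. -/
def kap : MvPowerSeries (Fin 2 ⊕ Fin 2) ℂ →ₐ[ℂ] MvPowerSeries (Fin 2 ⊕ Fin 2) ℂ :=
  pull fun i => X i * kapu i

theorem hasWt_kapu (i : Fin 2 ⊕ Fin 2) : HasWt 0 (kapu i) := by
  rcases i with j | j <;> exact hasWt_sz _ _

@[simp] theorem kap_X (i : Fin 2 ⊕ Fin 2) : kap (X i) = X i * kapu i :=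
  pull_X (noConst_diag kapu) i

@[simp] theorem constantCoeff_kap (f : MvPowerSeries (Fin 2 ⊕ Fin 2) ℂ) :
    constantCoeff (kap f) = constantCoeff f := constantCoeff_pull (noConst_diag kapu) f

theorem sz_ell_mul_elli (j : Fin 2) : sz j (ell j.castSucc) * sz j (elli j.castSucc) = 1 := by
  rw [← map_mul, ell_mul_elli, map_one]

theorem kap_zeta (j : Fin 2) : kap (zeta 2 j) = zeta 2 j := by
  rw [zeta, map_mul, kap_X, kap_X]
  simp only [kapu, Sum.elim_inl, Sum.elim_inr]
  linear_combination (X (Sum.inl j) * X (Sum.inr j)) * sz_ell_mul_elli j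

theorem kap_pull_zeta (g : MvPowerSeries (Fin 2) ℂ) : kap (pull (zeta 2) g) = pull (zeta 2) g := by
  rw [kap, pull_pull noConst_zeta (noConst_diag kapu)]
  congr 2
  funext j
  exact kap_zeta j

/-- The multipliers of `ξ_j` and `η_j` are inverse to each other, so the half step fixes `ζ_j` and
every series in them. -/
theorem kap_of_hasWt_zero {f : MvPowerSeries (Fin 2 ⊕ Fin 2) ℂ} (h : HasWt 0 f) : kap f = f := by
  rw [← h.pull_zeta_dg, kap_pull_zeta]

theorem kap_sz (j : Fin 2) (f : MvPowerSeries Unit ℂ) : kap (sz j f) = sz j f :=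
  kap_of_hasWt_zero (hasWt_sz j f)

theorem wproj_kap (q : Fin 2 → ℤ) (f : MvPowerSeries (Fin 2 ⊕ Fin 2) ℂ) :
    wproj q (kap f) = kap (wproj q f) := wproj_pull hasWt_kapu q f

/-- The coordinate `z_j` in terms of the normalizing coordinates. -/
def zc (j : Fin 2) : MvPowerSeries (Fin 2 ⊕ Fin 2) ℂ :=
  (X (Sum.inl j) - X (Sum.inr j)) * sz j (bser j.castSucc)

theorem noConst_zc : NoConst zc := fun j => by simp [zc]

theorem constantCoeff_kapu (i : Fin 2 ⊕ Fin 2) : constantCoeff (kapu i) =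
    Sum.elim (fun j : Fin 2 => lam j.castSucc) (fun j => (lam j.castSucc)⁻¹) i := by
  rcases i with j | j <;> simp [kapu]

theorem mult_kapu (m : Fin 2 ⊕ Fin 2 →₀ ℕ) :
    mult (fun i => constantCoeff (kapu i)) m = 2 ^ wt m 0 * 3 ^ wt m 1 := by
  have h2 : (2 : ℂ) ≠ 0 := by norm_num
  have h3 : (3 : ℂ) ≠ 0 := by norm_num
  simp only [mult, constantCoeff_kapu]
  rw [Finsupp.prod_fintype _ _ (by simp)]
  simp only [Fintype.prod_sum_type, Fin.prod_univ_two, Sum.elim_inl, Sum.elim_inr, wt]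
  simp [lam, zpow_sub₀ h2, zpow_sub₀ h3]
  field_simp

/-- Unique factorization, by the 2-, 3- and 5-adic valuations. All the nonresonance used in the
proof comes from here. -/
theorem two_three_five_zpow {p q r : ℤ} (h : (2 : ℂ) ^ p * 3 ^ q * 5 ^ r = 1) :
    p = 0 ∧ q = 0 ∧ r = 0 := by
  have h' : (2 : ℚ) ^ p * 3 ^ q * 5 ^ r = 1 := by
    have : ((2 ^ p * 3 ^ q * 5 ^ r : ℚ) : ℂ) = ((1 : ℚ) : ℂ) := by push_cast; exact h
    exact Rat.cast_injective this
  have key : ∀ l : ℕ, [hl : Fact l.Prime] → p * padicValRat l 2 + q * padicValRat l 3 +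
      r * padicValRat l 5 = 0 := by
    intro l hl
    have := congrArg (padicValRat l) h'
    rw [padicValRat.mul (by positivity) (by positivity), padicValRat.mul (by positivity)
      (by positivity), padicValRat.zpow, padicValRat.zpow, padicValRat.zpow] at this
    simpa using this
  have val : ∀ l k : ℕ, [hl : Fact l.Prime] → k.Prime → padicValRat l (k : ℚ) =
      if l = k then 1 else 0 := by
    intro l k hl hk
    rw [padicValRat.of_nat]
    split_ifs with h
    · subst h; simp
    · have : ¬ l ∣ k := fun hd => h ((Nat.prime_dvd_prime_iff_eq hl.out hk).mp hd)
      rw [padicValNat.eq_zero_of_not_dvd this]; rfl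
  have f2 : Fact (Nat.Prime 2) := ⟨by norm_num⟩
  have f3 : Fact (Nat.Prime 3) := ⟨by norm_num⟩
  have f5 : Fact (Nat.Prime 5) := ⟨by norm_num⟩
  have a2 := key 2
  have a3 := key 3
  have a5 := key 5
  have e : ∀ l : ℕ, [hl : Fact l.Prime] → padicValRat l 2 = (if l = 2 then 1 else 0) ∧
      padicValRat l 3 = (if l = 3 then 1 else 0) ∧ padicValRat l 5 = (if l = 5 then 1 else 0) := by
    intro l hl
    exact ⟨by exact_mod_cast val l 2 f2.out, by exact_mod_cast val l 3 f3.out,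
      by exact_mod_cast val l 5 f5.out⟩
  rw [(e 2).1, (e 2).2.1, (e 2).2.2] at a2
  rw [(e 3).1, (e 3).2.1, (e 3).2.2] at a3
  rw [(e 5).1, (e 5).2.1, (e 5).2.2] at a5
  simp at a2 a3 a5
  exact ⟨a2, a3, a5⟩

theorem two_three_five_zpow_fun {Q : Fin 3 → ℤ} (h : ∏ j, lam j ^ Q j = 1) : Q = 0 := by
  rw [Fin.prod_univ_three] at h
  obtain ⟨h0, h1, h2⟩ := two_three_five_zpow h
  funext j
  fin_cases j <;> assumption

end Coordinates

/-! ### Order of vanishing in the second pair of variables, and the linearized equation. -/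

section Filtration

/-- The degree of a monomial in the second pair of variables. -/
def deg₂ (m : Fin 2 ⊕ Fin 2 →₀ ℕ) : ℕ := m (Sum.inl 1) + m (Sum.inr 1)

/-- `f` vanishes to order `D` in the second pair of variables. -/
def JD (D : ℕ) (f : MvPowerSeries (Fin 2 ⊕ Fin 2) ℂ) : Prop := ∀ m, deg₂ m < D → coeff m f = 0

variable {D k : ℕ} {f g : MvPowerSeries (Fin 2 ⊕ Fin 2) ℂ}

theorem deg₂_add (m k : Fin 2 ⊕ Fin 2 →₀ ℕ) : deg₂ (m + k) = deg₂ m + deg₂ k := by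
  simp [deg₂]; ring

theorem deg₂_mono {m k : Fin 2 ⊕ Fin 2 →₀ ℕ} (h : m ≤ k) : deg₂ m ≤ deg₂ k :=
  Nat.add_le_add (h _) (h _)

theorem JD.of_zero (f : MvPowerSeries (Fin 2 ⊕ Fin 2) ℂ) : JD 0 f := fun m hm => by simp at hm

theorem JD.mono (h : JD D f) (hk : k ≤ D) : JD k f := fun m hm => h m (by omega)

theorem JD.add (hf : JD D f) (hg : JD D g) : JD D (f + g) := fun m hm => by
  simp [hf m hm, hg m hm]

theorem JD.sub (hf : JD D f) (hg : JD D g) : JD D (f - g) := fun m hm => by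
  simp [hf m hm, hg m hm]

theorem JD.mul (hf : JD D f) (hg : JD k g) : JD (D + k) (f * g) := by
  classical
  intro m hm
  rw [coeff_mul]
  refine Finset.sum_eq_zero fun p hp => ?_
  rw [Finset.HasAntidiagonal.mem_antidiagonal] at hp
  have := congrArg deg₂ hp
  rw [deg₂_add] at this
  by_cases h : deg₂ p.1 < D
  · simp [hf _ h]
  · simp [hg p.2 (by omega)]

theorem JD.mul_left (g : MvPowerSeries (Fin 2 ⊕ Fin 2) ℂ) (hf : JD D f) : JD D (g * f) := by
  simpa using (JD.of_zero g).mul hf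

theorem JD.mul_right (g : MvPowerSeries (Fin 2 ⊕ Fin 2) ℂ) (hf : JD D f) : JD D (f * g) := by
  simpa using hf.mul (JD.of_zero g)

theorem JD.pow (hf : JD D f) (n : ℕ) : JD (n * D) (f ^ n) := by
  induction n with
  | zero => simpa using JD.of_zero 1
  | succ n ih => rw [pow_succ]; exact (ih.mul hf).mono (by ring_nf; rfl)

theorem JD.sum {α : Type} {s : Finset α} {f : α → MvPowerSeries (Fin 2 ⊕ Fin 2) ℂ}
    (h : ∀ a ∈ s, JD D (f a)) : JD D (∑ a ∈ s, f a) := fun m hm => by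
  rw [map_sum]; exact Finset.sum_eq_zero fun a ha => h a ha m hm

theorem JD.kap (hf : JD D f) : JD D (kap f) := by
  intro m hm
  rw [CRSing.kap, coeff_pull_diag]
  refine Finset.sum_eq_zero fun p hp => ?_
  rw [Finset.HasAntidiagonal.mem_antidiagonal] at hp
  have := congrArg deg₂ hp
  rw [deg₂_add] at this
  rw [hf p.1 (by omega), zero_mul]

theorem JD.wproj (hf : JD D f) (q : Fin 2 → ℤ) : JD D (wproj q f) := by
  intro m hm
  rw [coeff_wproj, hf m hm]; simp

theorem jd_X_inl : JD 1 (X (Sum.inl 1)) := by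
  classical
  intro m hm
  rw [coeff_X, if_neg]
  rintro rfl
  simp [deg₂] at hm

theorem jd_X_inr : JD 1 (X (Sum.inr 1)) := by
  classical
  intro m hm
  rw [coeff_X, if_neg]
  rintro rfl
  simp [deg₂] at hm

theorem jd_zc : JD 1 (zc 1) := (jd_X_inl.sub jd_X_inr).mul_right _

/-- A power series in `ζ_2` is constant modulo the second pair of variables. -/
theorem jd_sz_sub (s : MvPowerSeries Unit ℂ) : JD 1 (sz 1 s - C (constantCoeff s)) := by
  have h : X () ∣ s - C (constantCoeff s) := by
    rw [X_dvd_iff]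
    intro m hm
    have : m = 0 := by ext; simpa using hm
    subst this; simp
  obtain ⟨t, ht⟩ := h
  have : sz 1 s - C (constantCoeff s) = sz 1 (X () * t) := by
    rw [← ht, map_sub, sz, pull_C]
  rw [this, map_mul, sz, pull_X (noConst_sz 1), zeta]
  exact (jd_X_inl.mul_right _).mul_right _

/-- The coordinate `z_2` is a multiple of `ξ_2 - η_2`, so `z_2^k` vanishes to order `k` in the
second pair. -/
theorem jd_pull_zc {F : MvPowerSeries (Fin 2) ℂ} (h : ∀ k, k 1 < D → coeff k F = 0) :
    JD D (pull zc F) := by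
  intro m hm
  rw [coeff_pull_eq_sum noConst_zc F m ∅, Finset.sum_empty]
  intro d hd
  exfalso
  have h1 : D ≤ d 1 := by
    by_contra hlt
    rw [h d (by omega), zero_mul] at hd
    exact hd rfl
  have h2 : JD (d 1) (mon zc d) := by
    rw [mon, Finsupp.prod_fintype _ _ (by simp), Fin.prod_univ_two]
    exact ((jd_zc.pow (d 1)).mono (by simp)).mul_left _
  rw [h2 m (by omega), mul_zero] at hd
  exact hd rfl

/-- Uniqueness for the linearized equation, to a given order in the second pair of variables. -/
theorem jd_of_linearized {A B c ε l : MvPowerSeries (Fin 2 ⊕ Fin 2) ℂ}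
    (hA : constantCoeff A = 25) (hB : constantCoeff B = 26) (hc : constantCoeff c ≠ 0)
    (hε : wproj 0 ε = 0) (hl : HasWt 0 l)
    (h : JD D (A * ε + kap (kap ε) - B * kap ε + c * l)) : JD D ε ∧ JD D l := by
  by_contra hcon
  have : ∃ m, deg₂ m < D ∧ (coeff m ε ≠ 0 ∨ coeff m l ≠ 0) := by
    by_contra! hn
    exact hcon ⟨fun m hm => (hn m hm).1, fun m hm => (hn m hm).2⟩
  -- At a minimal offending monomial all operators become scalars.
  obtain ⟨m, ⟨hmD, hm⟩, hmin⟩ := exists_minimal_degree this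
  have hmε : ∀ d ≤ m, d ≠ m → coeff d ε = 0 := fun d hd hne => by
    by_contra hh
    exact hmin d hd hne ⟨(deg₂_mono hd).trans_lt hmD, Or.inl hh⟩
  have hml : ∀ d ≤ m, d ≠ m → coeff d l = 0 := fun d hd hne => by
    by_contra hh
    exact hmin d hd hne ⟨(deg₂_mono hd).trans_lt hmD, Or.inr hh⟩
  have hk : ∀ d ≤ m, d ≠ m → coeff d (kap ε) = 0 := fun d hd hne => by
    rw [kap, coeff_pull_diag_of_leading kapu ε d, hmε d hd hne, mul_zero]
    intro e he hne'
    exact hmε e (he.trans hd) fun heq => hne (le_antisymm hd (heq ▸ he))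
  have h1 := h m hmD
  have k1 : coeff m (kap ε) = 2 ^ wt m 0 * 3 ^ wt m 1 * coeff m ε := by
    rw [kap, coeff_pull_diag_of_leading kapu ε m hmε, mult_kapu]
  have k2 : coeff m (kap (kap ε)) = 2 ^ wt m 0 * 3 ^ wt m 1 * coeff m (kap ε) := by
    have := coeff_pull_diag_of_leading kapu (kap ε) m hk
    rw [mult_kapu] at this
    exact this
  rw [map_add, map_sub, map_add, coeff_mul_of_leading A ε m hmε, coeff_mul_of_leading c l m hml,
    coeff_mul_of_leading B _ m hk, k2, k1, hA, hB] at h1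
  -- For weight zero the coefficient of `ε` vanishes by normalization, and the term `c * l`
  -- determines `l`. For other weights `l` does not contribute.
  by_cases hw : wt m = 0
  · have e0 : coeff m ε = 0 := by
      have := congrArg (coeff m) hε
      rw [coeff_wproj, if_pos hw, map_zero] at this
      exact this
    rw [e0] at h1
    simp only [mul_zero, add_zero, sub_zero, zero_add, mul_eq_zero, hc, false_or] at h1
    simp [e0, h1] at hm
  · have l0 : coeff m l = 0 := by
      by_contra hne
      exact hw (hl m hne)
    have e0 : coeff m ε ≠ 0 := by simpa [l0] using hm
    set s : ℂ := 2 ^ wt m 0 * 3 ^ wt m 1 with hs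
    -- The symbol `s² - 26 s + 25`. Here `s = 2^p 3^q` is never 25, and it is 1 only for weight
    -- zero.
    have : (s - 1) * (s - 25) * coeff m ε = 0 := by
      rw [l0] at h1; linear_combination h1
    rcases mul_eq_zero.mp this with h2 | h2
    · rcases mul_eq_zero.mp h2 with h3 | h3
      · have : (2 : ℂ) ^ wt m 0 * 3 ^ wt m 1 * 5 ^ (0 : ℤ) = 1 := by
          rw [zpow_zero, mul_one, ← hs]; linear_combination h3
        obtain ⟨a, b, -⟩ := two_three_five_zpow this
        exact hw (by funext j; fin_cases j <;> assumption)
      · have : (2 : ℂ) ^ wt m 0 * 3 ^ wt m 1 * 5 ^ (-2 : ℤ) = 1 := by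
          rw [← hs, sub_eq_zero.mp h3]; norm_num
        obtain ⟨-, -, hh⟩ := two_three_five_zpow this
        norm_num at hh
    · exact e0 h2

end Filtration

end CRSing
end

noncomputable section

namespace CRSing

open MvPowerSeries
open scoped ENNReal NNReal

/-! ### Bloch eigenfunctions of the half-step cocycle and their dependence on the potential. -/

section Cocycle

/-- `β` is a normalized eigenfunction, with multiplier `Λ(ζ)`, of the half-step cocycle defined by
the potential `λ_3 + λ_3⁻¹ + F(z_1, z_2)`. -/
def IsEigen (F Λ : MvPowerSeries (Fin 2) ℂ) (β : MvPowerSeries (Fin 2 ⊕ Fin 2) ℂ) : Prop :=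
  constantCoeff Λ = 5 ∧ wproj 0 β = 1 ∧
    pull (zeta 2) Λ ^ 2 * β + kap (kap β) =
      pull (zeta 2) Λ * (C (tr 2) + kap (pull zc F)) * kap β

variable {F F₁ F₂ Λ Λ₁ Λ₂ : MvPowerSeries (Fin 2) ℂ}
  {β β₁ β₂ : MvPowerSeries (Fin 2 ⊕ Fin 2) ℂ}

theorem tr_two : tr 2 = 26 / 5 := by
  change (5 : ℂ) + 5⁻¹ = _; norm_num

theorem isEigen_zero : IsEigen 0 (C 5) 1 := by
  refine ⟨by simp, by simpa using (hasWt_C (n := 2) 1).wproj_eq, ?_⟩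
  have h : (C (5 : ℂ) : MvPowerSeries (Fin 2 ⊕ Fin 2) ℂ) * C (26 / 5) = 26 := by
    rw [← map_mul, show (5 : ℂ) * (26 / 5) = 26 by norm_num]; exact map_ofNat _ 26
  have h5 : (C (5 : ℂ) : MvPowerSeries (Fin 2 ⊕ Fin 2) ℂ) = 5 := map_ofNat _ 5
  rw [tr_two]
  simp only [pull_C, map_one, map_zero, add_zero, mul_one]
  rw [h, h5]; norm_num

theorem constantCoeff_of_wproj (h : wproj 0 β = 1) : constantCoeff β = 1 := by
  have := congrArg (coeff 0) h
  rw [coeff_wproj, if_pos wt_zero] at this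
  simpa using this

theorem IsEigen.constantCoeff_eq (h : IsEigen F Λ β) : constantCoeff β = 1 :=
  constantCoeff_of_wproj h.2.1

theorem IsEigen.constantCoeff_lam (h : IsEigen F Λ β) :
    constantCoeff (pull (zeta 2) Λ) = 5 := by rw [constantCoeff_pull noConst_zeta, h.1]

theorem constantCoeff_potential (h : constantCoeff F = 0) :
    constantCoeff (C (tr 2) + kap (pull zc F)) = 26 / 5 := by
  rw [map_add, constantCoeff_kap, constantCoeff_pull noConst_zc, h, constantCoeff_C, tr_two,
    add_zero]

theorem hasWt_lam_sub : HasWt 0 (pull (zeta 2) Λ₂ - pull (zeta 2) Λ₁) := by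
  rw [← map_sub]; exact hasWt_pull_zeta _

/-- Eigenfunctions of two potentials that agree to order `b` in the second variable agree to
order `b`. -/
theorem IsEigen.jd_sub (h₁ : IsEigen F₁ Λ₁ β₁) (h₂ : IsEigen F₂ Λ₂ β₂)
    (h0 : constantCoeff F₂ = 0) {b : ℕ} (hF : ∀ k, k 1 < b → coeff k F₁ = coeff k F₂) :
    JD b (β₂ - β₁) ∧ JD b (pull (zeta 2) Λ₂ - pull (zeta 2) Λ₁) := by
  have hZ : JD b (pull zc F₂ - pull zc F₁) := by
    rw [← map_sub]
    exact jd_pull_zc fun k hk => by rw [map_sub, hF k hk, sub_self]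
  obtain ⟨-, w₁, e₁⟩ := id h₁
  obtain ⟨-, w₂, e₂⟩ := id h₂
  -- The difference of the two eigenvalue equations, written as linear in `β₂ - β₁` and `Λ₂ - Λ₁`.
  -- The coefficient `c` of the latter is `10 - 26 / 5` at the origin.
  refine jd_of_linearized (A := pull (zeta 2) Λ₂ ^ 2)
    (B := pull (zeta 2) Λ₂ * (C (tr 2) + kap (pull zc F₂)))
    (c := (pull (zeta 2) Λ₂ + pull (zeta 2) Λ₁) * β₁ - (C (tr 2) + kap (pull zc F₂)) * kap β₁)
    ?_ ?_ ?_ (by rw [wproj_sub, w₁, w₂, sub_self]) hasWt_lam_sub ?_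
  · rw [map_pow, h₂.constantCoeff_lam]; norm_num
  · rw [map_mul, h₂.constantCoeff_lam, constantCoeff_potential h0]; norm_num
  · rw [map_sub, map_mul, map_mul, map_add, h₂.constantCoeff_lam, h₁.constantCoeff_lam,
      constantCoeff_potential h0, constantCoeff_kap, h₁.constantCoeff_eq]
    norm_num
  · have := (hZ.kap.mul_left (pull (zeta 2) Λ₁)).mul_right (kap β₁)
    convert this using 1
    simp only [map_sub]
    linear_combination e₂ - e₁

/-- For `z_2 = 0` the potential is constant, so `β` and `Λ` reduce to their values 1 and 5 for `F =
0`. -/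
theorem IsEigen.jd_trivial (h : IsEigen F Λ β) (hF : ∀ k, k 1 < 1 → coeff k F = 0) :
    JD 1 (β - 1) ∧ JD 1 (pull (zeta 2) Λ - C 5) := by
  have h0 : constantCoeff F = 0 := by simpa using hF 0 (by simp)
  have := isEigen_zero.jd_sub h h0 (b := 1) (fun k hk => by rw [hF k hk, map_zero])
  simpa using this

/-- The sum of the multiplier and its inverse. -/
theorem IsEigen.lam_sq_add_one (h : IsEigen F Λ β) :
    pull (zeta 2) Λ ^ 2 + 1 =
      pull (zeta 2) Λ * (C (tr 2) + wproj 0 (pull zc F * β)) := by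
  obtain ⟨-, w, e⟩ := h
  have hL : HasWt 0 (pull (zeta 2) Λ) := hasWt_pull_zeta _
  -- Averaging: the part of weight zero of the eigenvalue equation. There `β`, `κβ` and `κ²β` all
  -- become 1, and series of weight zero are fixed by `κ`.
  have h1 := congrArg (wproj 0) e
  have h2 : wproj 0 (kap β) = 1 := by rw [wproj_kap, w, map_one]
  have h3 : wproj 0 (kap (kap β)) = 1 := by rw [wproj_kap, h2, map_one]
  have h4 : pull (zeta 2) Λ * (C (tr 2) + kap (pull zc F)) * kap β =
      pull (zeta 2) Λ * (C (tr 2) * kap β + kap (pull zc F * β)) := by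
    rw [map_mul]; ring
  rw [h4, wproj_add, pow_two, mul_assoc, wproj_mul hL, wproj_mul hL, w, h3, wproj_mul hL,
    wproj_add, wproj_mul (hasWt_C _), h2, wproj_kap, kap_of_hasWt_zero (hasWt_wproj _ _)] at h1
  linear_combination h1

variable {F₀ Λ₀ P Λp Λm : MvPowerSeries (Fin 2) ℂ}
  {β₀ βp βm : MvPowerSeries (Fin 2 ⊕ Fin 2) ℂ}

/-- The linear equation for the difference of the eigenfunctions of `F₀ + P` and `F₀ - P`. -/
theorem jd_first_difference {b : ℕ} (hF : ∀ k, k 1 < 1 → coeff k F₀ = 0)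
    (hP : ∀ k, k 1 < b → coeff k P = 0) (hb : 1 ≤ b)
    (hp : IsEigen (F₀ + P) Λp βp) (hm : IsEigen (F₀ - P) Λm βm) :
    ∃ c, constantCoeff c ≠ 0 ∧ JD (b + 1) (C 25 * (βp - βm) + kap (kap (βp - βm)) -
      C 26 * kap (βp - βm) + c * (pull (zeta 2) Λp - pull (zeta 2) Λm) -
        C 10 * kap (pull zc P)) := by
  have hP1 : ∀ k, k 1 < 1 → coeff k P = 0 := fun k hk => hP k (by omega)
  have hp1 : ∀ k, k 1 < 1 → coeff k (F₀ + P) = 0 := fun k hk => by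
    rw [map_add, hF k hk, hP1 k hk, add_zero]
  have hm1 : ∀ k, k 1 < 1 → coeff k (F₀ - P) = 0 := fun k hk => by
    rw [map_sub, hF k hk, hP1 k hk, sub_zero]
  have h0 : constantCoeff (F₀ + P) = 0 := by simpa using hp1 0 (by simp)
  obtain ⟨hη, hl⟩ := hm.jd_sub hp h0 (b := b) (fun k hk => by
    rw [map_add, map_sub, hP k hk, add_zero, sub_zero])
  obtain ⟨tp1, tp2⟩ := hp.jd_trivial hp1
  obtain ⟨tm1, tm2⟩ := hm.jd_trivial hm1
  have hZ : JD 1 (pull zc (F₀ + P)) := jd_pull_zc hp1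
  have hg : JD b (pull zc P) := jd_pull_zc hP
  refine ⟨(pull (zeta 2) Λp + pull (zeta 2) Λm) * βm -
    (C (tr 2) + kap (pull zc (F₀ + P))) * kap βm, ?_, ?_⟩
  · rw [map_sub, map_mul, map_mul, map_add, hp.constantCoeff_lam, hm.constantCoeff_lam,
      constantCoeff_potential h0, constantCoeff_kap, hm.constantCoeff_eq]
    norm_num
  · obtain ⟨-, -, ep⟩ := hp
    obtain ⟨-, -, em⟩ := hm
    set L := pull (zeta 2) Λp
    set L' := pull (zeta 2) Λm
    set η := βp - βm with hηdef
    have e25 : (C (25 : ℂ) : MvPowerSeries (Fin 2 ⊕ Fin 2) ℂ) = C 5 ^ 2 := by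
      rw [← map_pow]; norm_num
    have e26 : (C (26 : ℂ) : MvPowerSeries (Fin 2 ⊕ Fin 2) ℂ) = C 5 * C (tr 2) := by
      rw [← map_mul, tr_two]; norm_num
    have e10 : (C (10 : ℂ) : MvPowerSeries (Fin 2 ⊕ Fin 2) ℂ) = 2 * C 5 := by
      have h2 : (C (2 : ℂ) : MvPowerSeries (Fin 2 ⊕ Fin 2) ℂ) = 2 := map_ofNat _ 2
      rw [← h2, ← map_mul]; norm_num
    -- Replacing `Λ`, the potential and `β` by their values for `z_2 = 0` costs one order each, in
    -- terms that already have order `b`. The right-hand side becomes `5 * 2 κ(P)`.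
    have r1 : JD (b + 1) ((L - C 5) * ((L + C 5) * η)) :=
      (tp2.mul (hη.mul_left (L + C 5))).mono (by omega)
    have r2 : JD (b + 1) ((L - C 5) * (C (tr 2) * kap η)) :=
      (tp2.mul (hη.kap.mul_left (C (tr 2)))).mono (by omega)
    have r3 : JD (b + 1) (kap (pull zc (F₀ + P)) * (L * kap η)) :=
      (hZ.kap.mul (hη.kap.mul_left L)).mono (by omega)
    have r4 : JD (b + 1) ((L' - C 5) * (kap (pull zc P) * kap βm)) :=
      (tm2.mul (hg.kap.mul_right (kap βm))).mono (by omega)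
    have r5 : JD (b + 1) (kap (βm - 1) * (C 5 * kap (pull zc P))) :=
      (tm1.kap.mul (hg.kap.mul_left (C 5))).mono (by omega)
    have key := ((r2.add r3).sub r1).add ((r4.add r5).add (r4.add r5))
    convert key using 1
    rw [e25, e26, e10]
    simp only [hηdef, map_sub, map_add, map_one] at ep em ⊢
    linear_combination ep - em

/-- The second difference of the traces `Λ + Λ⁻¹`. -/
theorem jd_second_difference {b : ℕ} (hF : ∀ k, k 1 < 1 → coeff k F₀ = 0)
    (hP : ∀ k, k 1 < b → coeff k P = 0) (hb : 1 ≤ b) (h₀ : IsEigen F₀ Λ₀ β₀)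
    (hp : IsEigen (F₀ + P) Λp βp) (hm : IsEigen (F₀ - P) Λm βm) :
    JD (2 * b + 1) (wproj 0 (pull zc (F₀ + P) * βp) + wproj 0 (pull zc (F₀ - P) * βm) -
      2 * wproj 0 (pull zc F₀ * β₀) - wproj 0 (pull zc P * (βp - βm))) := by
  have hP1 : ∀ k, k 1 < 1 → coeff k P = 0 := fun k hk => hP k (by omega)
  have hp0 : constantCoeff (F₀ + P) = 0 := by
    have h1 := hF 0 (by simp)
    have h2 := hP1 0 (by simp)
    simp at h1 h2
    simp [h1, h2]
  have hm0 : constantCoeff (F₀ - P) = 0 := by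
    have h1 := hF 0 (by simp)
    have h2 := hP1 0 (by simp)
    simp at h1 h2
    simp [h1, h2]
  have hF0 : constantCoeff F₀ = 0 := by simpa using hF 0 (by simp)
  obtain ⟨dp, lp⟩ := h₀.jd_sub hp hp0 (b := b) (fun k hk => by rw [map_add, hP k hk, add_zero])
  obtain ⟨dm, lm⟩ := h₀.jd_sub hm hm0 (b := b) (fun k hk => by rw [map_sub, hP k hk, sub_zero])
  have hg : JD b (pull zc P) := jd_pull_zc hP
  have hZ : JD 1 (pull zc F₀) := jd_pull_zc hF
  -- In the sum of the two perturbed equations the terms linear in `P` cancel; what remains is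
  -- quadratic in quantities of order `b`.
  have hε : JD (2 * b) ((βp - β₀) + (βm - β₀)) := by
    obtain ⟨-, w₀, e₀⟩ := id h₀
    obtain ⟨-, wp, ep⟩ := id hp
    obtain ⟨-, wm, em⟩ := id hm
    refine (jd_of_linearized (A := pull (zeta 2) Λ₀ ^ 2)
      (B := pull (zeta 2) Λ₀ * (C (tr 2) + kap (pull zc F₀)))
      (c := 2 * pull (zeta 2) Λ₀ * β₀ - (C (tr 2) + kap (pull zc F₀)) * kap β₀)
      (l := (pull (zeta 2) Λp - pull (zeta 2) Λ₀) + (pull (zeta 2) Λm - pull (zeta 2) Λ₀))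
      ?_ ?_ ?_ ?_ (hasWt_lam_sub.add hasWt_lam_sub) ?_).1
    · rw [map_pow, h₀.constantCoeff_lam]; norm_num
    · rw [map_mul, h₀.constantCoeff_lam, constantCoeff_potential hF0]; norm_num
    · rw [map_sub, map_mul, map_mul, map_mul, h₀.constantCoeff_lam,
        constantCoeff_potential hF0, constantCoeff_kap, h₀.constantCoeff_eq, map_ofNat]
      norm_num
    · rw [wproj_add, wproj_sub, wproj_sub, w₀, wp, wm]; simp
    · set L := pull (zeta 2) Λ₀
      set a := pull (zeta 2) Λp - L with ha
      set a' := pull (zeta 2) Λm - L with ha'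
      set d := βp - β₀ with hd
      set d' := βm - β₀ with hd'
      set g := pull zc P with hgdef
      set t := C (tr 2) + kap (pull zc F₀) with ht
      have m1 : ∀ {x y : MvPowerSeries (Fin 2 ⊕ Fin 2) ℂ}, JD b x → JD b y →
          ∀ z, JD (2 * b) (x * y * z) := fun hx hy z => ((hx.mul hy).mono (by omega)).mul_right z
      have q : ∀ {x y : MvPowerSeries (Fin 2 ⊕ Fin 2) ℂ}, JD b x → JD b y →
          JD (2 * b) (x * x * β₀ + x * y * (2 * L) + x * x * y - x * kap y * t) :=
        fun {x y} hx hy => (((m1 hx hx _).add (m1 hx hy _)).add (m1 hx hx _)).sub (m1 hx hy.kap _)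
      have s : ∀ {x y : MvPowerSeries (Fin 2 ⊕ Fin 2) ℂ}, JD b x → JD b y →
          JD (2 * b) (x * kap g * kap β₀ + kap g * kap y * L + x * kap g * kap y) :=
        fun {x y} hx hy => ((m1 hx hg.kap _).add (m1 hg.kap hy.kap _)).add (m1 hx hg.kap _)
      have key := ((s lp dp).sub (s lm dm)).sub ((q lp dp).add (q lm dm))
      convert key using 1
      have ep' : (L + a) ^ 2 * (β₀ + d) + kap (kap β₀) + kap (kap d) =
          (L + a) * (t + kap g) * (kap β₀ + kap d) := by
        rw [ha, hd, ht, hgdef]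
        simp only [map_sub, map_add] at ep ⊢
        linear_combination ep
      have em' : (L + a') ^ 2 * (β₀ + d') + kap (kap β₀) + kap (kap d') =
          (L + a') * (t - kap g) * (kap β₀ + kap d') := by
        rw [ha', hd', ht, hgdef]
        simp only [map_sub] at em ⊢
        linear_combination em
      simp only [map_add]
      linear_combination ep' + em' - 2 * e₀
  -- The second difference of `β` enters the trace only through its product with `F₀`, which has
  -- order one. This factor raises the error from order `2 * b` to `2 * b + 1`.
  have h2 : wproj 0 (pull zc (F₀ + P) * βp) + wproj 0 (pull zc (F₀ - P) * βm) -
      2 * wproj 0 (pull zc F₀ * β₀) - wproj 0 (pull zc P * (βp - βm)) =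
      wproj 0 (pull zc F₀ * ((βp - β₀) + (βm - β₀))) := by
    rw [two_mul, ← wproj_add, ← wproj_add, ← wproj_sub, ← wproj_sub]
    congr 1
    simp only [map_add, map_sub]
    ring
  rw [h2]
  exact ((hZ.mul hε).mono (by omega)).wproj 0

end Cocycle

/-! ### Explicit solution of the linearized equation for the perturbation `z_1^a z_2^b`. -/

section Explicit

variable {a b : ℕ}

/-- The multiplier of the monomial `x^(a-l) x̄^l y^(b-i) ȳ^i`, modulo the second pair of
variables. -/
def qser (a b l i : ℕ) : MvPowerSeries Unit ℂ :=
  ell 0 ^ (a - l) * elli 0 ^ l * C (3 ^ (b - i) * (3 ^ i)⁻¹)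

/-- The small denominators. -/
def pser (a b l i : ℕ) : MvPowerSeries Unit ℂ := (qser a b l i - 1) * (qser a b l i - C 25)

theorem three_zpow_ratio (b i : ℕ) (hi : i ≤ b) :
    (3 : ℂ) ^ (b - i) * (3 ^ i)⁻¹ = 3 ^ ((b : ℤ) - 2 * i) := by
  rw [← zpow_natCast, ← zpow_natCast, ← zpow_neg, ← zpow_add₀ (by norm_num)]
  congr 1
  push_cast [hi]; ring

theorem constantCoeff_qser {a b l i : ℕ} (hl : l ≤ a) (hi : i ≤ b) :
    constantCoeff (qser a b l i) = 2 ^ ((a : ℤ) - 2 * l) * 3 ^ ((b : ℤ) - 2 * i) := by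
  rw [qser, map_mul, constantCoeff_C, three_zpow_ratio b i hi]
  congr 1
  rw [map_mul, map_pow, map_pow, constantCoeff_ell, constantCoeff_elli]
  change (2 : ℂ) ^ (a - l) * (2⁻¹) ^ l = _
  rw [inv_pow, ← zpow_natCast, ← zpow_natCast, ← zpow_neg, ← zpow_add₀ (by norm_num)]
  congr 1
  push_cast [hl]; ring

/-- The exponent `a - 2 l` is odd, so the monomial has nonzero weight and its multiplier is not 1;
it is not 25 because 5 does not occur in it. -/
theorem constantCoeff_pser_ne {l i : ℕ} (ha : Odd a) (hl : l ≤ a) (hi : i ≤ b) :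
    constantCoeff (pser a b l i) ≠ 0 := by
  rw [pser, map_mul, map_sub, map_sub, map_one, constantCoeff_C, constantCoeff_qser hl hi]
  intro h
  rcases mul_eq_zero.mp h with h | h
  · have : (2 : ℂ) ^ ((a : ℤ) - 2 * l) * 3 ^ ((b : ℤ) - 2 * i) * 5 ^ (0 : ℤ) = 1 := by
      rw [zpow_zero, mul_one]; linear_combination h
    obtain ⟨h1, -, -⟩ := two_three_five_zpow this
    obtain ⟨k, rfl⟩ := ha
    push_cast at h1
    omega
  · have : (2 : ℂ) ^ ((a : ℤ) - 2 * l) * 3 ^ ((b : ℤ) - 2 * i) * 5 ^ (-2 : ℤ) = 1 := by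
      rw [sub_eq_zero.mp h]; norm_num
    obtain ⟨-, -, h1⟩ := two_three_five_zpow this
    norm_num at h1

/-- The solution `E` of `(Q - 1) (Q - 25) E = 10 Q`. -/
def eser (a b l i : ℕ) : MvPowerSeries Unit ℂ := C 10 * qser a b l i * (pser a b l i)⁻¹

theorem pser_mul_eser {l i : ℕ} (ha : Odd a) (hl : l ≤ a) (hi : i ≤ b) :
    pser a b l i * eser a b l i = C 10 * qser a b l i := by
  rw [eser]
  linear_combination (C 10 * qser a b l i) *
    MvPowerSeries.mul_inv_cancel _ (constantCoeff_pser_ne ha hl hi)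

/-- The signed monomial `± binom x^(a-l) x̄^l y^(b-i) ȳ^i`. -/
def mterm (a b l i : ℕ) : MvPowerSeries (Fin 2 ⊕ Fin 2) ℂ :=
  C ((-1 : ℂ) ^ (l + i) * (a.choose l : ℂ) * (b.choose i : ℂ)) *
    (X (Sum.inl 0) ^ (a - l) * X (Sum.inr 0) ^ l *
      (X (Sum.inl 1) ^ (b - i) * X (Sum.inr 1) ^ i))

/-- The index set of the monomials of `z_1^a z_2^b`. -/
def idx (a b : ℕ) : Finset (ℕ × ℕ) := Finset.range (a + 1) ×ˢ Finset.range (b + 1)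

theorem sum_mterm (a b : ℕ) : ∑ p ∈ idx a b, mterm a b p.1 p.2 =
    (X (Sum.inl 0) - X (Sum.inr 0)) ^ a * (X (Sum.inl 1) - X (Sum.inr 1)) ^ b := by
  have h : ∀ (u v : MvPowerSeries (Fin 2 ⊕ Fin 2) ℂ) (n : ℕ), (u - v) ^ n =
      ∑ l ∈ Finset.range (n + 1), C ((-1) ^ l * (n.choose l : ℂ)) * (u ^ (n - l) * v ^ l) := by
    intro u v n
    rw [sub_eq_add_neg, add_comm, add_pow]
    refine Finset.sum_congr rfl fun l _ => ?_
    rw [neg_pow, map_mul, map_pow, map_neg, map_one, map_natCast]; ring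
  rw [h, h, Finset.sum_mul_sum, idx, Finset.sum_product]
  refine Finset.sum_congr rfl fun l _ => Finset.sum_congr rfl fun i _ => ?_
  rw [mterm]
  simp only [map_mul, pow_add]
  ring

theorem hasWt_mterm (a b l i : ℕ) (hl : l ≤ a) (hi : i ≤ b) :
    HasWt ![(a : ℤ) - 2 * l, (b : ℤ) - 2 * i] (mterm a b l i) := by
  classical
  intro m hm
  rw [mterm, X_pow_eq, X_pow_eq, X_pow_eq, X_pow_eq, monomial_mul_monomial, monomial_mul_monomial,
    monomial_mul_monomial, coeff_C_mul, coeff_monomial] at hm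
  have : m = Finsupp.single (Sum.inl 0) (a - l) + Finsupp.single (Sum.inr 0) l +
      (Finsupp.single (Sum.inl 1) (b - i) + Finsupp.single (Sum.inr 1) i) := by
    by_contra hne
    rw [if_neg hne, mul_zero] at hm
    exact hm rfl
  rw [this]
  funext j
  fin_cases j
  · simp [wt]; push_cast [hl]; ring
  · simp [wt]; push_cast [hi]; ring

theorem jd_mterm {a b l i : ℕ} (hi : i ≤ b) : JD b (mterm a b l i) := by
  have := ((jd_X_inl.pow (b - i)).mul (jd_X_inr.pow i)).mono
    (by omega : b ≤ (b - i) * 1 + i * 1)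
  exact (this.mul_left _).mul_left _

theorem JD.of_sub_mul_pow {k n : ℕ} {f h c : MvPowerSeries (Fin 2 ⊕ Fin 2) ℂ}
    (hf : JD 1 (f - h)) (hc : JD k c) : JD (k + 1) (f ^ n * c - h ^ n * c) := by
  have hd := sub_dvd_pow_sub_pow f h n
  obtain ⟨w, hw⟩ := hd
  rw [← sub_mul, hw, mul_assoc]
  exact (hf.mul (hc.mul_left w)).mono (by omega)

/-- To leading order in the second pair `ℓ_2` may be replaced by its value 3, whereas the dependence
of `ℓ_1` on `ζ_1` is kept: it is what produces poles in `ζ_1`. -/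
theorem jd_kap_mterm {a b l i : ℕ} (hi : i ≤ b) :
    JD (b + 1) (kap (mterm a b l i) - sz 0 (qser a b l i) * mterm a b l i) := by
  have e : kap (mterm a b l i) = sz 1 (ell 1 ^ (b - i) * elli 1 ^ i) *
      (sz 0 (ell 0 ^ (a - l) * elli 0 ^ l) * mterm a b l i) := by
    rw [mterm]
    simp only [map_mul, map_pow, kap_X, kapu, Sum.elim_inl, Sum.elim_inr]
    have : kap (C ((-1) ^ (l + i) * (a.choose l : ℂ) * (b.choose i : ℂ))) =
      C ((-1) ^ (l + i) * (a.choose l : ℂ) * (b.choose i : ℂ)) := pull_C _ _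
    simp only [map_mul, map_pow] at this
    rw [this]
    simp only [show (0 : Fin 2).castSucc = 0 from rfl, show (1 : Fin 2).castSucc = 1 from rfl]
    ring
  have hc : constantCoeff (ell 1 ^ (b - i) * elli 1 ^ i) = 3 ^ (b - i) * (3 ^ i)⁻¹ := by
    simp [lam]
  have h1 := jd_sz_sub (ell 1 ^ (b - i) * elli 1 ^ i)
  rw [hc] at h1
  have h2 := (h1.mul ((jd_mterm (a := a) (l := l) hi).mul_left
    (sz 0 (ell 0 ^ (a - l) * elli 0 ^ l)))).mono (by omega : b + 1 ≤ 1 + b)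
  convert h2 using 1
  have hC : ∀ c : ℂ, sz 0 (C c) = C c := fun c => pull_C _ c
  rw [e, qser, map_mul (sz 0) _ (C _), hC]
  ring

/-- The leading part of `z_1^a z_2^b`. -/
def lead (a b : ℕ) : MvPowerSeries (Fin 2 ⊕ Fin 2) ℂ :=
  sz 0 (bser 0 ^ a) * C ((3 / 8) ^ b) * ∑ p ∈ idx a b, mterm a b p.1 p.2

/-- The explicit solution of the linearized equation with right hand side `10 z_1^a z_2^b`. -/
def etah (a b : ℕ) : MvPowerSeries (Fin 2 ⊕ Fin 2) ℂ :=
  sz 0 (bser 0 ^ a) * C ((3 / 8) ^ b) *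
    ∑ p ∈ idx a b, sz 0 (eser a b p.1 p.2) * mterm a b p.1 p.2

theorem mem_idx {p : ℕ × ℕ} : p ∈ idx a b ↔ p.1 ≤ a ∧ p.2 ≤ b := by
  simp [idx]

theorem constantCoeff_bser_one : constantCoeff (bser 1) = 3 / 8 := by
  have := congrArg constantCoeff (bser_mul 1)
  simp [lam] at this
  field_simp at this
  linear_combination this / 8

/-- Here `bser 1` is replaced by its constant term `1 / (3 - 1 / 3) = 3 / 8`, at the cost of one
order. -/
theorem jd_pull_zc_monomial (a b : ℕ) :
    JD (b + 1) (pull zc (X 0 ^ a * X 1 ^ b) - lead a b) := by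
  rw [lead, sum_mterm, map_mul, map_pow, map_pow, pull_X noConst_zc, pull_X noConst_zc, zc, zc]
  have h1 := jd_sz_sub (bser 1)
  rw [constantCoeff_bser_one] at h1
  have h2 := ((jd_X_inl.sub jd_X_inr).pow b).mono (by omega : b ≤ b * 1)
  have h3 := (JD.of_sub_mul_pow (n := b) h1 h2).mul_left
    (sz 0 (bser 0 ^ a) * (X (Sum.inl 0) - X (Sum.inr 0)) ^ a)
  convert h3 using 1
  simp only [show (0 : Fin 2).castSucc = 0 from rfl, show (1 : Fin 2).castSucc = 1 from rfl,
    map_pow, mul_pow]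
  ring

theorem jd_lead (a b : ℕ) : JD b (lead a b) :=
  (JD.sum fun _ hp => jd_mterm (mem_idx.mp hp).2).mul_left _

theorem jd_etah (a b : ℕ) : JD b (etah a b) :=
  (JD.sum fun _ hp => (jd_mterm (mem_idx.mp hp).2).mul_left _).mul_left _

theorem kap_C (c : ℂ) : kap (C c) = C c := pull_C _ c

theorem jd_linearized_etah (ha : Odd a) : JD (b + 1) (C 25 * etah a b + kap (kap (etah a b)) -
    C 26 * kap (etah a b) - C 10 * kap (lead a b)) := by
  have key : ∀ p ∈ idx a b, JD (b + 1) (C 25 * (sz 0 (eser a b p.1 p.2) * mterm a b p.1 p.2) +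
      kap (kap (sz 0 (eser a b p.1 p.2) * mterm a b p.1 p.2)) -
      C 26 * kap (sz 0 (eser a b p.1 p.2) * mterm a b p.1 p.2) -
      C 10 * kap (mterm a b p.1 p.2)) := by
    intro p hp
    obtain ⟨hl, hi⟩ := mem_idx.mp hp
    set M := mterm a b p.1 p.2
    set E := sz 0 (eser a b p.1 p.2) with hE
    set Q := sz 0 (qser a b p.1 p.2) with hQ
    have h1 : JD (b + 1) (kap M - Q * M) := jd_kap_mterm hi
    have h2 : JD (b + 1) (kap (kap M) - Q * kap M) := by
      have := h1.kap
      rwa [map_sub, map_mul, hQ, kap_sz, ← hQ] at this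
    have hPE : (Q - 1) * (Q - C 25) * E = C 10 * Q := by
      have := congrArg (sz 0) (pser_mul_eser (b := b) ha hl hi)
      have hC : ∀ c : ℂ, sz 0 (C c) = C c := fun c => pull_C _ c
      simpa only [pser, map_mul, map_sub, map_one, hC] using this
    have e26 : (C (26 : ℂ) : MvPowerSeries (Fin 2 ⊕ Fin 2) ℂ) = C 25 + 1 := by
      rw [← map_one C, ← map_add]; norm_num
    -- Modulo order `b + 1` the half step multiplies each monomial by `Q`, and the equation becomes
    -- `(25 - 26 Q + Q²) E = 10 Q`.
    have h3 := ((h2.mul_left E).add (h1.mul_left (E * Q - C 26 * E - C 10)))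
    convert h3 using 1
    simp only [map_mul, hE, kap_sz]
    simp only [← hE]
    rw [e26]
    linear_combination M * hPE
  have h4 := (JD.sum key).mul_left (sz 0 (bser 0 ^ a) * C ((3 / 8) ^ b))
  convert h4 using 1
  rw [etah, lead]
  simp only [map_mul, map_sum, kap_sz, kap_C, Finset.sum_sub_distrib, Finset.sum_add_distrib,
    ← Finset.mul_sum]
  ring

theorem hasWt_prefactor (a b : ℕ) :
    HasWt 0 (sz 0 (bser 0 ^ a) * (C ((3 / 8) ^ b) : MvPowerSeries (Fin 2 ⊕ Fin 2) ℂ)) := by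
  have := (hasWt_sz 0 (bser 0 ^ a)).mul (hasWt_C (n := 2) ((3 / 8) ^ b))
  rwa [add_zero] at this

/-- As `a` is odd, the first component `a - 2 l` of the weight never vanishes. This is the
normalization under which the linearized equation has a unique solution. -/
theorem wproj_etah (ha : Odd a) : wproj 0 (etah a b) = 0 := by
  rw [etah, wproj_mul (hasWt_prefactor a b)]
  have : wproj 0 (∑ p ∈ idx a b, sz 0 (eser a b p.1 p.2) * mterm a b p.1 p.2) = 0 := by
    ext m
    rw [coeff_wproj, map_zero]
    split_ifs with hm
    · rw [map_sum]
      refine Finset.sum_eq_zero fun p hp => ?_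
      obtain ⟨hl, hi⟩ := mem_idx.mp hp
      by_contra hne
      have := ((hasWt_sz 0 (eser a b p.1 p.2)).mul (hasWt_mterm a b p.1 p.2 hl hi)) m hne
      rw [hm, zero_add] at this
      have h0 := congrFun this 0
      simp at h0
      obtain ⟨k, rfl⟩ := ha
      push_cast at h0
      omega
    · rfl
  rw [this, mul_zero]

/-- The series of one variable which is the leading part of the second difference of the trace. -/
def sser (a b : ℕ) : MvPowerSeries Unit ℂ :=
  C ((-1) ^ (a + b) * (3 / 8) ^ (2 * b)) * bser 0 ^ (2 * a) * X () ^ a *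
    ∑ p ∈ idx a b, C (((a.choose p.1 : ℂ) * (b.choose p.2)) ^ 2) * eser a b p.1 p.2

theorem wproj_sum {α : Type} (s : Finset α) (f : α → MvPowerSeries (Fin 2 ⊕ Fin 2) ℂ)
    (q : Fin 2 → ℤ) : wproj q (∑ x ∈ s, f x) = ∑ x ∈ s, wproj q (f x) := by
  ext m
  rw [coeff_wproj, map_sum, map_sum]
  simp only [coeff_wproj]
  split_ifs <;> simp

theorem wproj_eq_zero_of_hasWt {q r : Fin 2 → ℤ} {f : MvPowerSeries (Fin 2 ⊕ Fin 2) ℂ}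
    (h : HasWt q f) (hqr : q ≠ r) : wproj r f = 0 := by
  ext m
  rw [coeff_wproj, map_zero]
  split_ifs with hm
  · by_contra hne
    exact hqr (by rw [← h m hne, hm])
  · rfl

theorem mterm_mul_mterm {l i : ℕ} (hl : l ≤ a) (hi : i ≤ b) :
    mterm a b (a - l) (b - i) * mterm a b l i =
      C ((-1) ^ (a + b) * ((a.choose l : ℂ) * (b.choose i)) ^ 2) *
        (zeta 2 0 ^ a * zeta 2 1 ^ b) := by
  obtain ⟨c, rfl⟩ := Nat.exists_eq_add_of_le hl
  obtain ⟨d, rfl⟩ := Nat.exists_eq_add_of_le hi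
  have e1 : ((-1 : ℂ)) ^ (c + d) * (-1) ^ (l + i) = (-1) ^ (l + c + (i + d)) := by
    rw [← pow_add]; congr 1; ring
  have h1 : (l + c).choose c = (l + c).choose l := by
    rw [Nat.choose_symm_of_eq_add (by ring)]
  have h2 : (i + d).choose d = (i + d).choose i := by
    rw [Nat.choose_symm_of_eq_add (by ring)]
  simp only [mterm, Nat.add_sub_cancel_left, Nat.add_sub_cancel, zeta, h1, h2]
  rw [← e1]
  simp only [map_mul, map_pow]
  ring

/-- Only the monomial of opposite weight, of indices `(a - l, b - i)`, pairs with the given one to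
weight zero. -/
theorem wproj_sum_mterm_mul {l i : ℕ} (hl : l ≤ a) (hi : i ≤ b) :
    wproj 0 (∑ q ∈ idx a b, mterm a b q.1 q.2 * mterm a b l i) =
      C ((-1) ^ (a + b) * ((a.choose l : ℂ) * (b.choose i)) ^ 2) *
        (zeta 2 0 ^ a * zeta 2 1 ^ b) := by
  rw [wproj_sum, Finset.sum_eq_single (a - l, b - i)]
  · rw [mterm_mul_mterm hl hi, HasWt.wproj_eq]
    have : zeta 2 0 ^ a * zeta 2 1 ^ b = pull (zeta 2) (X 0 ^ a * X 1 ^ b) := by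
      rw [map_mul, map_pow, map_pow, pull_X noConst_zeta, pull_X noConst_zeta]
    rw [this]
    have := (hasWt_C (n := 2) ((-1) ^ (a + b) * ((a.choose l : ℂ) * (b.choose i)) ^ 2)).mul
      (hasWt_pull_zeta (n := 2) (X 0 ^ a * X 1 ^ b))
    rwa [add_zero] at this
  · intro q hq hne
    obtain ⟨hl', hi'⟩ := mem_idx.mp hq
    refine wproj_eq_zero_of_hasWt
      ((hasWt_mterm a b q.1 q.2 hl' hi').mul (hasWt_mterm a b l i hl hi)) ?_
    intro h
    have h0 : (a : ℤ) - 2 * q.1 + (a - 2 * l) = 0 := congrFun h 0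
    have h1 : (b : ℤ) - 2 * q.2 + (b - 2 * i) = 0 := congrFun h 1
    apply hne
    ext
    · change q.1 = a - l; omega
    · change q.2 = b - i; omega
  · intro hn
    exact absurd (mem_idx.mpr ⟨by omega, by omega⟩) hn

theorem sz_C (j : Fin 2) (c : ℂ) : sz j (C c) = C c := pull_C _ c

theorem sz_X (j : Fin 2) : sz j (X ()) = zeta 2 j := pull_X (noConst_sz j) ()

theorem sz_sser (a b : ℕ) : sz 0 (sser a b) =
    (sz 0 (bser 0 ^ a) * C ((3 / 8) ^ b)) * (sz 0 (bser 0 ^ a) * C ((3 / 8) ^ b)) *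
      (C ((-1) ^ (a + b)) * zeta 2 0 ^ a * ∑ p ∈ idx a b,
        C (((a.choose p.1 : ℂ) * (b.choose p.2)) ^ 2) * sz 0 (eser a b p.1 p.2)) := by
  have e1 : bser 0 ^ (2 * a) = bser 0 ^ a * bser 0 ^ a := by ring
  have e2 : ((-1) ^ (a + b) * (3 / 8) ^ (2 * b) : ℂ) =
    (-1) ^ (a + b) * ((3 / 8) ^ b * (3 / 8) ^ b) := by ring
  have e3 : sz 0 (X () ^ a) = zeta 2 0 ^ a := by rw [map_pow, sz_X]
  have e4 : sz 0 (∑ p ∈ idx a b, C (((a.choose p.1 : ℂ) * (b.choose p.2)) ^ 2) *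
      eser a b p.1 p.2) = ∑ p ∈ idx a b,
        C (((a.choose p.1 : ℂ) * (b.choose p.2)) ^ 2) * sz 0 (eser a b p.1 p.2) := by
    rw [map_sum]
    refine Finset.sum_congr rfl fun p _ => ?_
    rw [map_mul, sz_C]
  rw [sser, e1, e2, map_mul (sz 0), map_mul (sz 0), map_mul (sz 0), map_mul (sz 0), sz_C, e3, e4,
    map_mul C, map_mul C]
  generalize sz 0 (bser 0 ^ a) = u
  ring

/-- Pairing the perturbation with its first order response leaves the diagonal sum: squared binomial
coefficients over the small denominators. -/
theorem wproj_lead_mul_etah (a b : ℕ) :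
    wproj 0 (lead a b * etah a b) = sz 0 (sser a b) * zeta 2 1 ^ b := by
  have hw := hasWt_prefactor a b
  have hw2 := hw.mul hw
  rw [add_zero] at hw2
  rw [sz_sser]
  have e : lead a b * etah a b = (sz 0 (bser 0 ^ a) * C ((3 / 8) ^ b)) *
      (sz 0 (bser 0 ^ a) * C ((3 / 8) ^ b)) * ∑ p ∈ idx a b, sz 0 (eser a b p.1 p.2) *
      ∑ q ∈ idx a b, mterm a b q.1 q.2 * mterm a b p.1 p.2 := by
    rw [lead, etah]
    have : ∀ p ∈ idx a b, sz 0 (eser a b p.1 p.2) *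
        ∑ q ∈ idx a b, mterm a b q.1 q.2 * mterm a b p.1 p.2 =
        (∑ q ∈ idx a b, mterm a b q.1 q.2) * (sz 0 (eser a b p.1 p.2) * mterm a b p.1 p.2) := by
      intro p _
      rw [← Finset.sum_mul]; ring
    rw [Finset.sum_congr rfl this, ← Finset.mul_sum]
    ring
  rw [e, wproj_mul hw2, wproj_sum]
  generalize (sz 0 (bser 0 ^ a) * C ((3 / 8) ^ b)) = s
  have : ∀ p ∈ idx a b, wproj 0 (sz 0 (eser a b p.1 p.2) *
      ∑ q ∈ idx a b, mterm a b q.1 q.2 * mterm a b p.1 p.2) =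
      (C ((-1) ^ (a + b)) * (zeta 2 0 ^ a * zeta 2 1 ^ b)) *
      (C (((a.choose p.1 : ℂ) * (b.choose p.2)) ^ 2) * sz 0 (eser a b p.1 p.2)) := by
    intro p hp
    rw [wproj_mul (hasWt_sz _ _), wproj_sum_mterm_mul (mem_idx.mp hp).1 (mem_idx.mp hp).2,
      map_mul C]
    ring
  rw [Finset.sum_congr rfl this, ← Finset.mul_sum]
  ring

end Explicit

end CRSing
end

noncomputable section

namespace CRSing

open MvPowerSeries
open scoped ENNReal NNReal

/-! ### Evaluation of absolutely convergent series of one variable. -/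

section Evaluation

variable {x : ℂ} {f g : MvPowerSeries Unit ℂ}

/-- The value of `f` at the point `x`. -/
def ev (x : ℂ) (f : MvPowerSeries Unit ℂ) : ℂ := ∑' m, coeff m f * x ^ m.degree

theorem enorm_term (x : ℂ) (f : MvPowerSeries Unit ℂ) (m : Unit →₀ ℕ) :
    ‖coeff m f * x ^ m.degree‖ₑ = ‖coeff m f‖ₑ * (‖x‖₊ : ℝ≥0∞) ^ m.degree := by
  rw [enorm_mul, enorm_pow]; rfl

theorem summable_norm_term (hf : nrm ‖x‖₊ f ≠ ∞) :
    Summable fun m => ‖coeff m f * x ^ m.degree‖ := by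
  rw [nrm] at hf
  simp only [← enorm_term] at hf
  exact NNReal.summable_coe.mpr (ENNReal.tsum_coe_ne_top_iff_summable.mp hf)

theorem ev_add (hf : nrm ‖x‖₊ f ≠ ∞) (hg : nrm ‖x‖₊ g ≠ ∞) : ev x (f + g) = ev x f + ev x g := by
  rw [ev, ev, ev, ← (summable_norm_term hf).of_norm.tsum_add (summable_norm_term hg).of_norm]
  simp only [map_add, add_mul]

theorem sum_antidiagonal_term (x : ℂ) (f g : MvPowerSeries Unit ℂ) (m : Unit →₀ ℕ) :
    coeff m (f * g) * x ^ m.degree = ∑ p ∈ Finset.HasAntidiagonal.antidiagonal m,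
      coeff p.1 f * x ^ p.1.degree * (coeff p.2 g * x ^ p.2.degree) := by
  classical
  rw [coeff_mul, Finset.sum_mul]
  refine Finset.sum_congr rfl fun p hp => ?_
  rw [← Finset.HasAntidiagonal.mem_antidiagonal.mp hp, map_add, pow_add]; ring

theorem tsum_mul_tsum_of_summable_norm_unit {u w : (Unit →₀ ℕ) → ℂ} (su : Summable fun m => ‖u m‖)
    (sw : Summable fun m => ‖w m‖) : (∑' m, u m) * ∑' m, w m =
      ∑' m, ∑ p ∈ Finset.HasAntidiagonal.antidiagonal m, u p.1 * w p.2 :=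
  Summable.tsum_mul_tsum_eq_tsum_sum_antidiagonal su.of_norm sw.of_norm
    (summable_mul_of_summable_norm su sw)

theorem ev_mul (hf : nrm ‖x‖₊ f ≠ ∞) (hg : nrm ‖x‖₊ g ≠ ∞) : ev x (f * g) = ev x f * ev x g := by
  have h := tsum_mul_tsum_of_summable_norm_unit (summable_norm_term hf) (summable_norm_term hg)
  simp only [ev, sum_antidiagonal_term]
  exact h.symm

theorem ev_C (x c : ℂ) : ev x (C c) = c := by
  rw [ev, tsum_eq_single 0]
  · simp
  · intro m hm; rw [coeff_C_of_ne_zero hm, zero_mul]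

theorem ev_X (x : ℂ) : ev x (X ()) = x := by
  classical
  rw [ev, tsum_eq_single (Finsupp.single () 1)]
  · simp
  · intro m hm; rw [coeff_X, if_neg hm, zero_mul]

theorem enorm_ev_le (x : ℂ) (f : MvPowerSeries Unit ℂ) : ‖ev x f‖ₑ ≤ nrm ‖x‖₊ f := by
  rw [nrm]
  simp only [← enorm_term]
  exact enorm_tsum_le_tsum_enorm

/-- The algebra of the power series which converge absolutely at `x`. -/
def wiener (x : ℂ) : Subalgebra ℂ (MvPowerSeries Unit ℂ) where
  carrier := {f | nrm ‖x‖₊ f ≠ ∞}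
  mul_mem' hf hg := ne_top_of_le_ne_top (ENNReal.mul_ne_top hf hg) (nrm_mul_le _ _ _)
  add_mem' hf hg := ne_top_of_le_ne_top (ENNReal.add_ne_top.mpr ⟨hf, hg⟩) (nrm_add_le _ _ _)
  algebraMap_mem' c := by
    change nrm _ (algebraMap ℂ (MvPowerSeries Unit ℂ) c) ≠ ∞
    rw [MvPowerSeries.algebraMap_apply, Algebra.algebraMap_self, RingHom.id_apply, nrm_C]
    exact ENNReal.coe_ne_top

theorem C_mem_wiener (x c : ℂ) : C c ∈ wiener x := by
  change nrm _ (C c) ≠ ∞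
  rw [nrm_C]; exact ENNReal.coe_ne_top

theorem X_mem_wiener (x : ℂ) : X () ∈ wiener x := by
  change nrm _ (X ()) ≠ ∞
  rw [nrm_X]; exact ENNReal.coe_ne_top

/-- Evaluation at `x`. -/
def evHom (x : ℂ) : wiener x →+* ℂ where
  toFun f := ev x f
  map_one' := by simpa using ev_C x 1
  map_zero' := by simpa using ev_C x 0
  map_mul' f g := ev_mul f.2 g.2
  map_add' f g := ev_add f.2 g.2

theorem evHom_mk {h : f ∈ wiener x} : evHom x ⟨f, h⟩ = ev x f := rfl

end Evaluation

/-! ### The coefficients in `ζ_2` of the trace, and its second difference. -/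

section Strip

/-- The coefficient of the `b`-th power of the second variable. -/
def strip (b : ℕ) : MvPowerSeries (Fin 2) ℂ →ₗ[ℂ] MvPowerSeries Unit ℂ where
  toFun f := fun m => coeff (Finsupp.single 0 (m ()) + Finsupp.single 1 b) f
  map_add' _ _ := rfl
  map_smul' _ _ := rfl

theorem coeff_strip (b : ℕ) (f : MvPowerSeries (Fin 2) ℂ) (m : Unit →₀ ℕ) :
    coeff m (strip b f) = coeff (Finsupp.single 0 (m ()) + Finsupp.single 1 b) f := rfl

theorem degree_unit (m : Unit →₀ ℕ) : m.degree = m () := by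
  rw [Finsupp.degree_eq_sum]; simp

theorem nrm_strip_mul_le (r : ℝ≥0) (b : ℕ) (f : MvPowerSeries (Fin 2) ℂ) :
    nrm r (strip b f) * (r : ℝ≥0∞) ^ b ≤ nrm r f := by
  rw [nrm, nrm, ← ENNReal.tsum_mul_right]
  have hinj : Function.Injective fun m : Unit →₀ ℕ =>
      (Finsupp.single (0 : Fin 2) (m ()) + Finsupp.single 1 b : Fin 2 →₀ ℕ) := by
    intro m k h
    have := DFunLike.congr_fun h 0
    ext
    simpa using this
  refine le_trans (le_of_eq ?_) (ENNReal.tsum_comp_le_tsum_of_injective hinj _)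
  refine tsum_congr fun m => ?_
  rw [coeff_strip, mul_assoc, ← pow_add, degree_unit]
  simp

theorem strip_pull_mul (b : ℕ) (s : MvPowerSeries Unit ℂ) :
    strip b (pull (fun _ => X 0) s * X 1 ^ b) = s := by
  classical
  have hX : NoConst fun _ : Unit => (X 0 : MvPowerSeries (Fin 2) ℂ) := fun _ => by simp
  have hmon : ∀ d : Unit →₀ ℕ, mon (fun _ : Unit => (X 0 : MvPowerSeries (Fin 2) ℂ)) d =
      monomial (Finsupp.single 0 (d ())) 1 := fun d => by
    rw [mon, Finsupp.prod_fintype _ _ (by simp), Fintype.prod_unique, X_pow_eq]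
  refine MvPowerSeries.ext fun m => ?_
  rw [coeff_strip, X_pow_eq, coeff_add_mul_monomial, mul_one,
    coeff_pull_eq_sum hX s _ {m}, Finset.sum_singleton, hmon, coeff_monomial_same, mul_one]
  intro d hd
  rw [Finset.mem_singleton]
  by_contra hne
  apply hd
  rw [hmon, coeff_monomial, if_neg, mul_zero]
  intro h
  have := DFunLike.congr_fun h 0
  apply hne
  ext
  simpa using this.symm

/-- The monomial `ζ_2^b` has degree `2 * b` in the second pair of variables. -/
theorem strip_dg_eq_zero {b : ℕ} {f : MvPowerSeries (Fin 2 ⊕ Fin 2) ℂ} (h : JD (2 * b + 1) f) :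
    strip b (dg f) = 0 := by
  refine MvPowerSeries.ext fun m => ?_
  rw [coeff_strip, coeff_dg, map_zero (coeff m)]
  apply h
  simp [deg₂]; omega

theorem dg_sub {n : ℕ} (f g : MvPowerSeries (Fin n ⊕ Fin n) ℂ) : dg (f - g) = dg f - dg g := by
  ext k; simp [coeff_dg]

theorem dg_add {n : ℕ} (f g : MvPowerSeries (Fin n ⊕ Fin n) ℂ) : dg (f + g) = dg f + dg g := by
  ext k; simp [coeff_dg]

/-- The deviation of the trace `Λ + Λ⁻¹` from its value for the trivial potential. -/
def trace (F : MvPowerSeries (Fin 2) ℂ) (β : MvPowerSeries (Fin 2 ⊕ Fin 2) ℂ) :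
    MvPowerSeries (Fin 2) ℂ := dg (wproj 0 (pull zc F * β))

/-- `Λ⁻¹` converges with `Λ`, and the trace deviation is `Λ + Λ⁻¹` minus a constant. -/
theorem IsEigen.converges_trace {F Λ : MvPowerSeries (Fin 2) ℂ}
    {β : MvPowerSeries (Fin 2 ⊕ Fin 2) ℂ} (h : IsEigen F Λ β) (hΛ : Converges Λ) :
    Converges (trace F β) := by
  have e := h.lam_sq_add_one
  rw [← (hasWt_wproj 0 (pull zc F * β)).pull_zeta_dg] at e
  have e2 : Λ * (C (tr 2) + trace F β - Λ) = 1 := by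
    rw [← dg_pull_zeta (Λ * _), ← dg_pull_zeta (1 : MvPowerSeries (Fin 2) ℂ)]
    congr 1
    rw [map_mul, map_sub, map_add, pull_C, map_one, trace]
    linear_combination -e
  have := ((hΛ.of_mul_eq_one e2).add hΛ).sub (converges_C (tr 2))
  convert this using 1
  ring

/-- Terms of `F` of degree larger than `2 * b` in `z_2` do not influence the coefficient of `ζ_2^b`.
This permits choosing the coefficients of a sparse `F` one after another. -/
theorem strip_trace_eq {F₁ F₂ Λ₁ Λ₂ : MvPowerSeries (Fin 2) ℂ}
    {β₁ β₂ : MvPowerSeries (Fin 2 ⊕ Fin 2) ℂ} (h₁ : IsEigen F₁ Λ₁ β₁) (h₂ : IsEigen F₂ Λ₂ β₂)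
    (h0 : constantCoeff F₂ = 0) {b : ℕ} (hF : ∀ k, k 1 < 2 * b + 1 → coeff k F₁ = coeff k F₂) :
    strip b (trace F₁ β₁) = strip b (trace F₂ β₂) := by
  have hβ := (h₁.jd_sub h₂ h0 hF).1
  have hZ : JD (2 * b + 1) (pull zc F₂ - pull zc F₁) := by
    rw [← map_sub]
    exact jd_pull_zc fun k hk => by rw [map_sub, hF k hk, sub_self]
  have : JD (2 * b + 1) (wproj 0 (pull zc F₂ * β₂) - wproj 0 (pull zc F₁ * β₁)) := by
    rw [← wproj_sub]
    refine JD.wproj ?_ 0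
    convert (hβ.mul_left (pull zc F₂)).add (hZ.mul_right β₁) using 1
    ring
  have h := strip_dg_eq_zero this
  rw [dg_sub, map_sub, sub_eq_zero] at h
  exact h.symm

/-- The second difference of the traces. -/
theorem strip_second_difference {F₀ Λ₀ Λp Λm : MvPowerSeries (Fin 2) ℂ}
    {β₀ βp βm : MvPowerSeries (Fin 2 ⊕ Fin 2) ℂ} {a b : ℕ} (ha : Odd a) (hb : 1 ≤ b)
    (hF : ∀ k, k 1 < 1 → coeff k F₀ = 0) (h₀ : IsEigen F₀ Λ₀ β₀)
    (hp : IsEigen (F₀ + X 0 ^ a * X 1 ^ b) Λp βp) (hm : IsEigen (F₀ - X 0 ^ a * X 1 ^ b) Λm βm) :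
    strip b (trace (F₀ + X 0 ^ a * X 1 ^ b) βp) + strip b (trace (F₀ - X 0 ^ a * X 1 ^ b) βm) -
      (strip b (trace F₀ β₀) + strip b (trace F₀ β₀)) = sser a b := by
  classical
  set P : MvPowerSeries (Fin 2) ℂ := X 0 ^ a * X 1 ^ b with hPdef
  have hP : ∀ k, k 1 < b → coeff k P = 0 := by
    intro k hk
    rw [hPdef, X_pow_eq, X_pow_eq, monomial_mul_monomial, coeff_monomial, if_neg]
    rintro rfl
    simp at hk
  -- By uniqueness for the linearized equation, the first difference of the eigenfunctions agrees
  -- with the explicit solution to leading order.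
  have hε : JD (b + 1) (βp - βm - etah a b) := by
    obtain ⟨c, hc, h1⟩ := jd_first_difference hF hP hb hp hm
    have h2 := jd_linearized_etah (b := b) ha
    have h3 := ((jd_pull_zc_monomial a b).kap).mul_left (C 10)
    refine (jd_of_linearized (A := C 25) (B := C 26) (c := c) (by simp) (by simp) hc ?_
      (hasWt_lam_sub (Λ₂ := Λp) (Λ₁ := Λm)) ?_).1
    · rw [wproj_sub, wproj_sub, hp.2.1, hm.2.1, wproj_etah ha]; simp
    · convert (h1.sub h2).add h3 using 1
      simp only [map_sub]
      ring
  have hη : JD b (βp - βm) := by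
    have := (hε.mono (by omega : b ≤ b + 1)).add (jd_etah a b)
    convert this using 1; ring
  have h4 : JD (2 * b + 1) (wproj 0 (pull zc P * (βp - βm)) - wproj 0 (lead a b * etah a b)) := by
    rw [← wproj_sub]
    refine JD.wproj ?_ 0
    have e1 := ((jd_pull_zc_monomial a b).mul hη).mono (by omega : 2 * b + 1 ≤ _)
    have e2 := ((jd_lead a b).mul hε).mono (by omega : 2 * b + 1 ≤ _)
    convert e1.add e2 using 1
    ring
  have h5 := strip_dg_eq_zero ((jd_second_difference hF hP hb h₀ hp hm).add h4)
  have h6 : dg (wproj 0 (lead a b * etah a b)) = pull (fun _ => X 0) (sser a b) * X 1 ^ b := by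
    rw [wproj_lead_mul_etah, sz_eq_pull_zeta, ← pull_X noConst_zeta, ← map_pow, ← map_mul,
      dg_pull_zeta]
  rw [two_mul] at h5
  simp only [dg_add, dg_sub, h6, map_add (strip b), map_sub (strip b), strip_pull_mul] at h5
  simp only [trace]
  linear_combination h5

end Strip

/-! ### Poles of the second difference, and their accumulation at the origin. -/

section Pole

theorem pser_prod_mul_sum (a b : ℕ) (ha : Odd a) (c : ℕ × ℕ → MvPowerSeries Unit ℂ) :
    (∏ p ∈ idx a b, pser a b p.1 p.2) * ∑ p ∈ idx a b, c p * eser a b p.1 p.2 =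
      ∑ p ∈ idx a b, c p * (C 10 * qser a b p.1 p.2 *
        ∏ p' ∈ (idx a b).erase p, pser a b p'.1 p'.2) := by
  rw [Finset.mul_sum]
  refine Finset.sum_congr rfl fun p hp => ?_
  rw [← Finset.mul_prod_erase _ _ hp]
  linear_combination (c p * ∏ p' ∈ (idx a b).erase p, pser a b p'.1 p'.2) *
    pser_mul_eser ha (mem_idx.mp hp).1 (mem_idx.mp hp).2

/-- With all denominators cleared, this is an identity between polynomials in `sser`, `ℓ_1^{±1}` and
the variable; it can be evaluated at any point where these series converge. -/
theorem sser_mul (a b : ℕ) (ha : Odd a) :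
    sser a b * (ell 0 - elli 0) ^ (2 * a) * (∏ p ∈ idx a b, pser a b p.1 p.2) =
      C ((-1) ^ (a + b) * (3 / 8) ^ (2 * b)) * X () ^ a *
        ∑ p ∈ idx a b, C (((a.choose p.1 : ℂ) * (b.choose p.2)) ^ 2) *
          (C 10 * qser a b p.1 p.2 * ∏ p' ∈ (idx a b).erase p, pser a b p'.1 p'.2) := by
  rw [← pser_prod_mul_sum a b ha, sser]
  have : (ell 0 - elli 0) ^ (2 * a) * bser 0 ^ (2 * a) = 1 := by
    rw [← mul_pow, bser_mul, one_pow]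
  linear_combination (C ((-1) ^ (a + b) * (3 / 8) ^ (2 * b)) * X () ^ a *
    (∏ p ∈ idx a b, pser a b p.1 p.2) * ∑ p ∈ idx a b,
      C (((a.choose p.1 : ℂ) * (b.choose p.2)) ^ 2) * eser a b p.1 p.2) * this

/-- The values of the multipliers of the monomials are different from `1`, and different from `25`
but for one monomial. -/
theorem multiplier_value {a b l i : ℕ} {v : ℝ} (hv : 1 < v) (hva : v ^ a = 25 * 3 ^ b)
    (ha : Odd a) (hl : l ≤ a) (hi : i ≤ b) :
    (v ^ (a - l) * (v⁻¹) ^ l * (3 ^ (b - i) * (3 ^ i)⁻¹) ≠ 1) ∧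
      (v ^ (a - l) * (v⁻¹) ^ l * (3 ^ (b - i) * (3 ^ i)⁻¹) = 25 → l = 0 ∧ i = b) := by
  obtain ⟨c, rfl⟩ := Nat.exists_eq_add_of_le hl
  obtain ⟨d, rfl⟩ := Nat.exists_eq_add_of_le hi
  simp only [Nat.add_sub_cancel_left]
  have hv0 : v ≠ 0 := by positivity
  -- The `a`-th power of the multiplier is rational because `v ^ a` is, so the exponents of 5 and 3
  -- can be compared. They give `a = 2 l` for the value 1, and `l = 0`, then `i = b`, for the value
  -- 25.
  have key : (v ^ c * (v⁻¹) ^ l * (3 ^ d * (3 ^ i)⁻¹)) ^ (l + c) * ((25 * 3 ^ (i + d)) ^ l *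
      3 ^ (i * (l + c))) = (25 * 3 ^ (i + d)) ^ c * 3 ^ (d * (l + c)) := by
    rw [← hva]
    have e1 : v⁻¹ ^ l * v ^ l = 1 := by rw [← mul_pow, inv_mul_cancel₀ hv0, one_pow]
    have e2 : ((3 : ℝ) ^ i)⁻¹ * 3 ^ i = 1 := inv_mul_cancel₀ (by positivity)
    generalize v⁻¹ = u at e1 ⊢
    generalize ((3 : ℝ) ^ i)⁻¹ = s at e2 ⊢
    calc _ = (u ^ l * v ^ l) ^ (l + c) * (s * 3 ^ i) ^ (l + c) *
          ((v ^ (l + c)) ^ c * 3 ^ (d * (l + c))) := by ring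
      _ = _ := by rw [e1, e2]; ring
  have red : ∀ {m n m' n' : ℕ}, (25 : ℝ) ^ m * 3 ^ n = 25 ^ m' * 3 ^ n' → m = m' ∧ n = n' := by
    intro m n m' n' h
    have h2 : (2 : ℂ) ^ (0 : ℤ) * 3 ^ ((n : ℤ) - n') * 5 ^ (2 * (m : ℤ) - 2 * m') = 1 := by
      rw [zpow_zero, one_mul, zpow_sub₀ (by norm_num), zpow_sub₀ (by norm_num), zpow_mul, zpow_mul]
      have h' : (25 : ℂ) ^ m * 3 ^ n = 25 ^ m' * 3 ^ n' := by exact_mod_cast h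
      norm_num
      field_simp
      linear_combination h'
    obtain ⟨-, h3, h5⟩ := two_three_five_zpow h2
    omega
  constructor
  · intro h
    rw [h, one_pow, one_mul] at key
    have : (25 : ℝ) ^ l * 3 ^ ((i + d) * l + i * (l + c)) =
      25 ^ c * 3 ^ ((i + d) * c + d * (l + c)) := by
      rw [pow_add, pow_add, pow_mul 3 (i + d) l, pow_mul 3 (i + d) c]
      linear_combination key
    obtain ⟨h1, -⟩ := red this
    obtain ⟨k, hk⟩ := ha
    omega
  · intro h
    rw [h] at key
    have : (25 : ℝ) ^ (l + c + l) * 3 ^ ((i + d) * l + i * (l + c)) =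
      25 ^ c * 3 ^ ((i + d) * c + d * (l + c)) := by
      rw [pow_add 25, pow_add 3 ((i + d) * l), pow_add 3 ((i + d) * c), pow_mul 3 (i + d) l,
        pow_mul 3 (i + d) c]
      linear_combination key
    obtain ⟨h1, h2⟩ := red this
    have hl0 : l = 0 := by omega
    subst hl0
    refine ⟨rfl, ?_⟩
    have hc : 0 < c := by
      obtain ⟨k, hk⟩ := ha
      omega
    have : i * c = (i + d + d) * c := by linarith
    have := Nat.eq_of_mul_eq_mul_right hc this
    omega

/-- The value of `ℓ_1` at `x` is a root of the quadratic equation, hence `v` or `v⁻¹`. The bound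
`hρ` places it within `1 / 2` of 2, which excludes `v⁻¹ < 1`. -/
theorem ev_ell {x : ℂ} {v : ℝ} (hv : 1 < v) (hx : x = v + (v : ℂ)⁻¹ - 5 / 2)
    (hρ : nrm ‖x‖₊ (ell 0 - C 2) ≤ ENNReal.ofReal (1 / 2)) :
    ∃ h : ell 0 ∈ wiener x, evHom x ⟨ell 0, h⟩ = v := by
  have h1 : ell 0 - C 2 ∈ wiener x := ne_top_of_le_ne_top ENNReal.ofReal_ne_top hρ
  have h : ell 0 ∈ wiener x := by
    simpa using (wiener x).add_mem h1 (C_mem_wiener x 2)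
  refine ⟨h, ?_⟩
  set L : wiener x := ⟨ell 0, h⟩ with hL
  set T : wiener x := ⟨C (tr 0), C_mem_wiener x _⟩
  set Y : wiener x := ⟨X (), X_mem_wiener x⟩
  have e : L ^ 2 - (T + Y) * L + 1 = 0 := Subtype.ext (ell_eq 0)
  have e2 := congrArg (evHom x) e
  have hT : evHom x T = 5 / 2 := by
    rw [evHom_mk, ev_C]
    change (2 : ℂ) + 2⁻¹ = 5 / 2
    norm_num
  have hY : evHom x Y = x := by rw [evHom_mk, ev_X]
  simp only [map_add, map_sub, map_mul, map_pow, map_one, map_zero, hT, hY] at e2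
  have hv0 : (v : ℂ) ≠ 0 := by
    have : v ≠ 0 := by positivity
    exact_mod_cast this
  have e3 : (evHom x L - v) * (evHom x L - (v : ℂ)⁻¹) = 0 := by
    have : (v : ℂ) * (v : ℂ)⁻¹ = 1 := mul_inv_cancel₀ hv0
    linear_combination e2 + evHom x L * hx + this
  rcases mul_eq_zero.mp e3 with h2 | h2
  · exact sub_eq_zero.mp h2
  · exfalso
    have h3 : evHom x L - 2 = ev x (ell 0 - C 2) := by
      have : evHom x (L - ⟨C 2, C_mem_wiener x 2⟩) = ev x (ell 0 - C 2) := rfl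
      rw [← this, map_sub, evHom_mk (h := C_mem_wiener x 2), ev_C]
    have h4 := (enorm_ev_le x (ell 0 - C 2)).trans hρ
    rw [← h3, sub_eq_zero.mp h2] at h4
    have h5 : ‖((v : ℂ)⁻¹ - 2)‖ ≤ 1 / 2 := by
      rw [← ofReal_norm] at h4
      exact (ENNReal.ofReal_le_ofReal_iff (by norm_num)).mp h4
    have h6 : ((v : ℂ)⁻¹ - 2) = ((v⁻¹ - 2 : ℝ) : ℂ) := by push_cast; ring
    rw [h6, Complex.norm_real, Real.norm_eq_abs] at h5
    have h7 : v⁻¹ < 1 := inv_lt_one_of_one_lt₀ hv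
    have := (abs_le.mp h5).1
    linarith

/-- The second difference of the traces does not converge at the poles. -/
theorem nrm_sser_eq_top {a b : ℕ} (ha : Odd a) {v : ℝ} (hv : 1 < v) (hva : v ^ a = 25 * 3 ^ b)
    {x : ℂ} (hx : x = v + (v : ℂ)⁻¹ - 5 / 2) (hx0 : x ≠ 0)
    (hρ : nrm ‖x‖₊ (ell 0 - C 2) ≤ ENNReal.ofReal (1 / 2)) : nrm ‖x‖₊ (sser a b) = ∞ := by
  by_contra hfin
  obtain ⟨hell, hLv⟩ := ev_ell hv hx hρ
  have helli : elli 0 ∈ wiener x :=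
    (wiener x).sub_mem ((wiener x).add_mem (C_mem_wiener x _) (X_mem_wiener x)) hell
  set L : wiener x := ⟨ell 0, hell⟩
  set L' : wiener x := ⟨elli 0, helli⟩
  set c : ℂ → wiener x := fun z => ⟨C z, C_mem_wiener x z⟩
  have hc : ∀ z, evHom x (c z) = z := fun z => by rw [evHom_mk, ev_C]
  have hL' : evHom x L' = (v : ℂ)⁻¹ := by
    have : L * L' = 1 := Subtype.ext (ell_mul_elli 0)
    have := congrArg (evHom x) this
    rw [map_mul, hLv, map_one] at this
    exact eq_inv_of_mul_eq_one_right this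
  set S : wiener x := ⟨sser a b, hfin⟩
  set Y : wiener x := ⟨X (), X_mem_wiener x⟩
  set q : ℕ × ℕ → wiener x := fun p =>
    L ^ (a - p.1) * L' ^ p.1 * c (3 ^ (b - p.2) * (3 ^ p.2)⁻¹) with hq
  set d : ℕ × ℕ → wiener x := fun p => (q p - 1) * (q p - c 25) with hd
  have hqv : ∀ p, (q p : MvPowerSeries Unit ℂ) = qser a b p.1 p.2 := fun p => rfl
  have hdv : ∀ p, (d p : MvPowerSeries Unit ℂ) = pser a b p.1 p.2 := fun p => rfl
  have e : S * (L - L') ^ (2 * a) * (∏ p ∈ idx a b, d p) =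
      c ((-1) ^ (a + b) * (3 / 8) ^ (2 * b)) * Y ^ a *
        ∑ p ∈ idx a b, c (((a.choose p.1 : ℂ) * (b.choose p.2)) ^ 2) *
          (c 10 * q p * ∏ p' ∈ (idx a b).erase p, d p') := by
    apply Subtype.ext
    have := sser_mul a b ha
    push_cast
    simp only [hdv, hqv]
    exact this
  have hqe : ∀ p, evHom x (q p) =
      ((v ^ (a - p.1) * (v⁻¹) ^ p.1 * (3 ^ (b - p.2) * (3 ^ p.2)⁻¹) : ℝ) : ℂ) := by
    intro p
    simp only [hq, map_mul, map_pow, hLv, hL', hc]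
    push_cast
    ring
  have hp0 : ((0, b) : ℕ × ℕ) ∈ idx a b := mem_idx.mpr ⟨by omega, le_rfl⟩
  have hq0 : evHom x (q (0, b)) = 25 := by
    rw [hqe]
    have : v ^ (a - 0) * (v⁻¹) ^ 0 * (3 ^ (b - b) * (3 ^ b)⁻¹) = 25 := by
      simp only [Nat.sub_zero, Nat.sub_self, pow_zero, mul_one, one_mul]
      rw [hva]; field_simp
    simp only at this ⊢
    rw [this]; norm_num
  have hde : ∀ p, evHom x (d p) = (evHom x (q p) - 1) * (evHom x (q p) - 25) := by
    intro p
    simp only [hd, map_mul, map_sub, map_one, hc]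
  have hd0 : evHom x (d (0, b)) = 0 := by rw [hde, hq0]; ring
  have hdne : ∀ p ∈ (idx a b).erase (0, b), evHom x (d p) ≠ 0 := by
    intro p hp
    rw [Finset.mem_erase] at hp
    obtain ⟨hl, hi⟩ := mem_idx.mp hp.2
    obtain ⟨h1, h2⟩ := multiplier_value hv hva ha hl hi
    rw [hde, hqe]
    refine mul_ne_zero ?_ ?_
    · rw [sub_ne_zero]; exact_mod_cast h1
    · rw [sub_ne_zero]
      intro h
      obtain ⟨h3, h4⟩ := h2 (by exact_mod_cast h)
      exact hp.1 (Prod.ext h3 h4)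
  -- If the series converged at `x`, the left-hand side would vanish with the denominator of index
  -- `(0, b)`. On the right only the term omitting that denominator survives, and it is not zero.
  have e2 := congrArg (evHom x) e
  rw [map_mul, map_prod, Finset.prod_eq_zero hp0 hd0, mul_zero, map_mul, map_mul, map_pow, map_sum,
    Finset.sum_eq_single (0, b)] at e2
  · simp only [map_mul, hc, map_prod, hq0] at e2
    rw [evHom_mk, ev_X] at e2
    refine (?_ : _ ≠ (0 : ℂ)) e2.symm
    refine mul_ne_zero (mul_ne_zero (by simp) (pow_ne_zero _ hx0))
      (mul_ne_zero (by simp) (mul_ne_zero (by norm_num) (Finset.prod_ne_zero_iff.mpr hdne)))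
  · intro p _ hne
    rw [map_mul, map_mul, map_prod,
      Finset.prod_eq_zero (Finset.mem_erase.mpr ⟨hne.symm, hp0⟩) hd0, mul_zero, mul_zero]
  · exact fun h => absurd hp0 h

open Filter Topology in
/-- There are poles arbitrarily close to the origin. -/
theorem exists_pole (N : ℕ) {ε : ℝ} (hε : 0 < ε) : ∃ (a b : ℕ) (v : ℝ), Odd a ∧ N < b ∧ 1 < v ∧
    v ^ a = 25 * 3 ^ b ∧ v + v⁻¹ - 5 / 2 ≠ 0 ∧ |v + v⁻¹ - 5 / 2| < ε := by
  have l2 : 0 < Real.log 2 := Real.log_pos (by norm_num)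
  have l3 : 0 < Real.log 3 := Real.log_pos (by norm_num)
  have l25 : 0 < Real.log 25 := Real.log_pos (by norm_num)
  set t : ℕ → ℝ := fun b => Real.log 25 + b * Real.log 3 with ht
  set y : ℕ → ℝ := fun b => t b / (2 * Real.log 2) with hy
  -- An odd integer within a bounded distance of `log (25 * 3^b) / log 2`; the `a`-th root of `25 *
  -- 3^b` then tends to 2.
  set a : ℕ → ℕ := fun b => 2 * ⌊y b⌋₊ + 1 with ha
  have ht0 : ∀ b, 0 < t b := fun b => by positivity
  have hy0 : ∀ b, 0 < y b := fun b => div_pos (ht0 b) (by positivity)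
  have hyT : Tendsto y atTop atTop := by
    refine Tendsto.atTop_div_const (by positivity) ?_
    exact tendsto_atTop_add_const_left _ _ (tendsto_natCast_atTop_atTop.atTop_mul_const l3)
  have h1 : Tendsto (fun b => (⌊y b⌋₊ : ℝ) / y b) atTop (𝓝 1) :=
    tendsto_nat_floor_div_atTop.comp hyT
  have h2 : Tendsto (fun b => (a b : ℝ) / y b) atTop (𝓝 2) := by
    have := (h1.const_mul 2).add (tendsto_inv_atTop_zero.comp hyT)
    rw [show (2 : ℝ) * 1 + 0 = 2 by norm_num] at this
    refine this.congr fun b => ?_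
    have := (hy0 b).ne'
    simp only [ha, Function.comp]
    push_cast
    field_simp
  have h3 : Tendsto (fun b => t b / a b) atTop (𝓝 (Real.log 2)) := by
    have := (h2.inv₀ (by norm_num)).mul_const (2 * Real.log 2)
    rw [show (2 : ℝ)⁻¹ * (2 * Real.log 2) = Real.log 2 by ring] at this
    refine this.congr fun b => ?_
    simp only [hy]
    rw [inv_div, div_div, mul_comm, ← mul_div_assoc]
    have hne : (2 * Real.log 2) ≠ 0 := by positivity
    have hane : (a b : ℝ) ≠ 0 := by simp only [ha]; positivity
    field_simp
  set v : ℕ → ℝ := fun b => Real.exp (t b / a b) with hv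
  have h4 : Tendsto v atTop (𝓝 2) := by
    have := (Real.continuous_exp.tendsto _).comp h3
    rwa [Real.exp_log (by norm_num)] at this
  have h5 : Tendsto (fun b => |v b + (v b)⁻¹ - 5 / 2|) atTop (𝓝 0) := by
    have := ((h4.add (h4.inv₀ (by norm_num))).sub_const (5 / 2)).abs
    rwa [show |(2 : ℝ) + 2⁻¹ - 5 / 2| = 0 by norm_num] at this
  obtain ⟨b, hb, hbN⟩ := ((h5.eventually (gt_mem_nhds hε)).and (eventually_gt_atTop N)).exists
  have ha0 : (a b : ℝ) ≠ 0 := by simp only [ha]; positivity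
  have hva : v b ^ a b = 25 * 3 ^ b := by
    simp only [hv]
    rw [← Real.exp_nat_mul, mul_div_cancel₀ _ ha0]
    simp only [ht]
    rw [Real.exp_add, Real.exp_log (by norm_num), Real.exp_nat_mul, Real.exp_log (by norm_num)]
  have hv1 : 1 < v b := by
    refine Real.one_lt_exp_iff.mpr (div_pos (ht0 b) ?_)
    simp only [ha]; positivity
  refine ⟨a b, b, v b, ⟨_, rfl⟩, hbN, hv1, hva, ?_, hb⟩
  intro h
  have hv0 : v b ≠ 0 := by positivity
  -- The point is zero only for `v = 2` or `v = 1 / 2`. The former would make the even number `2 ^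
  -- a` equal to the odd number `25 * 3 ^ b`, and the latter contradicts `1 < v`.
  have : (v b - 2) * (v b - 1 / 2) = 0 := by
    field_simp at h
    linear_combination h / 2
  rcases mul_eq_zero.mp this with h6 | h6
  · rw [sub_eq_zero.mp h6] at hva
    have h7 : 2 ^ a b = 25 * 3 ^ b := by exact_mod_cast hva
    have h8 : Even (2 ^ a b) := (Nat.even_pow' (by simp [ha])).mpr even_two
    rw [h7, Nat.even_mul, Nat.even_pow] at h8
    rcases h8 with h8 | h8
    · exact absurd h8 (by decide)
    · exact absurd h8.1 (by decide)
  · linarith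

end Pole

end CRSing
end

noncomputable section

namespace CRSing

open MvPowerSeries
open scoped ENNReal NNReal

/-! ### Adaptive choice of the coefficients of the potential. -/

section Adaptive

/-- Sparse exponents `a_k, b_k` and points `x_k → 0` at which the second differences of the traces
diverge. -/
theorem exists_exponents : ∃ (a b : ℕ → ℕ) (x : ℕ → ℂ), (∀ k, Odd (a k)) ∧ 1 ≤ b 0 ∧
    (∀ k, 2 * b k < b (k + 1)) ∧ (∀ k, (‖x k‖₊ : ℝ) ≤ 1 / (k + 1)) ∧
      ∀ k, nrm ‖x k‖₊ (sser (a k) (b k)) = ∞ := by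
  obtain ⟨ρ, hρ, hell⟩ := ((converges_ell 0).sub (converges_C 2)).exists_nrm_le
    (by rw [map_sub, constantCoeff_ell, constantCoeff_C]; exact sub_self _)
    (s := Real.toNNReal (1 / 2)) (by simp)
  have step : ∀ N k : ℕ, ∃ p : ℕ × ℕ × ℂ, Odd p.1 ∧ N < p.2.1 ∧ (‖p.2.2‖₊ : ℝ) ≤ 1 / (k + 1) ∧
      nrm ‖p.2.2‖₊ (sser p.1 p.2.1) = ∞ := by
    intro N k
    obtain ⟨a, b, v, ha, hb, hv, hva, hne, hlt⟩ := exists_pole N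
      (ε := min (ρ : ℝ) (1 / (k + 1))) (lt_min (by exact_mod_cast hρ) (by positivity))
    have hx : ((v + v⁻¹ - 5 / 2 : ℝ) : ℂ) = v + (v : ℂ)⁻¹ - 5 / 2 := by push_cast; ring
    have hnorm : (‖((v + v⁻¹ - 5 / 2 : ℝ) : ℂ)‖₊ : ℝ) = |v + v⁻¹ - 5 / 2| := by
      rw [coe_nnnorm, Complex.norm_real, Real.norm_eq_abs]
    refine ⟨(a, b, ((v + v⁻¹ - 5 / 2 : ℝ) : ℂ)), ha, hb, ?_, ?_⟩
    · rw [hnorm]; exact hlt.le.trans (min_le_right _ _)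
    · refine nrm_sser_eq_top ha hv hva hx (Complex.ofReal_ne_zero.mpr hne) (hell _ ?_)
      rw [← NNReal.coe_le_coe, hnorm]
      exact hlt.le.trans (min_le_left _ _)
  choose f hf using step
  -- Each exponent `b` exceeds twice the preceding one, so later terms lie beyond the reach of
  -- `strip_trace_eq`.
  set s : ℕ → ℕ × ℕ × ℂ := fun k => Nat.rec (f 0 0) (fun k p => f (2 * p.2.1) (k + 1)) k with hs
  have hs0 : s 0 = f 0 0 := rfl
  have hsk : ∀ k, s (k + 1) = f (2 * (s k).2.1) (k + 1) := fun k => rfl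
  have all : ∀ k, ∃ N, s k = f N k := by
    rintro (_ | k)
    · exact ⟨0, hs0⟩
    · exact ⟨_, hsk k⟩
  refine ⟨fun k => (s k).1, fun k => (s k).2.1, fun k => (s k).2.2, ?_, ?_, ?_, ?_, ?_⟩
  · intro k; obtain ⟨N, h⟩ := all k; simp only [h]; exact (hf N k).1
  · exact (hf 0 0).2.1
  · intro k; simp only [hsk]; exact (hf _ _).2.1
  · intro k; obtain ⟨N, h⟩ := all k; simp only [h]; exact (hf N k).2.2.1
  · intro k; obtain ⟨N, h⟩ := all k; simp only [h]; exact (hf N k).2.2.2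

open Classical in
/-- The sparse series `∑ c_k z_1^{a_k} z_2^{b_k}`. -/
def sparse (a b : ℕ → ℕ) (c : ℕ → ℤ) : MvPowerSeries (Fin 2) ℂ := fun m =>
  if h : ∃ k, m = Finsupp.single 0 (a k) + Finsupp.single 1 (b k) then (c h.choose : ℂ) else 0

variable {a b : ℕ → ℕ} {c c' : ℕ → ℤ}

theorem exponent_injective (hb : StrictMono b) {j k : ℕ}
    (h : (Finsupp.single 0 (a j) + Finsupp.single 1 (b j) : Fin 2 →₀ ℕ) =
      Finsupp.single 0 (a k) + Finsupp.single 1 (b k)) : j = k := by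
  have := DFunLike.congr_fun h 1
  simp at this
  exact hb.injective this

theorem coeff_sparse_exponent (hb : StrictMono b) (k : ℕ) :
    coeff (Finsupp.single 0 (a k) + Finsupp.single 1 (b k)) (sparse a b c) = c k := by
  classical
  have h : ∃ j, (Finsupp.single 0 (a k) + Finsupp.single 1 (b k) : Fin 2 →₀ ℕ) =
    Finsupp.single 0 (a j) + Finsupp.single 1 (b j) := ⟨k, rfl⟩
  have : coeff (Finsupp.single 0 (a k) + Finsupp.single 1 (b k)) (sparse a b c) =
    (c h.choose : ℂ) := dif_pos h
  rw [this, ← exponent_injective hb h.choose_spec]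

theorem coeff_sparse_of_ne {m : Fin 2 →₀ ℕ}
    (h : ∀ k, m ≠ Finsupp.single 0 (a k) + Finsupp.single 1 (b k)) :
    coeff m (sparse a b c) = 0 := by
  classical
  exact dif_neg (by push Not; exact h)

theorem coeff_sparse_congr (hb : StrictMono b) {m : Fin 2 →₀ ℕ}
    (h : ∀ k, b k = m 1 → c k = c' k) :
    coeff m (sparse a b c) = coeff m (sparse a b c') := by
  by_cases hm : ∃ k, m = Finsupp.single 0 (a k) + Finsupp.single 1 (b k)
  · obtain ⟨k, rfl⟩ := hm
    rw [coeff_sparse_exponent hb, coeff_sparse_exponent hb, h k (by simp)]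
  · push Not at hm
    rw [coeff_sparse_of_ne hm, coeff_sparse_of_ne hm]

theorem coeff_sparse_of_lt (hb : StrictMono b) (hb0 : 1 ≤ b 0) {m : Fin 2 →₀ ℕ} (hm : m 1 < 1) :
    coeff m (sparse a b c) = 0 := by
  refine coeff_sparse_of_ne fun k hk => ?_
  have h1 : b 0 ≤ b k := hb.monotone (Nat.zero_le k)
  have h2 : m 1 = b k := by rw [hk]; simp
  omega

theorem sparse_update (hb : StrictMono b) (k : ℕ) (z : ℤ) :
    sparse a b (Function.update c k z) =
      sparse a b (Function.update c k 0) + C (z : ℂ) * (X 0 ^ a k * X 1 ^ b k) := by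
  classical
  refine MvPowerSeries.ext fun m => ?_
  rw [map_add, coeff_C_mul, X_pow_eq, X_pow_eq, monomial_mul_monomial, coeff_monomial]
  by_cases hm : m = Finsupp.single 0 (a k) + Finsupp.single 1 (b k)
  · rw [if_pos hm, hm, coeff_sparse_exponent hb, coeff_sparse_exponent hb]
    simp
  · rw [if_neg hm, mul_zero, add_zero]
    by_cases hm' : ∃ j, m = Finsupp.single 0 (a j) + Finsupp.single 1 (b j)
    · obtain ⟨j, rfl⟩ := hm'
      have hjk : j ≠ k := fun h => hm (by rw [h])
      rw [coeff_sparse_exponent hb, coeff_sparse_exponent hb, Function.update_of_ne hjk,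
        Function.update_of_ne hjk]
    · push Not at hm'
      rw [coeff_sparse_of_ne hm', coeff_sparse_of_ne hm']

/-- There is a potential for which the multiplier of every eigenfunction diverges. -/
theorem exists_divergent_potential : ∃ F : MvPowerSeries (Fin 2) ℂ,
    (∀ m, ∃ z : ℤ, coeff m F = z ∧ |z| ≤ 1) ∧ (∀ m, m 1 < 1 → coeff m F = 0) ∧
      ∀ Λ β, IsEigen F Λ β → ¬ Converges Λ := by
  classical
  obtain ⟨a, b, x, ha, hb0, hb2, hx, hpole⟩ := exists_exponents
  have hb : StrictMono b := strictMono_nat_of_lt_succ fun k => by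
    have := hb2 k
    omega
  -- The contrary assumption provides, for every admissible potential, an eigenfunction with
  -- convergent multiplier, so the existence of eigenfunctions need not be proved.
  by_contra! hcon
  have hb1 : ∀ k, 1 ≤ b k := fun k => hb0.trans (hb.monotone (Nat.zero_le k))
  have hcon' : ∀ c : ℕ → ℤ, (∀ k, |c k| ≤ 1) → ∃ Λ β, IsEigen (sparse a b c) Λ β ∧
      Converges Λ := by
    intro c hc
    refine hcon _ ?_ fun m hm => coeff_sparse_of_lt hb hb0 hm
    intro m
    by_cases hm : ∃ k, m = Finsupp.single 0 (a k) + Finsupp.single 1 (b k)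
    · obtain ⟨k, rfl⟩ := hm
      exact ⟨c k, coeff_sparse_exponent hb k, hc k⟩
    · push Not at hm
      exact ⟨0, by rw [coeff_sparse_of_ne hm]; simp, by simp⟩
  choose! Λ β hE hC using hcon'
  set T : (ℕ → ℤ) → MvPowerSeries (Fin 2) ℂ := fun c => trace (sparse a b c) (β c) with hT
  have hlow : ∀ (c : ℕ → ℤ) k, k 1 < 1 → coeff k (sparse a b c) = 0 :=
    fun c k hk => coeff_sparse_of_lt hb hb0 hk
  have h0 : ∀ c, constantCoeff (sparse a b c) = 0 := fun c => by simpa using hlow c 0 (by simp)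
  have hlocal : ∀ c c' : ℕ → ℤ, (∀ k, |c k| ≤ 1) → (∀ k, |c' k| ≤ 1) → ∀ k,
      (∀ j ≤ k, c j = c' j) → strip (b k) (T c) = strip (b k) (T c') := by
    intro c c' hc hc' k hk
    refine strip_trace_eq (hE c hc) (hE c' hc') (h0 c') fun m hm => coeff_sparse_congr hb ?_
    intro j hj
    refine hk j ?_
    by_contra hlt
    have : b (k + 1) ≤ b j := hb.monotone (by omega)
    have := hb2 k
    omega
  have hupd : ∀ c : ℕ → ℤ, (∀ k, |c k| ≤ 1) → ∀ k z, |z| ≤ 1 →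
      ∀ j, |Function.update c k z j| ≤ 1 := by
    intro c hc k z hz j
    by_cases h : j = k
    · subst h; simpa using hz
    · rw [Function.update_of_ne h]; exact hc j
  have hstep : ∀ c : ℕ → ℤ, (∀ k, |c k| ≤ 1) → ∀ k, ∃ z : ℤ, |z| ≤ 1 ∧
      nrm ‖x k‖₊ (strip (b k) (T (Function.update c k z))) = ∞ := by
    intro c hc k
    by_contra! hfin
    -- If the coefficients 0, 1 and -1 all gave convergence at `x k`, so would the second difference
    -- `sser`, which diverges there.
    have f0 := hfin 0 (by simp)
    have f1 := hfin 1 (by simp)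
    have f2 := hfin (-1) (by simp)
    have e0 := hE _ (hupd c hc k 0 (by simp))
    have e1 := hE _ (hupd c hc k 1 (by simp))
    have e2 := hE _ (hupd c hc k (-1) (by simp))
    have s1 : sparse a b (Function.update c k 1) =
        sparse a b (Function.update c k 0) + X 0 ^ a k * X 1 ^ b k := by
      rw [sparse_update hb k 1]; simp
    have s2 : sparse a b (Function.update c k (-1)) =
        sparse a b (Function.update c k 0) - X 0 ^ a k * X 1 ^ b k := by
      rw [sparse_update hb k (-1)]; simp [sub_eq_add_neg]
    have key := strip_second_difference (ha k) (hb1 k) (hlow _) e0 (s1 ▸ e1) (s2 ▸ e2)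
    rw [← s1, ← s2] at key
    have w0 : strip (b k) (T (Function.update c k 0)) ∈ wiener (x k) := f0
    have w1 : strip (b k) (T (Function.update c k 1)) ∈ wiener (x k) := f1
    have w2 : strip (b k) (T (Function.update c k (-1))) ∈ wiener (x k) := f2
    have : sser (a k) (b k) ∈ wiener (x k) := by
      rw [← key]
      exact (wiener (x k)).sub_mem ((wiener (x k)).add_mem w1 w2) ((wiener (x k)).add_mem w0 w0)
    exact this (hpole k)
  choose! z hz hzinf using hstep
  set S : ℕ → ℕ → ℤ := fun k => Nat.rec (fun _ => 0) (fun k c => Function.update c k (z c k)) k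
    with hS
  have hSk : ∀ k, S (k + 1) = Function.update (S k) k (z (S k) k) := fun k => rfl
  have hS1 : ∀ k j, |S k j| ≤ 1 := by
    intro k
    induction k with
    | zero => intro j; simp [hS]
    | succ k ih => rw [hSk]; exact hupd _ ih k _ (hz _ ih k)
  have hstab : ∀ k n j, j < k → S (k + n) j = S k j := by
    intro k n j hj
    induction n with
    | zero => rfl
    | succ n ih => rw [← add_assoc, hSk, Function.update_of_ne (by omega), ih]
  -- The diagonal of the successive choices. It agrees with stage `k + 1` at all indices up to `k`,
  -- which is all that the `k`-th strip sees.
  set c : ℕ → ℤ := fun k => S (k + 1) k with hc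
  have hc1 : ∀ k, |c k| ≤ 1 := fun k => hS1 (k + 1) k
  have hcinf : ∀ k, nrm ‖x k‖₊ (strip (b k) (T c)) = ∞ := by
    intro k
    rw [hlocal c (S (k + 1)) hc1 (hS1 (k + 1)) k, hSk]
    · exact hzinf _ (hS1 k) k
    · intro j hj
      have := hstab (j + 1) (k - j) j (by omega)
      rw [show j + 1 + (k - j) = k + 1 by omega] at this
      exact this.symm
  obtain ⟨r, hr, hfin⟩ := converges_iff.mp ((hE c hc1).converges_trace (hC c hc1))
  -- A polydisc of convergence of radius `r` would contain some `x k`, where the `k`-th strip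
  -- diverges.
  obtain ⟨k, hk⟩ := exists_nat_one_div_lt (show (0 : ℝ) < r by exact_mod_cast hr)
  have hle : ‖x k‖₊ ≤ r := by
    rw [← NNReal.coe_le_coe]
    exact (hx k).trans hk.le
  have h1 := nrm_mono hle (strip (b k) (T c))
  rw [hcinf k, top_le_iff] at h1
  have h2 := nrm_strip_mul_le r (b k) (T c)
  rw [h1, ENNReal.top_mul (by positivity), top_le_iff] at h2
  exact hfin h2

end Adaptive

end CRSing
end

noncomputable section

namespace CRSing

open MvPowerSeries
open scoped ENNReal NNReal

theorem comp_eq_pull {ι : Type} [Finite ι] {F G : FormalMap ι} (hG : NoConst G) :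
    comp F G = fun i => pull G (F i) := by
  funext i; rw [comp, pull_eq_subst hG]

/-! ### The submanifold and its deck transformations. -/

section Submanifold

/-- The space of power series in `(z', w')`. -/
abbrev PS₆ : Type := MvPowerSeries (Fin 3 ⊕ Fin 3) ℂ

/-- The first integral `(z² + w² - (λ_j + λ_j⁻¹) z w) / (1 + z w)`. -/
def inva (j : Fin 3) : PS₆ :=
  (X (Sum.inl j) ^ 2 + X (Sum.inr j) ^ 2 - C (tr j) * X (Sum.inl j) * X (Sum.inr j)) *
    (1 + X (Sum.inl j) * X (Sum.inr j))⁻¹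

theorem inva_mul (j : Fin 3) : inva j * (1 + X (Sum.inl j) * X (Sum.inr j)) =
    X (Sum.inl j) ^ 2 + X (Sum.inr j) ^ 2 - C (tr j) * X (Sum.inl j) * X (Sum.inr j) := by
  have h : constantCoeff (1 + X (Sum.inl j) * X (Sum.inr j) : PS₆) ≠ 0 := by simp
  rw [inva, mul_assoc, MvPowerSeries.inv_mul_cancel _ h, mul_one]

theorem constantCoeff_inva (j : Fin 3) : constantCoeff (inva j) = 0 := by simp [inva]

/-- The first integral is the unique `J` with `z² + w² - (λ + λ⁻¹ + J) z w = J`, because `1 + z w`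
is not a zero divisor. In this form its invariances are exchanges of roots of a quadratic
polynomial. -/
theorem pull_inva_eq {τ : Type} {G : Fin 3 ⊕ Fin 3 → MvPowerSeries τ ℂ} (hG : NoConst G)
    {j : Fin 3} {J : MvPowerSeries τ ℂ} (hJ : G (Sum.inl j) ^ 2 + G (Sum.inr j) ^ 2 -
      (C (tr j) + J) * G (Sum.inl j) * G (Sum.inr j) = J) : pull G (inva j) = J := by
  have h := congrArg (pull G) (inva_mul j)
  simp only [map_mul, map_add, map_sub, map_pow, map_one, pull_X hG, pull_C] at h
  have hne : (1 + G (Sum.inl j) * G (Sum.inr j)) ≠ 0 := by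
    intro h0
    have := congrArg constantCoeff h0
    rw [map_add, map_mul, hG] at this
    simp at this
  refine mul_right_cancel₀ hne ?_
  linear_combination h + hJ

theorem converges_inva (j : Fin 3) : Converges (inva j) := by
  have h : constantCoeff (1 + X (Sum.inl j) * X (Sum.inr j) : PS₆) ≠ 0 := by simp
  have h1 : Converges (1 + X (Sum.inl j) * X (Sum.inr j) : PS₆) := by
    rw [← map_one C]
    exact (converges_C 1).add ((converges_X _).mul (converges_X _))
  refine Converges.mul ?_ (h1.of_mul_eq_one (MvPowerSeries.mul_inv_cancel _ h))
  exact (((converges_X _).pow 2).add ((converges_X _).pow 2)).sub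
    (((converges_C _).mul (converges_X _)).mul (converges_X _))

variable {F : MvPowerSeries (Fin 2) ℂ}

/-- The first two coordinates `z_1, z_2`. -/
def zfst (k : Fin 2) : PS₆ := X (Sum.inl k.castSucc)

/-- The first two coordinates `w_1, w_2`. -/
def wfst (k : Fin 2) : PS₆ := X (Sum.inr k.castSucc)

theorem noConst_zfst : NoConst zfst := fun k => by simp [zfst]

theorem noConst_wfst : NoConst wfst := fun k => by simp [wfst]

/-- The functions `S_j`, for which `w_j ↦ S_j z_j - w_j` are the deck transformations. -/
def pot (F : MvPowerSeries (Fin 2) ℂ) (j : Fin 3) : PS₆ :=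
  C (tr j) + if j = 2 then pull zfst F else inva j

/-- The functions `S_j` with the roles of `z'` and `w'` exchanged. -/
def pot' (F : MvPowerSeries (Fin 2) ℂ) (j : Fin 3) : PS₆ :=
  C (tr j) + if j = 2 then pull wfst F else inva j

theorem pot_castSucc (F : MvPowerSeries (Fin 2) ℂ) (j : Fin 2) :
    pot F j.castSucc = C (tr j.castSucc) + inva j.castSucc := by
  rw [pot, if_neg]; fin_cases j <;> decide

theorem pot'_castSucc (F : MvPowerSeries (Fin 2) ℂ) (j : Fin 2) :
    pot' F j.castSucc = C (tr j.castSucc) + inva j.castSucc := by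
  rw [pot', if_neg]; fin_cases j <;> decide

theorem pot_two (F : MvPowerSeries (Fin 2) ℂ) : pot F 2 = C (tr 2) + pull zfst F := by simp [pot]

theorem pot'_two (F : MvPowerSeries (Fin 2) ℂ) : pot' F 2 = C (tr 2) + pull wfst F := by
  simp [pot']

theorem fin_three_cases {P : Fin 3 → Prop} (h : ∀ j : Fin 2, P j.castSucc) (h2 : P 2) (j : Fin 3) :
    P j := by
  fin_cases j
  · exact h 0
  · exact h 1
  · exact h2

/-- The functions `E_j`. -/
def eqn (F : MvPowerSeries (Fin 2) ℂ) (j : Fin 3) : PS₆ :=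
  X (Sum.inr j) ^ 2 - pot F j * X (Sum.inl j) * X (Sum.inr j)

theorem eqn_castSucc (F : MvPowerSeries (Fin 2) ℂ) (j : Fin 2) :
    eqn F j.castSucc = inva j.castSucc - X (Sum.inl j.castSucc) ^ 2 := by
  rw [eqn, pot_castSucc]; linear_combination -(inva_mul j.castSucc)

theorem pot_eq_eqn (F : MvPowerSeries (Fin 2) ℂ) (j : Fin 2) : pot F j.castSucc =
    C (tr j.castSucc) + eqn F j.castSucc + X (Sum.inl j.castSucc) ^ 2 := by
  rw [eqn_castSucc, pot_castSucc]; ring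

theorem constantCoeff_pot (hF : constantCoeff F = 0) (j : Fin 3) :
    constantCoeff (pot F j) = tr j := by
  induction j using fin_three_cases with
  | h j => rw [pot_castSucc, map_add, constantCoeff_inva, constantCoeff_C, add_zero]
  | h2 => rw [pot_two, map_add, constantCoeff_pull noConst_zfst, hF, constantCoeff_C, add_zero]

theorem constantCoeff_pot' (hF : constantCoeff F = 0) (j : Fin 3) :
    constantCoeff (pot' F j) = tr j := by
  induction j using fin_three_cases with
  | h j => rw [pot'_castSucc, map_add, constantCoeff_inva, constantCoeff_C, add_zero]
  | h2 => rw [pot'_two, map_add, constantCoeff_pull noConst_wfst, hF, constantCoeff_C, add_zero]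

theorem converges_pot (hF : Converges F) (j : Fin 3) : Converges (pot F j) := by
  induction j using fin_three_cases with
  | h j => rw [pot_castSucc]; exact (converges_C _).add (converges_inva _)
  | h2 =>
    rw [pot_two]
    exact (converges_C _).add (hF.pull noConst_zfst fun _ => converges_X _)

theorem converges_eqn (hF : Converges F) (j : Fin 3) : Converges (eqn F j) :=
  ((converges_X _).pow 2).sub (((converges_pot hF j).mul (converges_X _)).mul (converges_X _))

theorem ord_two_mul_X {τ : Type} (f : MvPowerSeries τ ℂ) (i j : τ) : Ord 2 (f * X i * X j) := by
  have h : ∀ k : τ, Ord 1 (X k : MvPowerSeries τ ℂ) := fun k => ord_one_iff.mpr (by simp)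
  exact ((Ord.zero f).mul (h i)).mul (h j)

theorem ord_eqn (F : MvPowerSeries (Fin 2) ℂ) (j : Fin 3) : Ord 2 (eqn F j) := by
  refine Ord.sub ?_ (ord_two_mul_X _ _ _)
  have := ord_two_mul_X (1 : PS₆) (Sum.inr j) (Sum.inr j)
  rwa [one_mul, ← pow_two] at this

theorem exists_submanifold (hF : Converges F) :
    ∃ M : Set (Fin 3 ⊕ Fin 3 → ℂ), IsRealAnalyticSubmanifold M (eqn F) := by
  have hr : ∃ r : ℝ, 0 < r ∧ ∀ j, Summable fun m : Fin 3 ⊕ Fin 3 →₀ ℕ =>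
      ‖coeff m (eqn F j)‖ * r ^ m.degree := by
    choose r hr hs using converges_eqn hF
    refine ⟨min (r 0) (min (r 1) (r 2)), lt_min (hr 0) (lt_min (hr 1) (hr 2)), fun j => ?_⟩
    have h0 : 0 ≤ min (r 0) (min (r 1) (r 2)) := (lt_min (hr 0) (lt_min (hr 1) (hr 2))).le
    refine Summable.of_nonneg_of_le (fun m => by positivity) (fun m => ?_) (hs j)
    have : min (r 0) (min (r 1) (r 2)) ≤ r j := by fin_cases j <;> simp
    gcongr
  obtain ⟨r, hr, hs⟩ := hr
  refine ⟨_, ord_eqn F, fun j m _ => ?_, r, hr, hs, rfl⟩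
  have : X (Sum.inr j) ∣ eqn F j := ⟨X (Sum.inr j) - pot F j * X (Sum.inl j), by rw [eqn]; ring⟩
  exact X_dvd_iff.mp this _ (by simp)

theorem antiholQuad_eqn (F : MvPowerSeries (Fin 2) ℂ) (j : Fin 3) (w : Fin 3 → ℂ) :
    antiholQuad (eqn F) j w = w j ^ 2 := by
  classical
  have key : ∀ m : Fin 3 →₀ ℕ, coeff (Finsupp.sumElim (0 : Fin 3 →₀ ℕ) m) (eqn F j) =
      if m = Finsupp.single j 2 then 1 else 0 := by
    intro m
    have h1 : coeff (Finsupp.sumElim (0 : Fin 3 →₀ ℕ) m)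
        (pot F j * X (Sum.inl j) * X (Sum.inr j)) = 0 := by
      have hd : X (Sum.inl j) ∣ pot F j * X (Sum.inl j) * X (Sum.inr j) :=
        ⟨pot F j * X (Sum.inr j), by ring⟩
      exact X_dvd_iff.mp hd _ (by simp)
    rw [eqn, map_sub, h1, sub_zero, coeff_X_pow]
    congr 1
    rw [eq_iff_iff]
    constructor
    · intro h
      ext k
      have := DFunLike.congr_fun h (Sum.inr k)
      by_cases hk : j = k
      · subst hk; simpa using this
      · simpa [Finsupp.single_apply, hk] using this
    · rintro rfl
      ext (k | k)
      · simp
      · by_cases hk : j = k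
        · subst hk; simp
        · simp [hk]
  rw [antiholQuad, Finset.sum_eq_single (Finsupp.single j 2)]
  · rw [key, if_pos rfl, one_mul, Finset.prod_eq_single j]
    · simp
    · intro k _ hk
      simp [Ne.symm hk]
    · simp
  · intro m _ hm
    rw [key, if_neg hm, zero_mul]
  · intro h
    exfalso
    apply h
    rw [Finset.mem_finsuppAntidiag]
    simp

theorem conditionB_eqn (F : MvPowerSeries (Fin 2) ℂ) : ConditionB (eqn F) := by
  intro w hw
  funext j
  have := hw j
  rw [antiholQuad_eqn] at this
  exact pow_eq_zero_iff (two_ne_zero) |>.mp this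

/-- The deck transformations. -/
def deck (F : MvPowerSeries (Fin 2) ℂ) (s : Finset (Fin 3)) : FormalMap (Fin 3 ⊕ Fin 3) :=
  Sum.elim (fun i => X (Sum.inl i)) fun i =>
    if i ∈ s then pot F i * X (Sum.inl i) - X (Sum.inr i) else X (Sum.inr i)

theorem noConst_deck (s : Finset (Fin 3)) : NoConst (deck F s) := by
  rintro (i | i)
  · simp [deck]
  · simp only [deck, Sum.elim_inr]; split_ifs <;> simp

theorem converges_deck (hF : Converges F) (s : Finset (Fin 3)) : IsConvergent (deck F s) := by
  rintro (i | i)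
  · exact converges_X _
  · simp only [deck, Sum.elim_inr]
    split_ifs
    · exact ((converges_pot hF i).mul (converges_X _)).sub (converges_X _)
    · exact converges_X _

theorem pull_zfst_of_fix {G : FormalMap (Fin 3 ⊕ Fin 3)} (hG : NoConst G)
    (hz : ∀ i, G (Sum.inl i) = X (Sum.inl i)) : pull G (pull zfst F) = pull zfst F := by
  rw [pull_pull noConst_zfst hG]
  congr 2
  funext k
  rw [zfst, pull_X hG, hz]

/-- `S_3` depends on `z'` only. For the other indices `w_j` and `S_j z_j - w_j` are the two roots of
the equation defining the first integral. -/
theorem pull_deck_pot (s : Finset (Fin 3)) (j : Fin 3) : pull (deck F s) (pot F j) = pot F j := by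
  induction j using fin_three_cases with
  | h2 => rw [pot_two, map_add, pull_C, pull_zfst_of_fix (noConst_deck s) fun i => rfl]
  | h j =>
    rw [pot_castSucc, map_add, pull_C, pull_inva_eq (noConst_deck s) (J := inva j.castSucc)]
    have h := inva_mul j.castSucc
    simp only [deck, Sum.elim_inl, Sum.elim_inr]
    split_ifs
    · rw [pot_castSucc]; linear_combination -h
    · linear_combination -h

theorem comp_deck (s t : Finset (Fin 3)) :
    comp (deck F s) (deck F t) = deck F (symmDiff s t) := by
  rw [comp_eq_pull (noConst_deck t)]
  funext i
  rcases i with i | i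
  · simp only [deck, Sum.elim_inl]
    exact pull_X (noConst_deck t) _
  · have hs : deck F s (Sum.inr i) = if i ∈ s then pot F i * X (Sum.inl i) - X (Sum.inr i)
      else X (Sum.inr i) := rfl
    have e1 : pull (deck F t) (X (Sum.inl i)) = X (Sum.inl i) := pull_X (noConst_deck t) _
    have e2 : pull (deck F t) (X (Sum.inr i)) = deck F t (Sum.inr i) := pull_X (noConst_deck t) _
    rw [hs]
    by_cases h1 : i ∈ s <;> by_cases h2 : i ∈ t
    · rw [if_pos h1, map_sub, map_mul, pull_deck_pot, e1, e2]
      simp [deck, h1, h2, Finset.mem_symmDiff]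
    · rw [if_pos h1, map_sub, map_mul, pull_deck_pot, e1, e2]
      simp [deck, h1, h2, Finset.mem_symmDiff]
    · rw [if_neg h1, e2]
      simp [deck, h1, h2, Finset.mem_symmDiff]
    · rw [if_neg h1, e2]
      simp [deck, h1, h2, Finset.mem_symmDiff]

theorem deck_empty : deck F ∅ = idMap _ := by
  funext i
  rcases i with i | i <;> simp [deck, idMap]

theorem isDeckTransformation_deck (hF : Converges F) (s : Finset (Fin 3)) :
    IsDeckTransformation (eqn F) (deck F s) := by
  refine ⟨converges_deck hF s, ⟨deck F s, noConst_deck s, noConst_deck s, ?_, ?_⟩, ?_⟩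
  · rw [comp_deck, symmDiff_self, Finset.bot_eq_empty, deck_empty]
  · rw [comp_deck, symmDiff_self, Finset.bot_eq_empty, deck_empty]
  · rw [comp_eq_pull (noConst_deck s)]
    funext i
    rcases i with i | i
    · exact pull_X (noConst_deck s) _
    · change pull (deck F s) (eqn F i) = eqn F i
      rw [eqn, map_sub, map_mul, map_mul, map_pow, pull_deck_pot, pull_X (noConst_deck s),
        pull_X (noConst_deck s)]
      simp only [deck, Sum.elim_inl, Sum.elim_inr]
      split_ifs <;> ring

/-- A deck transformation fixes `z'`, the `E_j` and the `S_j`, so each of its last components is one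
of the two roots of the same quadratic equation; power series form a domain. -/
theorem eq_deck_of_isDeckTransformation {τ : FormalMap (Fin 3 ⊕ Fin 3)}
    (h : IsDeckTransformation (eqn F) τ) : ∃ s, τ = deck F s := by
  classical
  obtain ⟨-, ⟨_, hτ, -⟩, hcomp⟩ := h
  rw [comp_eq_pull hτ] at hcomp
  have hz : ∀ i, τ (Sum.inl i) = X (Sum.inl i) := fun i => by
    have := congrFun hcomp (Sum.inl i)
    simpa only [proj₁, Sum.elim_inl, pull_X hτ] using this
  have hE : ∀ i, pull τ (eqn F i) = eqn F i := fun i => congrFun hcomp (Sum.inr i)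
  have hS : ∀ i, pull τ (pot F i) = pot F i := by
    intro i
    induction i using fin_three_cases with
    | h2 => rw [pot_two, map_add, pull_C, pull_zfst_of_fix hτ hz]
    | h j => rw [pot_eq_eqn, map_add, map_add, map_pow, pull_C, hE, pull_X hτ, hz]
  have hw : ∀ i, τ (Sum.inr i) = X (Sum.inr i) ∨
      τ (Sum.inr i) = pot F i * X (Sum.inl i) - X (Sum.inr i) := by
    intro i
    have := hE i
    rw [eqn, map_sub, map_mul, map_mul, map_pow, hS, pull_X hτ, pull_X hτ, hz] at this
    have h2 : (τ (Sum.inr i) - X (Sum.inr i)) *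
        (τ (Sum.inr i) - (pot F i * X (Sum.inl i) - X (Sum.inr i))) = 0 := by
      linear_combination this
    rcases mul_eq_zero.mp h2 with h3 | h3
    · exact Or.inl (sub_eq_zero.mp h3)
    · exact Or.inr (sub_eq_zero.mp h3)
  refine ⟨Finset.univ.filter fun i => τ (Sum.inr i) ≠ X (Sum.inr i), ?_⟩
  funext i
  rcases i with i | i
  · exact hz i
  · simp only [deck, Sum.elim_inr, Finset.mem_filter, Finset.mem_univ, true_and]
    split_ifs with h
    · exact (hw i).resolve_left h
    · exact not_not.mp h

theorem coeff_single_deck (s : Finset (Fin 3)) (i : Fin 3) :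
    coeff (Finsupp.single (Sum.inr i) 1) (deck F s (Sum.inr i)) = if i ∈ s then -1 else 1 := by
  classical
  simp only [deck, Sum.elim_inr]
  split_ifs
  · rw [map_sub, coeff_single_mul, coeff_X, coeff_X]
    simp [Finsupp.single_left_inj]
  · rw [coeff_X]; simp

theorem deck_injective : Function.Injective (deck F) := by
  intro s t h
  ext i
  have := coeff_single_deck (F := F) s i
  rw [h, coeff_single_deck] at this
  by_cases h1 : i ∈ s <;> by_cases h2 : i ∈ t <;> simp [h1, h2] at this ⊢ <;> norm_num at this

theorem conditionD_eqn (hF : Converges F) : ConditionD (eqn F) := by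
  have : {τ | IsDeckTransformation (eqn F) τ} = deck F '' Set.univ := by
    ext τ
    constructor
    · intro h
      obtain ⟨s, rfl⟩ := eq_deck_of_isDeckTransformation h
      exact ⟨s, trivial, rfl⟩
    · rintro ⟨s, -, rfl⟩
      exact isDeckTransformation_deck hF s
  rw [ConditionD, this, Set.ncard_image_of_injective _ deck_injective, Set.ncard_univ,
    Nat.card_eq_fintype_card]
  simp

theorem fixesHypersurface_deck (j : Fin 3) : FixesHypersurface (deck F {j}) := by
  classical
  have hd : deck F {j} (Sum.inr j) - X (Sum.inr j) =
      pot F j * X (Sum.inl j) - X (Sum.inr j) - X (Sum.inr j) := by simp [deck]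
  refine ⟨deck F {j} (Sum.inr j) - X (Sum.inr j), ?_, ?_, ?_⟩
  · intro h
    have := congrArg (coeff (Finsupp.single (Sum.inr j) 1)) h
    rw [map_sub, coeff_single_deck, coeff_X] at this
    simp at this
    norm_num at this
  · rw [hd]; simp
  · congr 1
    apply le_antisymm
    · rw [Ideal.span_le]
      rintro _ ⟨i, rfl⟩
      rcases i with i | i
      · simp [deck]
      · by_cases h : i = j
        · subst h; exact Ideal.subset_span rfl
        · simp [deck, h]
    · rw [Ideal.span_le]
      rintro _ rfl
      exact Ideal.subset_span ⟨Sum.inr j, rfl⟩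

theorem exists_compList (s : Finset (Fin 3)) :
    ∃ l : List (Fin 3), deck F s = compList (l.map fun j => deck F {j}) := by
  induction s using Finset.induction_on with
  | empty => exact ⟨[], deck_empty⟩
  | insert a s ha ih =>
    obtain ⟨l, hl⟩ := ih
    refine ⟨a :: l, ?_⟩
    have : compList ((a :: l).map fun j => deck F {j}) =
      comp (deck F {a}) (compList (l.map fun j => deck F {j})) := rfl
    rw [this, ← hl, comp_deck]
    congr 1
    ext i
    simp only [Finset.mem_insert, Finset.mem_symmDiff, Finset.mem_singleton]
    by_cases h : i = a
    · subst h; simp [ha]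
    · simp [h]

theorem isMoserWebsterFamily (hF : Converges F) :
    IsMoserWebsterFamily (eqn F) fun j => deck F {j} := by
  refine ⟨fun j => ⟨isDeckTransformation_deck hF _, ?_, fixesHypersurface_deck j⟩,
    fun j k => ?_, fun τ hτ => ?_⟩
  · rw [comp_deck, symmDiff_self, Finset.bot_eq_empty, deck_empty]
  · simp only [comp_deck, symmDiff_comm]
  · obtain ⟨s, rfl⟩ := eq_deck_of_isDeckTransformation hτ
    exact exists_compList s

theorem tau₁_deck : tau₁ (fun j => deck F {j}) = deck F Finset.univ := by
  have h : tau₁ (fun j => deck F {j}) =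
    comp (deck F {0}) (comp (deck F {1}) (comp (deck F {2}) (idMap _))) := by
    simp [tau₁, compList, List.ofFn_succ]
  rw [h, ← deck_empty (F := F), comp_deck, comp_deck, comp_deck]
  congr 1

end Submanifold

end CRSing
end

noncomputable section

namespace CRSing

open MvPowerSeries
open scoped ENNReal NNReal

/-! ### The map `σ`, its linear part and the elliptic type. -/

section Reversible

variable {F : MvPowerSeries (Fin 2) ℂ}

theorem map_pull {ι τ : Type} [Finite ι] {F : ι → MvPowerSeries τ ℂ} (hF : NoConst F)
    (φ : ℂ →+* ℂ) (f : MvPowerSeries ι ℂ) :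
    map φ (pull F f) = pull (fun i => map φ (F i)) (map φ f) := by
  have h : NoConst fun i => map φ (F i) := fun i => by
    rw [constantCoeff_map, hF i, map_zero]
  rw [pull_eq_subst hF, pull_eq_subst h, MvPowerSeries.map_subst hF.hasSubst]

theorem conj_lam (j : Fin 3) : (starRingEnd ℂ) (lam j) = lam j := by
  fin_cases j
  · exact map_ofNat _ 2
  · exact map_ofNat _ 3
  · exact map_ofNat _ 5

theorem map_conj_C_tr {τ : Type} (j : Fin 3) :
    map (starRingEnd ℂ) (C (tr j) : MvPowerSeries τ ℂ) = C (tr j) := by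
  rw [map_C, tr, map_add, map_inv₀, conj_lam]

theorem map_conj_inva (j : Fin 3) : map (starRingEnd ℂ) (inva j) = inva j := by
  have h := congrArg (map (starRingEnd ℂ)) (inva_mul j)
  simp only [map_mul, map_add, map_sub, map_pow, map_one, map_X, map_conj_C_tr] at h
  rw [← inva_mul j] at h
  have hne : (1 + X (Sum.inl j) * X (Sum.inr j) : PS₆) ≠ 0 := by
    intro h0
    have := congrArg constantCoeff h0
    simp at this
  exact mul_right_cancel₀ hne h

theorem map_conj_pot (hF : map (starRingEnd ℂ) F = F) (j : Fin 3) :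
    map (starRingEnd ℂ) (pot F j) = pot F j := by
  induction j using fin_three_cases with
  | h j => rw [pot_castSucc, map_add, map_conj_C_tr, map_conj_inva]
  | h2 =>
    rw [pot_two, map_add, map_conj_C_tr, map_pull noConst_zfst, hF]
    simp only [zfst, map_X]
    rfl

/-- The exchange of `z'` and `w'`. -/
def swapMap : FormalMap (Fin 3 ⊕ Fin 3) := fun k => X k.swap

theorem noConst_swapMap : NoConst swapMap := fun k => by simp [swapMap]

theorem pull_swapMap_pot (F : MvPowerSeries (Fin 2) ℂ) (j : Fin 3) :
    pull swapMap (pot F j) = pot' F j := by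
  induction j using fin_three_cases with
  | h j =>
    rw [pot_castSucc, pot'_castSucc, map_add, pull_C, pull_inva_eq noConst_swapMap]
    simp only [swapMap, Sum.swap_inl, Sum.swap_inr]
    linear_combination -(inva_mul j.castSucc)
  | h2 =>
    rw [pot_two, pot'_two, map_add, pull_C, pull_pull noConst_zfst noConst_swapMap]
    congr 3
    funext k
    rw [zfst, pull_X noConst_swapMap]; rfl

/-- The conjugate involution `τ_2`. -/
def deck' (F : MvPowerSeries (Fin 2) ℂ) : FormalMap (Fin 3 ⊕ Fin 3) :=
  Sum.elim (fun i => pot' F i * X (Sum.inr i) - X (Sum.inl i)) fun i => X (Sum.inr i)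

theorem noConst_deck' : NoConst (deck' F) := by
  rintro (i | i) <;> simp [deck']

/-- All coefficients are real, so conjugation by `ρ₀` amounts to exchanging `z'` and `w'`. -/
theorem conjRho_deck (hF : map (starRingEnd ℂ) F = F) :
    conjRho (deck F Finset.univ) = deck' F := by
  funext i
  have h : ∀ f : PS₆, subst (fun k : Fin 3 ⊕ Fin 3 => X (R := ℂ) k.swap) f = pull swapMap f :=
    fun f => (pull_eq_subst noConst_swapMap f).symm
  rw [conjRho, h]
  rcases i with i | i
  · simp only [deck, deck', Sum.swap_inl, Sum.elim_inr, Sum.elim_inl, Finset.mem_univ, if_true,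
      map_sub, map_mul, map_X, map_conj_pot hF, pull_swapMap_pot, pull_X noConst_swapMap]
    simp [swapMap]
  · simp only [deck, deck', Sum.swap_inr, Sum.elim_inr, Sum.elim_inl, map_X,
      pull_X noConst_swapMap]
    simp [swapMap]

/-- The map `σ`. -/
def sig (F : MvPowerSeries (Fin 2) ℂ) : FormalMap (Fin 3 ⊕ Fin 3) :=
  fun i => pull (deck' F) (deck F Finset.univ i)

theorem sigma_deck (hF : map (starRingEnd ℂ) F = F) :
    sigma (fun j => deck F {j}) = sig F := by
  rw [sigma, tau₁_deck, conjRho_deck hF, comp_eq_pull noConst_deck']; rfl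

theorem noConst_sig : NoConst (sig F) := (noConst_deck _).pull noConst_deck'

theorem sig_inl (i : Fin 3) :
    sig F (Sum.inl i) = pot' F i * X (Sum.inr i) - X (Sum.inl i) := pull_X noConst_deck' _

theorem sig_inr (i : Fin 3) : sig F (Sum.inr i) =
    pull (deck' F) (pot F i) * sig F (Sum.inl i) - X (Sum.inr i) := by
  rw [sig, deck, Sum.elim_inr, if_pos (Finset.mem_univ i), map_sub, map_mul,
    pull_X noConst_deck', pull_X noConst_deck', sig_inl]
  rfl

theorem pull_deck'_inva (j : Fin 2) : pull (deck' F) (inva j.castSucc) = inva j.castSucc := by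
  rw [pull_inva_eq noConst_deck']
  simp only [deck', Sum.elim_inl, Sum.elim_inr, pot'_castSucc]
  linear_combination -(inva_mul j.castSucc)

/-- The first integral is symmetric in `z_j` and `w_j`, so its invariance under `τ₁` yields that
under `τ₂`. -/
theorem pull_sig_inva (j : Fin 2) : pull (sig F) (inva j.castSucc) = inva j.castSucc := by
  have h := pull_deck_pot (F := F) Finset.univ j.castSucc
  rw [pot_castSucc, map_add, pull_C, add_right_inj] at h
  have : pull (sig F) (inva j.castSucc) =
      pull (deck' F) (pull (deck F Finset.univ) (inva j.castSucc)) := by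
    rw [pull_pull (noConst_deck _) noConst_deck']; rfl
  rw [this, h, pull_deck'_inva]

theorem jacobian_comp {ι : Type} [Fintype ι] {F G : FormalMap ι} (hG : NoConst G) :
    jacobian (comp F G) = jacobian F * jacobian G := by
  rw [comp_eq_pull hG]
  ext i j
  simp only [jacobian, Matrix.of_apply, Matrix.mul_apply, coeff_single_pull hG]

theorem coeff_single_X {ι : Type} [DecidableEq ι] (i j : ι) :
    coeff (Finsupp.single i 1) (X j : MvPowerSeries ι ℂ) = if i = j then 1 else 0 := by
  rw [coeff_X]; simp [Finsupp.single_left_inj]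

theorem jacobian_deck (hF : constantCoeff F = 0) : jacobian (deck F Finset.univ) =
    Matrix.fromBlocks 1 0 (Matrix.diagonal tr) (-1) := by
  classical
  ext (i | i) (j | j)
  · simp [jacobian, deck, coeff_single_X, Matrix.one_apply, eq_comm]
  · simp [jacobian, deck, coeff_single_X]
  · simp [jacobian, deck, coeff_single_mul, coeff_single_X, constantCoeff_pot hF,
      Matrix.diagonal_apply, eq_comm]
  · simp [jacobian, deck, coeff_single_mul, coeff_single_X, Matrix.one_apply, eq_comm]

theorem jacobian_deck' (hF : constantCoeff F = 0) : jacobian (deck' F) =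
    Matrix.fromBlocks (-1) (Matrix.diagonal tr) 0 1 := by
  classical
  ext (i | i) (j | j)
  · simp [jacobian, deck', coeff_single_mul, coeff_single_X, Matrix.one_apply, eq_comm]
  · simp [jacobian, deck', coeff_single_mul, coeff_single_X, constantCoeff_pot' hF,
      Matrix.diagonal_apply, eq_comm]
  · simp [jacobian, deck', coeff_single_X]
  · simp [jacobian, deck', coeff_single_X, Matrix.one_apply, eq_comm]

/-- The change to the coordinates `(ξ, η)` that diagonalize the linear part of `σ`. -/
def eigenbasis : Matrix (Fin 3 ⊕ Fin 3) (Fin 3 ⊕ Fin 3) ℂ :=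
  Matrix.fromBlocks 1 (Matrix.diagonal lam) (Matrix.diagonal lam) 1

/-- The inverse of `eigenbasis`. -/
def eigenbasisInv : Matrix (Fin 3 ⊕ Fin 3) (Fin 3 ⊕ Fin 3) ℂ :=
  Matrix.fromBlocks (Matrix.diagonal fun j => (1 - lam j ^ 2)⁻¹)
    (Matrix.diagonal fun j => -lam j * (1 - lam j ^ 2)⁻¹)
    (Matrix.diagonal fun j => -lam j * (1 - lam j ^ 2)⁻¹)
    (Matrix.diagonal fun j => (1 - lam j ^ 2)⁻¹)

theorem eigenbasis_mul_inv : eigenbasis * eigenbasisInv = 1 := by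
  rw [eigenbasis, eigenbasisInv, Matrix.fromBlocks_multiply, ← Matrix.fromBlocks_one]
  have h : ∀ j, 1 - lam j ^ 2 ≠ 0 := fun j => sub_ne_zero.mpr (lam_sq_ne_one j).symm
  simp only [Matrix.one_mul, Matrix.diagonal_mul_diagonal, Matrix.diagonal_add]
  congr 1
  · rw [← Matrix.diagonal_one]; congr 1; funext j; have := h j; field_simp; ring
  · rw [← Matrix.diagonal_zero]; congr 1; funext j; have := h j; field_simp; ring
  · rw [← Matrix.diagonal_zero]; congr 1; funext j; have := h j; field_simp; ring
  · rw [← Matrix.diagonal_one]; congr 1; funext j; have := h j; field_simp; ring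

theorem eigenbasis_inv_mul : eigenbasisInv * eigenbasis = 1 :=
  mul_eq_one_comm.mp eigenbasis_mul_inv

theorem jacobian_deck_mul_eigenbasis (hF : constantCoeff F = 0) :
    jacobian (deck F Finset.univ) * eigenbasis = eigenbasis *
      Matrix.fromBlocks 0 (Matrix.diagonal lam) (Matrix.diagonal fun j => (lam j)⁻¹) 0 := by
  rw [jacobian_deck hF, eigenbasis, Matrix.fromBlocks_multiply, Matrix.fromBlocks_multiply]
  simp only [Matrix.one_mul, Matrix.mul_one, Matrix.zero_mul, Matrix.mul_zero, add_zero, zero_add,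
    Matrix.diagonal_mul_diagonal, Matrix.neg_mul]
  congr 1
  · rw [← Matrix.diagonal_one]; congr 1; funext j; exact (mul_inv_cancel₀ (lam_ne_zero j)).symm
  · ext i j
    by_cases h : i = j
    · subst h; simp [tr]
    · simp [h]
  · rw [← Matrix.diagonal_one, Matrix.diagonal_neg, Matrix.diagonal_add]
    congr 1; funext j
    have := lam_ne_zero j
    simp only [tr]; field_simp; ring

theorem jacobian_deck'_mul_eigenbasis (hF : constantCoeff F = 0) :
    jacobian (deck' F) * eigenbasis = eigenbasis *
      Matrix.fromBlocks 0 (Matrix.diagonal fun j => (lam j)⁻¹) (Matrix.diagonal lam) 0 := by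
  rw [jacobian_deck' hF, eigenbasis, Matrix.fromBlocks_multiply, Matrix.fromBlocks_multiply]
  simp only [Matrix.one_mul, Matrix.mul_one, Matrix.zero_mul, Matrix.mul_zero, add_zero, zero_add,
    Matrix.diagonal_mul_diagonal, Matrix.neg_mul]
  congr 1
  · rw [← Matrix.diagonal_one, Matrix.diagonal_neg, Matrix.diagonal_add]
    congr 1; funext j
    have := lam_ne_zero j
    simp only [tr]; field_simp; ring
  · ext i j
    by_cases h : i = j
    · subst h; simp [tr]
    · simp [h]
  · rw [← Matrix.diagonal_one]; congr 1; funext j; exact (mul_inv_cancel₀ (lam_ne_zero j)).symm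

/-- The eigenvalues of the linear part of `σ`. -/
def mu : Fin 3 ⊕ Fin 3 → ℂ := Sum.elim (fun j => lam j ^ 2) fun j => (lam j ^ 2)⁻¹

theorem jacobian_sig_mul_eigenbasis (hF : constantCoeff F = 0) :
    jacobian (sig F) * eigenbasis = eigenbasis * Matrix.diagonal mu := by
  have h : jacobian (sig F) = jacobian (deck F Finset.univ) * jacobian (deck' F) := by
    rw [← jacobian_comp noConst_deck', comp_eq_pull noConst_deck']; rfl
  rw [h, Matrix.mul_assoc, jacobian_deck'_mul_eigenbasis hF, ← Matrix.mul_assoc,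
    jacobian_deck_mul_eigenbasis hF, Matrix.mul_assoc, Matrix.fromBlocks_multiply]
  congr 1
  simp only [Matrix.zero_mul, Matrix.mul_zero, add_zero, zero_add, Matrix.diagonal_mul_diagonal]
  ext (i | i) (j | j)
  · by_cases h : i = j
    · subst h; simp [mu, pow_two]
    · simp [h]
  · simp
  · simp
  · by_cases h : i = j
    · subst h; simp [mu, pow_two]
    · simp [h]

theorem isNonResonant_sig (hF : constantCoeff F = 0) : IsNonResonant (sig F) := by
  refine ⟨fun j => lam j ^ 2, fun j => pow_ne_zero _ (lam_ne_zero j), ?_, ?_⟩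
  · have h : jacobian (sig F) = eigenbasis * Matrix.diagonal mu * eigenbasisInv := by
      rw [← jacobian_sig_mul_eigenbasis hF, Matrix.mul_assoc, eigenbasis_mul_inv, Matrix.mul_one]
    rw [h, Matrix.charpoly_mul_comm, ← Matrix.mul_assoc, eigenbasis_inv_mul, Matrix.one_mul,
      Matrix.charpoly_diagonal, Fintype.prod_sum_type, ← Finset.prod_mul_distrib]
    rfl
  · intro Q hQ h
    have : ∏ j, lam j ^ (2 * Q j) = 1 := by
      rw [← h]
      refine Finset.prod_congr rfl fun j _ => ?_
      rw [zpow_mul]; norm_cast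
    have h2 := two_three_five_zpow_fun this
    apply hQ
    funext j
    have := congrFun h2 j
    simp at this
    exact this

theorem isPurelyElliptic_deck (hF : constantCoeff F = 0) :
    IsPurelyElliptic (deck F Finset.univ) := by
  have hl : ∀ j, ((![2, 3, 5] j : ℝ) : ℂ) = lam j := by
    intro j; fin_cases j <;> simp [lam]
  -- The coordinates are `z = ξ + λ η`, `w = λ ξ + η`: this change is real and symmetric under the
  -- simultaneous exchanges, so `ρ₀` keeps its form.
  refine ⟨![2, 3, 5], eigenbasis, ?_, ⟨⟨_, _, eigenbasis_mul_inv, eigenbasis_inv_mul⟩, rfl⟩,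
    ?_, ?_⟩
  · intro j; fin_cases j <;> simp
  · have hc : eigenbasis.map (starRingEnd ℂ) = eigenbasis := by
      ext (i | i) (j | j)
      · by_cases h : i = j <;> simp [eigenbasis, h]
      · by_cases h : i = j <;> simp [eigenbasis, h, conj_lam]
      · by_cases h : i = j <;> simp [eigenbasis, h, conj_lam]
      · by_cases h : i = j <;> simp [eigenbasis, h]
    rw [hc, eigenbasis, Matrix.fromBlocks_multiply, Matrix.fromBlocks_multiply]
    simp
  · simp only [hl]
    exact jacobian_deck_mul_eigenbasis hF

end Reversible

end CRSing
end

noncomputable section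

namespace CRSing

open MvPowerSeries
open scoped ENNReal NNReal

/-! ### Linear changes of coordinates. -/

section Linear

variable {ι : Type} [Fintype ι]

/-- The linear map with matrix `A`. -/
def linMap (A : Matrix ι ι ℂ) : FormalMap ι := fun i => ∑ j, C (A i j) * X j

theorem noConst_linMap (A : Matrix ι ι ℂ) : NoConst (linMap A) := fun i => by simp [linMap]

theorem converges_sum {α τ : Type} (s : Finset α) {f : α → MvPowerSeries τ ℂ}
    (h : ∀ a ∈ s, Converges (f a)) : Converges (∑ a ∈ s, f a) := by
  classical
  induction s using Finset.induction_on with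
  | empty => simpa using converges_C (τ := τ) 0
  | insert a s ha ih =>
    rw [Finset.sum_insert ha]
    exact (h a (by simp)).add (ih fun b hb => h b (by simp [hb]))

theorem converges_linMap (A : Matrix ι ι ℂ) : IsConvergent (linMap A) := fun _ =>
  converges_sum _ fun _ _ => (converges_C _).mul (converges_X _)

theorem pull_linMap {τ : Type} {G : ι → MvPowerSeries τ ℂ} (hG : NoConst G) (A : Matrix ι ι ℂ)
    (i : ι) : pull G (linMap A i) = ∑ j, C (A i j) * G j := by
  simp only [linMap, map_sum, map_mul, pull_C, pull_X hG]

theorem pull_linMap_linMap (A B : Matrix ι ι ℂ) (i : ι) :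
    pull (linMap B) (linMap A i) = linMap (A * B) i := by
  rw [pull_linMap (noConst_linMap B)]
  simp only [linMap, Matrix.mul_apply, map_sum, map_mul, Finset.mul_sum, Finset.sum_mul]
  rw [Finset.sum_comm]
  simp only [mul_assoc]

theorem linMap_one [DecidableEq ι] : linMap (1 : Matrix ι ι ℂ) = X := by
  funext i
  rw [linMap, Finset.sum_eq_single i]
  · simp
  · intro j _ h; simp [Matrix.one_apply_ne h.symm]
  · simp

theorem linMap_diagonal_mul [DecidableEq ι] (d : ι → ℂ) (B : Matrix ι ι ℂ) (i : ι) :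
    linMap (Matrix.diagonal d * B) i = C (d i) * linMap B i := by
  simp only [linMap, Matrix.diagonal_mul, map_mul, Finset.mul_sum, mul_assoc]

theorem pull_linMap_pull_linMap (A B : Matrix ι ι ℂ) (f : MvPowerSeries ι ℂ) :
    pull (linMap B) (pull (linMap A) f) = pull (linMap (A * B)) f := by
  rw [pull_pull (noConst_linMap A) (noConst_linMap B)]
  congr 2
  funext i
  exact pull_linMap_linMap A B i

theorem coeff_pull_linMap_diagonal [DecidableEq ι] (d : ι → ℂ) (f : MvPowerSeries ι ℂ)
    (m : ι →₀ ℕ) : coeff m (pull (linMap (Matrix.diagonal d)) f) = mult d m * coeff m f := by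
  have h : linMap (Matrix.diagonal d) = fun i => X i * (fun i => C (d i)) i := by
    funext i
    have := linMap_diagonal_mul d 1 i
    rw [Matrix.mul_one, linMap_one] at this
    rw [this, mul_comm]
  have hm : ∀ k : ι →₀ ℕ, mon (fun i => (C (d i) : MvPowerSeries ι ℂ)) k = C (mult d k) := by
    intro k
    simp only [mon, mult, Finsupp.prod, map_prod, map_pow]
  rw [h, coeff_pull_diag, Finset.sum_eq_single (m, 0)]
  · rw [hm]; simp; ring
  · rintro ⟨p, q⟩ hp hne
    rw [hm, coeff_C_of_ne_zero, mul_zero]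
    rintro rfl
    rw [Finset.HasAntidiagonal.mem_antidiagonal] at hp
    apply hne
    simpa using hp
  · intro hn
    exact absurd (Finset.HasAntidiagonal.mem_antidiagonal.mpr (by simp)) hn

theorem Converges.of_X_mul {τ : Type} {i : τ} {u : MvPowerSeries τ ℂ} (h : Converges (X i * u)) :
    Converges u := by
  obtain ⟨r, hr, hfin⟩ := converges_iff.mp h
  refine converges_iff.mpr ⟨r, hr, fun htop => hfin ?_⟩
  have hinj : Function.Injective fun m : τ →₀ ℕ => Finsupp.single i 1 + m :=
    add_right_injective _
  have hle : nrm r u * r ≤ nrm r (X i * u) := by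
    rw [nrm, nrm, ← ENNReal.tsum_mul_right]
    refine le_trans (le_of_eq ?_) (ENNReal.tsum_comp_le_tsum_of_injective hinj _)
    refine tsum_congr fun m => ?_
    rw [X_def, coeff_add_monomial_mul, one_mul, map_add, pow_add]
    simp
    ring
  rw [htop, ENNReal.top_mul (by exact_mod_cast hr.ne'), top_le_iff] at hle
  exact hle

end Linear

/-! ### Normal forms in diagonalizing coordinates. -/

section NormalForm

theorem mult_mu (m : Fin 3 ⊕ Fin 3 →₀ ℕ) : mult mu m = ∏ j, lam j ^ (2 * wt m j) := by
  rw [mult, Finsupp.prod_fintype _ _ (by simp), Fintype.prod_sum_type, ← Finset.prod_mul_distrib]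
  refine Finset.prod_congr rfl fun j _ => ?_
  have h := lam_ne_zero j
  rw [mu, Sum.elim_inl, Sum.elim_inr, wt, zpow_mul, zpow_sub₀ (by norm_cast; positivity)]
  norm_cast
  rw [inv_pow, div_eq_mul_inv]

/-- Nonresonance: the only coincidences of multipliers are those forced by `μ_j μ_j⁻¹ = 1`. -/
theorem wt_eq_of_mult_mu_eq {m k : Fin 3 ⊕ Fin 3 →₀ ℕ} (h : mult mu m = mult mu k) :
    wt m = wt k := by
  rw [mult_mu, mult_mu] at h
  have h1 : ∏ j, lam j ^ (2 * wt m j - 2 * wt k j) = 1 := by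
    have hne : ∏ j, lam j ^ (2 * wt k j) ≠ 0 :=
      Finset.prod_ne_zero_iff.mpr fun j _ => zpow_ne_zero _ (lam_ne_zero j)
    refine mul_right_cancel₀ hne ?_
    rw [one_mul, ← Finset.prod_mul_distrib, ← h]
    refine Finset.prod_congr rfl fun j _ => ?_
    rw [← zpow_add₀ (lam_ne_zero j)]; congr 1; ring
  have h2 := two_three_five_zpow_fun h1
  funext j
  have := congrFun h2 j
  simp only [Pi.zero_apply] at this
  omega

theorem mult_single {ι : Type} (ν : ι → ℂ) (i : ι) : mult ν (Finsupp.single i 1) = ν i := by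
  simp [mult]

theorem mu_injective : Function.Injective mu := by
  intro i j h
  rw [← mult_single mu i, ← mult_single mu j] at h
  have h2 := wt_eq_of_mult_mu_eq h
  rcases i with i | i <;> rcases j with j | j <;>
    simp only [wt_single_inl, wt_single_inr] at h2
  · have := congrFun h2 i
    by_contra hne
    have hij : i ≠ j := fun h => hne (by rw [h])
    simp [hij] at this
  · have := congrFun h2 i
    by_cases hij : i = j
    · subst hij; simp at this
    · simp [hij] at this
  · have := congrFun h2 j
    by_cases hij : j = i
    · subst hij; simp at this
    · simp [hij] at this
  · have := congrFun h2 i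
    by_contra hne
    have hij : i ≠ j := fun h => hne (by rw [h])
    simp [hij] at this

variable {σ σ' : FormalMap (Fin 3 ⊕ Fin 3)}

/-- In coordinates that diagonalize the linear part of `σ`, a normal form multiplies each
coordinate by a power series of weight zero. -/
theorem exists_diagonal_form {A B : Matrix (Fin 3 ⊕ Fin 3) (Fin 3 ⊕ Fin 3) ℂ} (hσ : NoConst σ)
    (hAB : A * B = 1) (hJ : jacobian σ * A = A * Matrix.diagonal mu)
    (h : IsPoincareDulacNormalForm σ σ') (hc : IsConvergent σ') :
    ∃ Ψ Φ u : FormalMap (Fin 3 ⊕ Fin 3), NoConst Ψ ∧ NoConst Φ ∧ (∀ i, pull Φ (Ψ i) = X i) ∧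
      (∀ i, pull Ψ (Φ i) = X i) ∧ (∀ i, Converges (u i)) ∧ (∀ i, HasWt 0 (u i)) ∧
        ∀ i, pull Φ (X i * u i) = pull σ (Φ i) := by
  obtain ⟨⟨Ψ, Φ, ⟨hΨ, hΦ, h1, h2⟩, e⟩, hcomm⟩ := h
  have hΨ' : NoConst Ψ := hΨ
  have hΦ' : NoConst Φ := hΦ
  rw [comp_eq_pull hΦ'] at h1
  rw [comp_eq_pull hΨ'] at h2
  have hσΨ : NoConst fun i => pull Ψ (σ i) := hσ.pull hΨ'
  rw [comp_eq_pull hΨ', comp_eq_pull hσΨ] at e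
  have hσ' : NoConst σ' := by rw [e]; exact hΦ'.pull hσΨ
  have hBA : B * A = 1 := mul_eq_one_comm.mp hAB
  have idΨΦ : ∀ f, pull Φ (pull Ψ f) = f := fun f => by
    rw [pull_pull hΨ' hΦ', h1]; exact pull_X_self f
  have idΦΨ : ∀ f, pull Ψ (pull Φ f) = f := fun f => by
    rw [pull_pull hΦ' hΨ', h2]; exact pull_X_self f
  have idAB : ∀ f, pull (linMap B) (pull (linMap A) f) = f := fun f => by
    rw [pull_linMap_pull_linMap, hAB, linMap_one, pull_X_self]
  have idBA : ∀ f, pull (linMap A) (pull (linMap B) f) = f := fun f => by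
    rw [pull_linMap_pull_linMap, hBA, linMap_one, pull_X_self]
  have hconj : ∀ f, pull Φ (pull σ' f) = pull σ (pull Φ f) := fun f => by
    have : pull σ' f = pull Ψ (pull σ (pull Φ f)) := by
      rw [pull_pull hσ hΨ', pull_pull hΦ' hσΨ, e]
    rw [this, idΨΦ]
  set L : FormalMap (Fin 3 ⊕ Fin 3) := linMap (jacobian σ) with hL
  have hLc : NoConst L := noConst_linMap _
  have hcomm' : ∀ f, pull L (pull σ' f) = pull σ' (pull L f) := fun f => by
    have : linearPart σ = L := rfl
    rw [this, comp_eq_pull hLc, comp_eq_pull hσ'] at hcomm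
    rw [pull_pull hσ' hLc, pull_pull hLc hσ', hcomm]
  set s : FormalMap (Fin 3 ⊕ Fin 3) := fun i => pull (linMap A) (pull σ' (linMap B i)) with hs
  have hsD : ∀ i, pull (linMap (Matrix.diagonal mu)) (s i) = C (mu i) * s i := by
    intro i
    have hBJ : B * jacobian σ = Matrix.diagonal mu * B := by
      calc B * jacobian σ = B * (jacobian σ * A) * B := by
            rw [Matrix.mul_assoc, Matrix.mul_assoc, hAB, Matrix.mul_one]
        _ = B * A * Matrix.diagonal mu * B := by rw [hJ, ← Matrix.mul_assoc]
        _ = _ := by rw [hBA, Matrix.one_mul]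
    rw [hs]
    simp only
    rw [pull_linMap_pull_linMap, ← hJ, ← pull_linMap_pull_linMap, hcomm', hL, pull_linMap_linMap,
      hBJ, linMap_diagonal_mul, map_mul, map_mul, pull_C, pull_C]
  have hsw : ∀ i m, coeff m (s i) ≠ 0 → wt m = wt (Finsupp.single i 1) := by
    intro i m hm
    apply wt_eq_of_mult_mu_eq
    rw [mult_single]
    have := congrArg (coeff m) (hsD i)
    rw [coeff_pull_linMap_diagonal, coeff_C_mul] at this
    exact mul_right_cancel₀ hm this
  -- A monomial of the weight of `ξ_j` contains `ξ_j`, and one of the weight of `η_j` contains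
  -- `η_j`.
  have hdvd : ∀ i, X i ∣ s i := by
    intro i
    rw [X_dvd_iff]
    intro m hm
    by_contra hne
    have := hsw i m hne
    rcases i with j | j
    · have := congrFun this j
      rw [wt_single_inl] at this
      simp [wt, hm] at this
      omega
    · have := congrFun this j
      rw [wt_single_inr] at this
      simp [wt, hm] at this
  choose u hu using hdvd
  refine ⟨fun i => pull (linMap A) (Ψ i), fun i => pull Φ (linMap B i), u,
    hΨ'.pull (noConst_linMap A), (noConst_linMap B).pull hΦ', ?_, ?_, ?_, ?_, ?_⟩
  · intro i
    rw [← pull_pull (noConst_linMap B) hΦ', idAB]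
    exact congrFun h1 i
  · intro i
    rw [← pull_pull hΨ' (noConst_linMap A), idΦΨ, pull_linMap_linMap, hBA, linMap_one]
  · intro i
    have : Converges (s i) := by
      refine Converges.pull (noConst_linMap A) (converges_linMap A) ?_
      exact Converges.pull hσ' hc (converges_linMap B i)
    rw [hu i] at this
    exact this.of_X_mul
  · intro i m hm
    have : coeff (Finsupp.single i 1 + m) (s i) ≠ 0 := by
      rw [hu i, X_def, coeff_add_monomial_mul, one_mul]; exact hm
    have := hsw i _ this
    rw [wt_add] at this
    simpa using this
  · intro i
    rw [← hu i, ← pull_pull (noConst_linMap B) hΦ', hs]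
    simp only
    rw [idAB, hconj]

/-- The data of `exists_diagonal_form`, relabelled so that the multipliers are in the standard
order. The coordinates are paired by an involution `ι`. -/
theorem exists_ordered_form {A B : Matrix (Fin 3 ⊕ Fin 3) (Fin 3 ⊕ Fin 3) ℂ} (hσ : NoConst σ)
    (hAB : A * B = 1) (hJ : jacobian σ * A = A * Matrix.diagonal mu)
    (h : IsPoincareDulacNormalForm σ σ') (hc : IsConvergent σ') :
    ∃ (Ψ Φ u : FormalMap (Fin 3 ⊕ Fin 3)) (ι : Fin 3 ⊕ Fin 3 → Fin 3 ⊕ Fin 3), NoConst Ψ ∧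
      NoConst Φ ∧ (∀ i, pull Φ (Ψ i) = X i) ∧ (∀ i, pull Ψ (Φ i) = X i) ∧
      (∀ i, Converges (u i)) ∧ (∀ i, pull Φ (X i * u i) = pull σ (Φ i)) ∧
      (∀ i, constantCoeff (u i) = mu i) ∧ (∀ i, ι (ι i) = i) ∧ (∀ i, ι i ≠ i) ∧
        ∀ i m, coeff m (u i) ≠ 0 → ∀ k, m (ι k) = m k := by
  classical
  obtain ⟨Ψ, Φ, u, hΨ, hΦ, h1, h2, hu, hw, hconj⟩ := exists_diagonal_form hσ hAB hJ h hc
  -- The linear part of the normal form commutes with that of `σ` and is conjugate to it, but the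
  -- conjugation may permute the eigenvalues. The permutation is read off the nonzero entries of an
  -- invertible intertwining matrix.
  have hPQ : jacobian Φ * jacobian Ψ = 1 := by
    rw [← jacobian_comp hΨ, comp_eq_pull hΨ]
    ext i j
    simp only [jacobian, Matrix.of_apply, h2, coeff_single_X, Matrix.one_apply, eq_comm]
  set Q := jacobian Φ * A with hQ
  have hQR : B * jacobian Ψ * Q = 1 := by
    rw [hQ, Matrix.mul_assoc, ← Matrix.mul_assoc (jacobian Ψ), mul_eq_one_comm.mp hPQ,
      Matrix.one_mul, mul_eq_one_comm.mp hAB]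
  have hlin : ∀ i k, constantCoeff (u i) * Q i k = Q i k * mu k := by
    have e : Matrix.diagonal (fun i => constantCoeff (u i)) * jacobian Φ =
        jacobian Φ * jacobian σ := by
      ext i k
      have := congrArg (coeff (Finsupp.single k 1)) (hconj i)
      rw [coeff_single_pull hσ, map_mul, coeff_single_mul, constantCoeff_pull hΦ,
        constantCoeff_pull hΦ, pull_X hΦ, constantCoeff_X] at this
      rw [Matrix.diagonal_mul, Matrix.mul_apply]
      simp only [jacobian, Matrix.of_apply]
      rw [← this]; ring
    intro i k
    have e2 : Matrix.diagonal (fun i => constantCoeff (u i)) * Q = Q * Matrix.diagonal mu := by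
      rw [hQ, ← Matrix.mul_assoc, e, Matrix.mul_assoc, hJ, Matrix.mul_assoc]
    have := congrFun (congrFun e2 i) k
    rwa [Matrix.diagonal_mul, Matrix.mul_diagonal] at this
  have hex : ∀ k, ∃ i, constantCoeff (u i) = mu k := by
    intro k
    have : (B * jacobian Ψ * Q) k k = 1 := by rw [hQR, Matrix.one_apply_eq]
    rw [Matrix.mul_apply] at this
    obtain ⟨i, -, hi⟩ := Finset.exists_ne_zero_of_sum_ne_zero (by rw [this]; exact one_ne_zero)
    have hne : Q i k ≠ 0 := right_ne_zero_of_mul hi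
    refine ⟨i, mul_right_cancel₀ hne ?_⟩
    rw [hlin, mul_comm]
  choose π hπ using hex
  have hinj : Function.Injective π := fun i j hij => mu_injective (by rw [← hπ i, ← hπ j, hij])
  set P : Equiv.Perm (Fin 3 ⊕ Fin 3) := Equiv.ofBijective π (Finite.injective_iff_bijective.mp hinj)
    with hP
  have hPπ : ∀ i, P i = π i := fun i => rfl
  set G : FormalMap (Fin 3 ⊕ Fin 3) := fun j => X (P.symm j) with hG
  have hGc : NoConst G := fun j => by simp [hG]
  have hΦP : NoConst fun k => Φ (P k) := fun k => hΦ _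
  have hcompat : ∀ f, pull (fun k => Φ (P k)) (pull G f) = pull Φ f := by
    intro f
    rw [pull_pull hGc hΦP]
    congr 2
    funext j
    rw [hG]
    simp only
    rw [pull_X hΦP, Equiv.apply_symm_apply]
  refine ⟨fun i => pull G (Ψ i), fun k => Φ (P k), fun k => pull G (u (P k)),
    fun k => P.symm (P k).swap, hΨ.pull hGc, hΦP, ?_, ?_, ?_, ?_, ?_, ?_, ?_, ?_⟩
  · intro i; rw [hcompat, h1]
  · intro k
    rw [← pull_pull hΨ hGc, h2, pull_X hGc, hG]
    simp
  · exact fun k => Converges.pull hGc (fun _ => converges_X _) (hu _)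
  · intro k
    rw [← hconj, map_mul, hcompat, pull_X hΦP, map_mul, pull_X hΦ]
  · intro k
    rw [constantCoeff_pull hGc, hPπ, hπ]
  · intro k; simp
  · intro k hk
    have : (P k).swap = P k := by simpa using congrArg P hk
    rcases hx : P k with j | j <;> rw [hx] at this <;> simp at this
  · intro k m hm x
    rw [coeff_pull hGc] at hm
    obtain ⟨d, hd⟩ : ∃ d, coeff d (u (P k)) * coeff m (mon G d) ≠ 0 := by
      by_contra! hn
      exact hm (by simp [hn])
    have hwd := hw _ d (left_ne_zero_of_mul hd)
    have hmon : ∀ d : Fin 3 ⊕ Fin 3 →₀ ℕ, mon G d = monomial (d.mapDomain P.symm) 1 := by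
      intro d
      induction d using finsupp_induction_add_single with
      | h0 => simp
      | hs i d ih =>
        rw [mon_add, ih, mon_single, pow_one, hG, Finsupp.mapDomain_add, Finsupp.mapDomain_single]
        simp only [X_def, monomial_mul_monomial, one_mul]
    have hmd : m = d.mapDomain P.symm := by
      by_contra hne
      apply right_ne_zero_of_mul hd
      rw [hmon, coeff_monomial, if_neg hne]
    have hval : ∀ y, m y = d (P y) := fun y => by
      rw [hmd]
      have := Finsupp.mapDomain_apply P.symm.injective d (P y)
      rwa [Equiv.symm_apply_apply] at this
    rw [hval, hval, Equiv.apply_symm_apply]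
    rcases P x with j | j
    · have := congrFun hwd j
      simp only [wt, Pi.zero_apply] at this
      simp only [Sum.swap_inl]
      omega
    · have := congrFun hwd j
      simp only [wt, Pi.zero_apply] at this
      simp only [Sum.swap_inr]
      omega

end NormalForm

end CRSing
end

noncomputable section

namespace CRSing

open MvPowerSeries
open scoped ENNReal NNReal

/-! ### Eigenfunctions of the first two pairs, and the pairing of the coordinates. -/

section Eigenfunctions

variable {F : MvPowerSeries (Fin 2) ℂ}

/-- Substitution of the first integral in a power series of one variable. -/
def siv (j : Fin 2) : MvPowerSeries Unit ℂ →ₐ[ℂ] PS₆ := pull fun _ => inva j.castSucc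

theorem noConst_siv (j : Fin 2) : NoConst fun _ : Unit => inva j.castSucc :=
  fun _ => constantCoeff_inva _

theorem siv_ell_mul_elli (j : Fin 2) : siv j (ell j.castSucc) * siv j (elli j.castSucc) = 1 := by
  rw [← map_mul, ell_mul_elli, map_one]

theorem siv_ell_add_elli (j : Fin 2) : siv j (ell j.castSucc) + siv j (elli j.castSucc) =
    C (tr j.castSucc) + inva j.castSucc := by
  rw [← map_add, elli, add_sub_cancel, map_add, siv, pull_C, pull_X (noConst_siv j)]

theorem siv_bser (j : Fin 2) : (siv j (ell j.castSucc) - siv j (elli j.castSucc)) *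
    siv j (bser j.castSucc) = 1 := by
  rw [← map_sub, ← map_mul, bser_mul, map_one]

/-- The eigenfunction of `σ` with multiplier `ℓ_j²`. -/
def ep (j : Fin 2) : PS₆ :=
  X (Sum.inr j.castSucc) - siv j (elli j.castSucc) * X (Sum.inl j.castSucc)

/-- The eigenfunction of `σ` with multiplier `ℓ_j⁻²`. -/
def em (j : Fin 2) : PS₆ :=
  X (Sum.inr j.castSucc) - siv j (ell j.castSucc) * X (Sum.inl j.castSucc)

/-- The factorization of `w² - S z w + z²` with `S = ℓ_j + ℓ_j⁻¹` evaluated at the first integral.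
-/
theorem ep_mul_em (j : Fin 2) : ep j * em j = inva j.castSucc := by
  rw [ep, em]
  linear_combination (X (Sum.inl j.castSucc)) ^ 2 * siv_ell_mul_elli j -
    X (Sum.inl j.castSucc) * X (Sum.inr j.castSucc) * siv_ell_add_elli j - inva_mul j.castSucc

theorem pull_sig_siv (j : Fin 2) (f : MvPowerSeries Unit ℂ) :
    pull (sig F) (siv j f) = siv j f := by
  rw [siv, pull_pull (noConst_siv j) noConst_sig]
  congr 2
  funext _
  exact pull_sig_inva j

theorem sig_inl_castSucc (j : Fin 2) : sig F (Sum.inl j.castSucc) =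
    (C (tr j.castSucc) + inva j.castSucc) * X (Sum.inr j.castSucc) - X (Sum.inl j.castSucc) := by
  rw [sig_inl, pot'_castSucc]

theorem sig_inr_castSucc (j : Fin 2) : sig F (Sum.inr j.castSucc) =
    (C (tr j.castSucc) + inva j.castSucc) * sig F (Sum.inl j.castSucc) -
      X (Sum.inr j.castSucc) := by
  rw [sig_inr, pot_castSucc, map_add, pull_C, pull_deck'_inva]

theorem pull_sig_ep (j : Fin 2) : pull (sig F) (ep j) = siv j (ell j.castSucc ^ 2) * ep j := by
  rw [ep, map_sub, map_mul, pull_sig_siv, pull_X noConst_sig, pull_X noConst_sig, sig_inr_castSucc,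
    sig_inl_castSucc, ← siv_ell_add_elli, map_pow]
  linear_combination (X (Sum.inr j.castSucc) + siv j (ell j.castSucc) * X (Sum.inl j.castSucc)) *
    siv_ell_mul_elli j

theorem pull_sig_em (j : Fin 2) : pull (sig F) (em j) = siv j (elli j.castSucc ^ 2) * em j := by
  rw [em, map_sub, map_mul, pull_sig_siv, pull_X noConst_sig, pull_X noConst_sig, sig_inr_castSucc,
    sig_inl_castSucc, ← siv_ell_add_elli, map_pow]
  linear_combination (X (Sum.inr j.castSucc) + siv j (elli j.castSucc) * X (Sum.inl j.castSucc)) *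
    siv_ell_mul_elli j

theorem ord_two_of_linear {τ : Type} {f : MvPowerSeries τ ℂ} (h0 : constantCoeff f = 0)
    (h1 : ∀ i, coeff (Finsupp.single i 1) f = 0) : Ord 2 f := by
  intro m hm
  have : m.degree = 0 ∨ m.degree = 1 := by omega
  rcases this with h | h
  · rw [(Finsupp.degree_eq_zero_iff m).mp h]; simpa using h0
  · obtain ⟨i, rfl⟩ := (finsupp_degree_eq_one_iff m).mp h
    exact h1 i

theorem constantCoeff_ep (j : Fin 2) : constantCoeff (ep j) = 0 := by simp [ep]

theorem constantCoeff_em (j : Fin 2) : constantCoeff (em j) = 0 := by simp [em]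

theorem not_ord_two_ep (j : Fin 2) : ¬ Ord 2 (ep j) := by
  classical
  intro h
  have := coeff_single_eq_zero_of_ord h (Sum.inr j.castSucc)
  rw [ep, map_sub, coeff_single_mul, coeff_single_X, coeff_single_X] at this
  simp at this

theorem not_ord_two_em (j : Fin 2) : ¬ Ord 2 (em j) := by
  classical
  intro h
  have := coeff_single_eq_zero_of_ord h (Sum.inr j.castSucc)
  rw [em, map_sub, coeff_single_mul, coeff_single_X, coeff_single_X] at this
  simp at this

variable {Ψ Φ u : FormalMap (Fin 3 ⊕ Fin 3)}

theorem pull_conj {σ : FormalMap (Fin 3 ⊕ Fin 3)} (hσ : NoConst σ) (hΨ : NoConst Ψ)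
    (hΦ : NoConst Φ) (h1 : ∀ i, pull Φ (Ψ i) = X i) (h2 : ∀ i, pull Ψ (Φ i) = X i)
    (hconj : ∀ i, pull Φ (X i * u i) = pull σ (Φ i)) (f : PS₆) :
    pull Ψ (pull σ f) = pull (fun i => X i * u i) (pull Ψ f) := by
  have id1 : ∀ f, pull Φ (pull Ψ f) = f := fun f => by
    rw [pull_pull hΨ hΦ, funext h1]; exact pull_X_self f
  have id2 : ∀ f, pull Ψ (pull Φ f) = f := fun f => by
    rw [pull_pull hΦ hΨ, funext h2]; exact pull_X_self f
  have h : pull Φ (pull (fun i => X i * u i) (pull Ψ f)) = pull σ f := by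
    rw [pull_pull (noConst_diag u) hΦ, funext hconj, ← pull_pull hΦ hσ, id1]
  rw [← h, id2]

/-- The linear part of an eigenfunction of a diagonal map. -/
theorem ord_two_sub_of_eigen (hmu : ∀ i, constantCoeff (u i) = mu i) {p M : PS₆}
    {k : Fin 3 ⊕ Fin 3} (hM : constantCoeff M = mu k) (hp : constantCoeff p = 0)
    (he : pull (fun i => X i * u i) p = M * p) :
    Ord 2 (p - C (coeff (Finsupp.single k 1) p) * X k) := by
  classical
  refine ord_two_of_linear (by rw [map_sub, hp]; simp) fun i => ?_
  rw [map_sub, coeff_C_mul, coeff_single_X]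
  by_cases hik : i = k
  · subst hik; simp
  · rw [if_neg hik, mul_zero, sub_zero]
    have hlead : ∀ d ≤ Finsupp.single i 1, d ≠ Finsupp.single i 1 → coeff d p = 0 := by
      intro d hd hne
      have : d = 0 := by
        ext x
        by_contra hx
        apply hne
        refine le_antisymm hd ?_
        rw [Finsupp.single_le_iff]
        have h1 := hd x
        rw [Finsupp.single_apply] at h1
        split_ifs at h1 with hix
        · subst hix; simp at hx; omega
        · simp at hx; omega
      rw [this]; simpa using hp
    have := congrArg (coeff (Finsupp.single i 1)) he
    rw [coeff_pull_diag_of_leading u p _ hlead, coeff_mul_of_leading M p _ hlead, hM, mult_single,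
      hmu] at this
    by_contra hne
    exact hik (mu_injective (mul_right_cancel₀ hne this))

/-- The eigenvalues are distinct, so the linear part is a multiple of one coordinate. It is nonzero
because an invertible change of coordinates preserves the order of vanishing. -/
theorem exists_linear_part {p₀ : PS₆} (hΨ : NoConst Ψ)
    (hΦ : NoConst Φ) (h1 : ∀ i, pull Φ (Ψ i) = X i)
    (hmu : ∀ i, constantCoeff (u i) = mu i) {M : PS₆}
    {k : Fin 3 ⊕ Fin 3} (hM : constantCoeff M = mu k) (hp : constantCoeff p₀ = 0)
    (hp2 : ¬ Ord 2 p₀) (he : pull (fun i => X i * u i) (pull Ψ p₀) = M * pull Ψ p₀) :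
    ∃ c : ℂ, c ≠ 0 ∧ Ord 2 (pull Ψ p₀ - C c * X k) := by
  have h := ord_two_sub_of_eigen hmu hM (by rw [constantCoeff_pull hΨ, hp]) he
  refine ⟨_, ?_, h⟩
  intro h0
  rw [h0, map_zero, zero_mul, sub_zero] at h
  apply hp2
  have := h.pull hΦ
  rwa [pull_pull hΨ hΦ, funext h1, pull_X_self] at this

theorem pull_pull_siv (hΨ : NoConst Ψ) (j : Fin 2) (f : MvPowerSeries Unit ℂ) :
    pull Ψ (siv j f) = pull (fun _ => pull Ψ (inva j.castSucc)) f :=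
  pull_pull (noConst_siv j) hΨ f

theorem ord_three_mul_sub {τ : Type} {p q : MvPowerSeries τ ℂ} {c d : ℂ} {k l : τ}
    (hp : Ord 2 (p - C c * X k)) (hq : Ord 2 (q - C d * X l)) (hq0 : constantCoeff q = 0) :
    Ord 3 (p * q - C (c * d) * (X k * X l)) := by
  have hX : Ord 1 (C c * X k : MvPowerSeries τ ℂ) := ord_one_iff.mpr (by simp)
  have := (hp.mul (ord_one_iff.mpr hq0)).add (hX.mul hq)
  convert this using 1
  rw [map_mul]; ring

/-- The twist condition: the multiplier depends on the first integral to first order. It is used to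
recognize which coordinates are paired. -/
theorem exists_ell_sq_expansion (j : Fin 3) : ∃ (c : ℂ) (t : MvPowerSeries Unit ℂ), c ≠ 0 ∧
    ell j ^ 2 = C (lam j ^ 2) + C c * X () + X () ^ 2 * t := by
  have hdvd : ∀ f : MvPowerSeries Unit ℂ, X () ∣ f - C (constantCoeff f) := by
    intro f
    rw [X_dvd_iff]
    intro m hm
    have : m = 0 := by ext; simpa using hm
    subst this; simp
  obtain ⟨e, he⟩ := hdvd (ell j)
  obtain ⟨e', he'⟩ := hdvd e
  rw [constantCoeff_ell, sub_eq_iff_eq_add] at he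
  rw [sub_eq_iff_eq_add] at he'
  have h0 : (C (lam j) : MvPowerSeries Unit ℂ) ^ 2 - C (tr j) * C (lam j) + 1 = 0 := by
    rw [← map_pow, ← map_mul, ← map_sub, ← map_one C, ← map_add, ← map_zero C]
    congr 1
    have := lam_ne_zero j
    rw [tr]; field_simp; ring
  have h1 : X () * (2 * C (lam j) * e - C (tr j) * e - C (lam j) + X () * (e ^ 2 - e)) = 0 := by
    have := ell_eq j
    rw [he] at this
    linear_combination this - h0
  have hX : (X () : MvPowerSeries Unit ℂ) ≠ 0 := fun h => by
    have := congrArg (coeff (Finsupp.single () 1)) h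
    simp at this
  have h2 := congrArg constantCoeff ((mul_eq_zero.mp h1).resolve_left hX)
  simp only [map_add, map_sub, map_mul, constantCoeff_C, constantCoeff_X, zero_mul, add_zero,
    map_ofNat, map_zero] at h2
  have he0 : constantCoeff e ≠ 0 := by
    intro h
    rw [h] at h2
    apply lam_ne_zero j
    linear_combination -h2
  refine ⟨2 * lam j * constantCoeff e, 2 * C (lam j) * e' + e ^ 2,
    mul_ne_zero (mul_ne_zero two_ne_zero (lam_ne_zero j)) he0, ?_⟩
  have h2C : (C (2 : ℂ) : MvPowerSeries Unit ℂ) = 2 := map_ofNat _ 2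
  rw [he, map_pow, map_mul, map_mul, h2C]
  linear_combination 2 * C (lam j) * X () * he'

variable {ι : Fin 3 ⊕ Fin 3 → Fin 3 ⊕ Fin 3}

theorem coeff_mon_symmetric (hw : ∀ i m, coeff m (u i) ≠ 0 → ∀ k, m (ι k) = m k)
    (d : Fin 3 ⊕ Fin 3 →₀ ℕ) : ∀ m, coeff m (mon u d) ≠ 0 → ∀ k, m (ι k) = m k := by
  classical
  induction d using finsupp_induction_add_single with
  | h0 =>
    intro m hm k
    rw [mon_zero, coeff_one] at hm
    have : m = 0 := by
      by_contra hne
      rw [if_neg hne] at hm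
      exact hm rfl
    simp [this]
  | hs i d ih =>
    intro m hm k
    rw [mon_add, mon_single, pow_one, coeff_mul] at hm
    obtain ⟨x, hx, hne⟩ := Finset.exists_ne_zero_of_sum_ne_zero hm
    rw [← Finset.HasAntidiagonal.mem_antidiagonal.mp hx, Finsupp.add_apply, Finsupp.add_apply,
      ih _ (left_ne_zero_of_mul hne) k, hw i _ (right_ne_zero_of_mul hne) k]

theorem mult_add {α : Type} (ν : α → ℂ) (m k : α →₀ ℕ) : mult ν (m + k) = mult ν m * mult ν k := by
  classical
  exact Finsupp.prod_add_index' (by simp) (by simp [pow_add])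

/-- The pairing of the coordinates is the standard one. -/
theorem pairing_inl (hΨ : NoConst Ψ) (hΦ : NoConst Φ) (h1 : ∀ i, pull Φ (Ψ i) = X i)
    (h2 : ∀ i, pull Ψ (Φ i) = X i) (hconj : ∀ i, pull Φ (X i * u i) = pull (sig F) (Φ i))
    (hmu : ∀ i, constantCoeff (u i) = mu i) (hι : ∀ i, ι (ι i) = i) (hι' : ∀ i, ι i ≠ i)
    (hw : ∀ i m, coeff m (u i) ≠ 0 → ∀ k, m (ι k) = m k) (j : Fin 2) :
    ι (Sum.inl j.castSucc) = Sum.inr j.castSucc := by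
  classical
  by_contra hne
  set k : Fin 3 ⊕ Fin 3 := Sum.inl j.castSucc with hk
  set l : Fin 3 ⊕ Fin 3 := Sum.inr j.castSucc with hl
  set J := pull Ψ (inva j.castSucc) with hJ
  have hJ0 : NoConst fun _ : Unit => J := fun _ => by
    rw [hJ, constantCoeff_pull hΨ, constantCoeff_inva]
  set p := pull Ψ (ep j) with hp
  set q := pull Ψ (em j) with hq
  have hp0 : constantCoeff p = 0 := by rw [hp, constantCoeff_pull hΨ, constantCoeff_ep]
  have hq0 : constantCoeff q = 0 := by rw [hq, constantCoeff_pull hΨ, constantCoeff_em]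
  have hpq : p * q = J := by rw [hp, hq, ← map_mul, ep_mul_em]
  have ecp := pull_conj noConst_sig hΨ hΦ h1 h2 hconj (ep j)
  rw [pull_sig_ep, map_mul, pull_pull_siv hΨ] at ecp
  have ecm := pull_conj noConst_sig hΨ hΦ h1 h2 hconj (em j)
  rw [pull_sig_em, map_mul, pull_pull_siv hΨ] at ecm
  obtain ⟨c, hc, hpc⟩ := exists_linear_part (k := k) hΨ hΦ h1 hmu
    (by rw [constantCoeff_pull hJ0, map_pow, constantCoeff_ell]; rfl)
    (constantCoeff_ep j) (not_ord_two_ep j) ecp.symm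
  obtain ⟨d, hd, hqd⟩ := exists_linear_part (k := l) hΨ hΦ h1 hmu
    (by rw [constantCoeff_pull hJ0, map_pow, constantCoeff_elli, inv_pow]; rfl)
    (constantCoeff_em j) (not_ord_two_em j) ecm.symm
  rw [← hp] at hpc ecp
  rw [← hq] at hqd
  obtain ⟨a, t, ha, hexp⟩ := exists_ell_sq_expansion j.castSucc
  -- The coefficient of `ξ_j² η_j` in the eigenvalue equation is compared. If `ξ_j` and `η_j` were
  -- not paired, no nonconstant monomial of the `u_i` could divide it, and the left-hand side would
  -- be `μ` times the coefficient of `p`; the twist adds a nonzero term on the right.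
  set m : Fin 3 ⊕ Fin 3 →₀ ℕ :=
    Finsupp.single k 1 + (Finsupp.single k 1 + Finsupp.single l 1) with hm
  have hmdeg : m.degree = 3 := by simp [hm]
  have hlhs : coeff m (pull (fun i => X i * u i) p) = mu k * coeff m p := by
    rw [coeff_pull_diag, Finset.sum_eq_single (m, 0)]
    · have : mult mu m = mu k := by
        have hkl : mu k * mu l = 1 :=
          mul_inv_cancel₀ (pow_ne_zero 2 (lam_ne_zero j.castSucc))
        rw [hm, mult_add, mult_add, mult_single, mult_single, hkl, mul_one]
      have h3 := constantCoeff_mon u m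
      rw [funext hmu, this] at h3
      rw [coeff_zero_eq_constantCoeff_apply, h3, mul_comm]
    · rintro ⟨x, r⟩ hxr hne'
      rw [Finset.HasAntidiagonal.mem_antidiagonal] at hxr
      have hr : r ≠ 0 := by
        rintro rfl
        apply hne'
        simpa using hxr
      by_contra hcon
      apply hr
      have hsym := coeff_mon_symmetric hw x r (right_ne_zero_of_mul hcon)
      have hle : ∀ y, r y ≤ m y := fun y => by
        rw [← hxr]; simp
      have hout : ∀ y, y ≠ k → y ≠ l → r y = 0 := by
        intro y hy1 hy2
        have := hle y
        simp [hm, hy1, hy2] at this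
        exact this
      have hrk : r k = 0 := by
        rw [← hsym k]
        exact hout _ (hι' k) hne
      have hrl : r l = 0 := by
        rw [← hsym l]
        refine hout _ ?_ (hι' l)
        intro h
        apply hne
        rw [← h, hι]
      ext y
      by_cases hy1 : y = k
      · rw [hy1, hrk]; rfl
      · by_cases hy2 : y = l
        · rw [hy2, hrl]; rfl
        · rw [hout y hy1 hy2]; rfl
    · intro h
      exact absurd (Finset.HasAntidiagonal.mem_antidiagonal.mpr (by simp)) h
  have hM : pull (fun _ => J) (ell j.castSucc ^ 2) * p = C (mu k) * p +
      C a * (p * J) + J * J * (pull (fun _ => J) t * p) := by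
    rw [hexp, map_add, map_add, map_mul, map_mul, map_pow (pull fun _ => J) (X ()) 2, pull_C,
        pull_C,
      pull_X hJ0]
    have : mu k = lam j.castSucc ^ 2 := rfl
    rw [this]; ring
  have hJ2 : Ord 2 J := by
    rw [← hpq]; exact (ord_one_iff.mpr hp0).mul (ord_one_iff.mpr hq0)
  have hz1 : coeff m (J * J * (pull (fun _ => J) t * p)) = 0 :=
    ((hJ2.mul hJ2).mul (Ord.zero _)) m (by omega)
  have hz2 : coeff m (p * J) = c * (c * d) := by
    have h3 := ord_three_mul_sub hpc hqd hq0
    rw [hpq] at h3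
    have hX : Ord 1 (C c * X k : PS₆) := ord_one_iff.mpr (by simp)
    have h4 := (hpc.mul hJ2).add (hX.mul h3)
    have h5 := h4 m (by omega)
    have e : (p - C c * X k) * J + C c * X k * (J - C (c * d) * (X k * X l)) =
        p * J - C (c * (c * d)) * (X k * (X k * X l)) := by
      rw [map_mul C c (c * d)]; ring
    rw [e, map_sub, coeff_C_mul] at h5
    have h6 : coeff m (X k * (X k * X l) : PS₆) = 1 := by
      rw [X_def, X_def, monomial_mul_monomial, monomial_mul_monomial, one_mul, one_mul,
        coeff_monomial_same]
    rw [h6] at h5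
    linear_combination h5
  rw [← ecp, hM, map_add, map_add, coeff_C_mul, coeff_C_mul, hz1, hz2] at hlhs
  have : a * (c * (c * d)) = 0 := by linear_combination hlhs
  simp [ha, hc, hd] at this

/-- An involution without fixed points of six indices that pairs four of them in the standard way
pairs the last two. -/
theorem pairing_eq_swap (hι : ∀ i, ι (ι i) = i) (hι' : ∀ i, ι i ≠ i)
    (h : ∀ j : Fin 2, ι (Sum.inl j.castSucc) = Sum.inr j.castSucc) (i : Fin 3) :
    ι (Sum.inl i) = Sum.inr i := by
  induction i using fin_three_cases with
  | h j => exact h j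
  | h2 =>
    have h0 : ι (Sum.inl 0) = Sum.inr 0 := h 0
    have h1 : ι (Sum.inl 1) = Sum.inr 1 := h 1
    have hi := hι (Sum.inl 2)
    rcases hx : ι (Sum.inl 2) with j | j <;> rw [hx] at hi <;> fin_cases j
    · rw [Fin.zero_eta, h0] at hi; simp at hi
    · rw [Fin.mk_one, h1] at hi; simp at hi
    · exact absurd hx (hι' _)
    · have := hι (Sum.inl 0); rw [h0] at this; rw [Fin.zero_eta, this] at hi; simp at hi
    · have := hι (Sum.inl 1); rw [h1] at this; rw [Fin.mk_one, this] at hi; simp at hi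
    · rfl

/-- The normal form data, in the standard order. -/
theorem exists_normal_form {σ' : FormalMap (Fin 3 ⊕ Fin 3)} (hF : constantCoeff F = 0)
    (h : IsPoincareDulacNormalForm (sig F) σ') (hc : IsConvergent σ') :
    ∃ Ψ Φ u : FormalMap (Fin 3 ⊕ Fin 3), NoConst Ψ ∧ NoConst Φ ∧ (∀ i, pull Φ (Ψ i) = X i) ∧
      (∀ i, pull Ψ (Φ i) = X i) ∧ (∀ i, Converges (u i)) ∧
      (∀ i, pull Φ (X i * u i) = pull (sig F) (Φ i)) ∧
      (∀ i, constantCoeff (u i) = mu i) ∧ ∀ i, HasWt 0 (u i) := by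
  obtain ⟨Ψ, Φ, u, ι, hΨ, hΦ, h1, h2, hu, hconj, hmu, hι, hι', hw⟩ :=
    exists_ordered_form noConst_sig eigenbasis_mul_inv (jacobian_sig_mul_eigenbasis hF) h hc
  refine ⟨Ψ, Φ, u, hΨ, hΦ, h1, h2, hu, hconj, hmu, fun i m hm => ?_⟩
  funext j
  have h3 := hw i m hm (Sum.inl j)
  rw [pairing_eq_swap hι hι' (pairing_inl hΨ hΦ h1 h2 hconj hmu hι hι' hw) j] at h3
  simp [wt, h3]

end Eigenfunctions

end CRSing
end

noncomputable section

namespace CRSing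

open MvPowerSeries
open scoped ENNReal NNReal

/-! ### Restriction to the first two pairs of normalizing coordinates, and convergence of the first
integrals there. -/

section Restriction

/-- The space of power series in the first two pairs of variables. -/
abbrev PS₄ : Type := MvPowerSeries (Fin 2 ⊕ Fin 2) ℂ

/-- The inclusion of the first two pairs of indices. -/
def emb : Fin 2 ⊕ Fin 2 → Fin 3 ⊕ Fin 3 := Sum.map Fin.castSucc Fin.castSucc

/-- The components of the inclusion of `ℂ⁴` in `ℂ⁶`. -/
def rsf : Fin 3 ⊕ Fin 3 → PS₄ :=
  Sum.elim ![X (Sum.inl 0), X (Sum.inl 1), 0] ![X (Sum.inr 0), X (Sum.inr 1), 0]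

theorem rsf_emb (i : Fin 2 ⊕ Fin 2) : rsf (emb i) = X i := by
  rcases i with i | i <;> fin_cases i <;> rfl

theorem rsf_inl_two : rsf (Sum.inl 2) = 0 := rfl

theorem rsf_inr_two : rsf (Sum.inr 2) = 0 := rfl

theorem emb_cases {P : Fin 3 ⊕ Fin 3 → Prop} (h : ∀ i, P (emb i)) (hl : P (Sum.inl 2))
    (hr : P (Sum.inr 2)) (i : Fin 3 ⊕ Fin 3) : P i := by
  rcases i with i | i
  · exact fin_three_cases (P := fun i => P (Sum.inl i)) (fun j => h (Sum.inl j)) hl i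
  · exact fin_three_cases (P := fun i => P (Sum.inr i)) (fun j => h (Sum.inr j)) hr i

theorem noConst_rsf : NoConst rsf := by
  intro i
  induction i using emb_cases with
  | h i => rw [rsf_emb]; simp
  | hl => rw [rsf_inl_two]; simp
  | hr => rw [rsf_inr_two]; simp

/-- Restriction to the subspace where the last pair of variables vanishes. -/
def rs : PS₆ →ₐ[ℂ] PS₄ := pull rsf

theorem pull_eq_pull_rs {τ : Type} {G : Fin 3 ⊕ Fin 3 → MvPowerSeries τ ℂ} (hG : NoConst G)
    (hl : G (Sum.inl 2) = 0) (hr : G (Sum.inr 2) = 0) (f : PS₆) :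
    pull G f = pull (fun i => G (emb i)) (rs f) := by
  have hG' : NoConst fun i => G (emb i) := fun i => hG _
  rw [rs, pull_pull noConst_rsf hG']
  congr 2
  funext i
  induction i using emb_cases with
  | h i => rw [rsf_emb, pull_X hG']
  | hl => rw [rsf_inl_two, map_zero, hl]
  | hr => rw [rsf_inr_two, map_zero, hr]

theorem rs_pull_diag (u : FormalMap (Fin 3 ⊕ Fin 3)) (f : PS₆) :
    rs (pull (fun i => X i * u i) f) = pull (fun i => X i * rs (u (emb i))) (rs f) := by
  have h : ∀ i, rs (X i * u i) = rsf i * rs (u i) := fun i => by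
    rw [map_mul, rs, pull_X noConst_rsf]
  have e : rs (pull (fun i => X i * u i) f) = pull (fun i => rs (X i * u i)) f :=
    pull_pull (noConst_diag u) noConst_rsf f
  have hc : NoConst fun i => rs (X i * u i) := (noConst_diag u).pull noConst_rsf
  rw [e, pull_eq_pull_rs hc]
  · congr 2
    funext i
    rw [h, rsf_emb]
  · rw [h, rsf_inl_two, zero_mul]
  · rw [h, rsf_inr_two, zero_mul]

theorem HasWt.rs {f : PS₆} (h : HasWt 0 f) : HasWt 0 (rs f) := by
  set G : Fin 3 → MvPowerSeries (Fin 2) ℂ := ![X 0, X 1, 0] with hG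
  have hGc : NoConst G := by intro i; fin_cases i <;> simp [hG]
  have e : (fun j => CRSing.rs (zeta 3 j)) = fun j => pull (zeta 2) (G j) := by
    funext j
    rw [zeta, map_mul, CRSing.rs, pull_X noConst_rsf, pull_X noConst_rsf]
    fin_cases j
    · exact (pull_X noConst_zeta 0).symm
    · exact (pull_X noConst_zeta 1).symm
    · simp [rsf, hG]
  rw [← h.pull_zeta_dg, CRSing.rs, pull_pull noConst_zeta noConst_rsf]
  change HasWt 0 (pull (fun j => CRSing.rs (zeta 3 j)) (dg f))
  rw [e, ← pull_pull hGc noConst_zeta]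
  exact hasWt_pull_zeta _

theorem mult_mu_emb (m : Fin 2 ⊕ Fin 2 →₀ ℕ) :
    mult (fun i => mu (emb i)) m = (2 ^ wt m 0 * 3 ^ wt m 1) ^ 2 := by
  have h : (fun i => mu (emb i)) = fun i => constantCoeff (kapu i) ^ 2 := by
    funext i
    rw [constantCoeff_kapu]
    rcases i with i | i <;> simp [mu, emb]
  rw [h, ← mult_kapu, mult, mult, Finsupp.prod, Finsupp.prod, ← Finset.prod_pow]
  refine Finset.prod_congr rfl fun i _ => ?_
  ring

theorem wt_eq_zero_of_mult {m : Fin 2 ⊕ Fin 2 →₀ ℕ} {r : ℤ}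
    (h : mult (fun i => mu (emb i)) m = 5 ^ r) : wt m = 0 ∧ r = 0 := by
  rw [mult_mu_emb] at h
  have : (2 : ℂ) ^ (2 * wt m 0) * 3 ^ (2 * wt m 1) * 5 ^ (-r) = 1 := by
    have e2 : ∀ (x : ℂ) (n : ℤ), x ^ (2 * n) = (x ^ n) ^ 2 := fun x n => by
      rw [mul_comm, zpow_mul]; norm_cast
    rw [zpow_neg, ← h, e2, e2, ← mul_pow]
    exact mul_inv_cancel₀ (pow_ne_zero 2 (mul_ne_zero (zpow_ne_zero _ two_ne_zero)
      (zpow_ne_zero _ three_ne_zero)))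
  obtain ⟨h0, h1, h2⟩ := two_three_five_zpow this
  refine ⟨?_, by omega⟩
  funext j
  fin_cases j
  · simp only [Fin.zero_eta, Pi.zero_apply]; omega
  · simp only [Fin.mk_one, Pi.zero_apply]; omega

variable {v : Fin 2 ⊕ Fin 2 → PS₄}

/-- The map respects weights, so each weight component is invariant; a component of nonzero weight
has a multiplier different from 1. -/
theorem hasWt_zero_of_invariant (hv : ∀ i, HasWt 0 (v i))
    (hmu : ∀ i, constantCoeff (v i) = mu (emb i)) {f : PS₄}
    (h : pull (fun i => X i * v i) f = f) : HasWt 0 f := by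
  intro m hm
  by_contra hne
  have hg : wproj (wt m) f = 0 := by
    refine eq_zero_of_pull_diag_eq_mul v (g := 1) ?_ ?_
    · rw [← wproj_pull hv, h, one_mul]
    · intro k hk heq
      rw [funext hmu, map_one, ← zpow_zero (5 : ℂ)] at heq
      have := hasWt_wproj (wt m) f k hk
      rw [(wt_eq_zero_of_mult heq).1] at this
      exact hne this.symm
  have := congrArg (coeff m) hg
  rw [coeff_wproj, if_pos rfl, map_zero] at this
  exact hm this

theorem hasWt_pull_unit {J : PS₄} (h : HasWt 0 J) (h0 : constantCoeff J = 0)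
    (f : MvPowerSeries Unit ℂ) : HasWt 0 (pull (fun _ => J) f) ∧
      dg (pull (fun _ => J) f) = pull (fun _ => dg J) f := by
  have h1 : NoConst fun _ : Unit => dg J := fun _ => by
    rw [← coeff_zero_eq_constantCoeff_apply, coeff_dg]
    have : Finsupp.sumElim (0 : Fin 2 →₀ ℕ) (0 : Fin 2 →₀ ℕ) = 0 := by ext (i | i) <;> simp
    rw [this]; simpa using h0
  have e : pull (fun _ => J) f = pull (zeta 2) (pull (fun _ => dg J) f) := by
    rw [pull_pull h1 noConst_zeta, h.pull_zeta_dg]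
  rw [e]
  exact ⟨hasWt_pull_zeta _, dg_pull_zeta _⟩

/-- The multiplier of a coordinate is the multiplier of an eigenfunction with leading term this
coordinate, provided that the functions of weight zero are invariant. -/
theorem multiplier_eq (hv : ∀ i, HasWt 0 (v i))
    (hinv : ∀ f, HasWt 0 f → pull (fun i => X i * v i) f = f) {p M : PS₄} (hM : HasWt 0 M)
    {j : Fin 2} {c : ℂ} (hc : c ≠ 0) (hp : Ord 2 (p - C c * X (Sum.inl j)))
    (h : pull (fun i => X i * v i) p = M * p) : v (Sum.inl j) = M := by
  classical
  set f := wproj (wt (Finsupp.single (Sum.inl j) 1)) p with hf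
  have hfe : pull (fun i => X i * v i) f = M * f := by
    rw [hf, ← wproj_pull hv, h, wproj_mul hM]
  have hfw : HasWt (wt (Finsupp.single (Sum.inl j) 1)) f := hasWt_wproj _ _
  -- The component of `p` with the weight of `ξ_j` is `ξ_j g`, where `g` has weight zero and is
  -- invariant, so it can be cancelled.
  have hdvd : X (Sum.inl j) ∣ f := by
    rw [X_dvd_iff]
    intro m hm
    by_contra hne
    have := congrFun (hfw m hne) j
    rw [wt_single_inl] at this
    simp [wt, hm] at this
    omega
  obtain ⟨g, hg⟩ := hdvd
  have hgw : HasWt 0 g := by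
    intro m hm
    have h1 : coeff (Finsupp.single (Sum.inl j) 1 + m) f ≠ 0 := by
      rw [hg, X_def, coeff_add_monomial_mul, one_mul]; exact hm
    have := hfw _ h1
    rw [wt_add] at this
    simpa using this
  have hg0 : g ≠ 0 := by
    rintro rfl
    rw [mul_zero] at hg
    have h1 := congrArg (coeff (Finsupp.single (Sum.inl j) 1)) hg
    rw [hf, coeff_wproj, if_pos rfl, map_zero] at h1
    have h2 := coeff_single_eq_zero_of_ord hp (Sum.inl j)
    rw [map_sub, h1, coeff_C_mul, coeff_single_X, if_pos rfl] at h2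
    apply hc
    linear_combination -h2
  rw [hg, map_mul, hinv g hgw, pull_X (noConst_diag v)] at hfe
  have hX : (X (Sum.inl j) : PS₄) * g ≠ 0 := by
    refine mul_ne_zero ?_ hg0
    intro h0
    have := congrArg (coeff (Finsupp.single (Sum.inl j) 1)) h0
    rw [coeff_single_X, if_pos rfl, map_zero] at this
    exact one_ne_zero this
  refine mul_right_cancel₀ hX ?_
  linear_combination hfe

/-- `D` is recovered from its multiplier as `ℓ + ℓ⁻¹ - (λ + λ⁻¹)`. -/
theorem Converges.of_pull_ell_sq {τ : Type} {D : MvPowerSeries τ ℂ} (hD : constantCoeff D = 0)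
    (j : Fin 3) (h : Converges (CRSing.pull (fun _ => D) (ell j ^ 2))) : Converges D := by
  have hDc : NoConst fun _ : Unit => D := fun _ => hD
  rw [map_pow] at h
  have h1 : Converges (CRSing.pull (fun _ => D) (ell j)) := by
    refine Converges.of_sq ?_ h
    rw [constantCoeff_pull hDc, constantCoeff_ell]
    exact lam_ne_zero j
  have h2 : Converges (CRSing.pull (fun _ => D) (elli j)) := by
    refine h1.of_mul_eq_one ?_
    rw [← map_mul, ell_mul_elli, map_one]
  have e : D = CRSing.pull (fun _ => D) (ell j) + CRSing.pull (fun _ => D) (elli j) - C (tr j) := by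
    rw [← map_add, elli, add_sub_cancel, map_add, pull_C, pull_X hDc]; ring
  rw [e]
  exact (h1.add h2).sub (converges_C _)

variable {F : MvPowerSeries (Fin 2) ℂ} {Ψ Φ u : FormalMap (Fin 3 ⊕ Fin 3)}

/-- The restrictions to the subspace of the first two pairs of normalizing coordinates of the first
integrals are functions `D_j(ζ_1, ζ_2)`, with convergent inverse if the normal form converges. -/
theorem exists_convergent_inverse (hΨ : NoConst Ψ) (hΦ : NoConst Φ)
    (h1 : ∀ i, pull Φ (Ψ i) = X i) (h2 : ∀ i, pull Ψ (Φ i) = X i)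
    (hu : ∀ i, Converges (u i)) (hconj : ∀ i, pull Φ (X i * u i) = pull (sig F) (Φ i))
    (hmu : ∀ i, constantCoeff (u i) = mu i) (hw : ∀ i, HasWt 0 (u i)) :
    ∃ V : Fin 2 → MvPowerSeries (Fin 2) ℂ, NoConst V ∧ (∀ l, Converges (V l)) ∧
      ∀ l, zeta 2 l = pull (fun j : Fin 2 => rs (pull Ψ (inva j.castSucc))) (V l) := by
  set v : Fin 2 ⊕ Fin 2 → PS₄ := fun i => rs (u (emb i)) with hv
  have hvw : ∀ i, HasWt 0 (v i) := fun i => (hw _).rs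
  have hvmu : ∀ i, constantCoeff (v i) = mu (emb i) := fun i => by
    rw [hv, rs, constantCoeff_pull noConst_rsf, hmu]
  have hvc : ∀ i, Converges (v i) := fun i => by
    refine Converges.pull noConst_rsf (fun k => ?_) (hu _)
    induction k using emb_cases with
    | h i => rw [rsf_emb]; exact converges_X _
    | hl => rw [rsf_inl_two, ← map_zero C]; exact converges_C _
    | hr => rw [rsf_inr_two, ← map_zero C]; exact converges_C _
  set J : Fin 2 → PS₄ := fun j => rs (pull Ψ (inva j.castSucc)) with hJ
  have hJ0 : NoConst J := fun j => by
    rw [hJ, rs, constantCoeff_pull noConst_rsf, constantCoeff_pull hΨ, constantCoeff_inva]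
  have hrsv : ∀ f : PS₆, rs (pull Ψ (pull (sig F) f)) =
      pull (fun i => X i * v i) (rs (pull Ψ f)) := fun f => by
    rw [pull_conj noConst_sig hΨ hΦ h1 h2 hconj, rs_pull_diag]
  have hJinv : ∀ j, pull (fun i => X i * v i) (J j) = J j := fun j => by
    rw [hJ, ← hrsv, pull_sig_inva]
  have hJw : ∀ j, HasWt 0 (J j) := fun j => hasWt_zero_of_invariant hvw hvmu (hJinv j)
  have hsiv : ∀ j f, rs (pull Ψ (siv j f)) = pull (fun _ => J j) f := fun j f => by
    rw [pull_pull_siv hΨ, rs, pull_pull (fun _ => by rw [constantCoeff_pull hΨ,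
      constantCoeff_inva]) noConst_rsf]
    rfl
  set p : Fin 2 → PS₄ := fun j => rs (pull Ψ (ep j)) with hp
  set q : Fin 2 → PS₄ := fun j => rs (pull Ψ (em j)) with hq
  have hpq : ∀ j, p j * q j = J j := fun j => by rw [hp, hq, ← map_mul, ← map_mul, ep_mul_em]
  have hpe : ∀ j, pull (fun i => X i * v i) (p j) =
      pull (fun _ => J j) (ell j.castSucc ^ 2) * p j := fun j => by
    rw [hp, ← hrsv, pull_sig_ep, map_mul, map_mul, hsiv]
  have hJ' : ∀ j : Fin 2, NoConst fun _ : Unit => pull Ψ (inva j.castSucc) := fun j _ => by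
    rw [constantCoeff_pull hΨ, constantCoeff_inva]
  have hplin : ∀ j, ∃ c : ℂ, c ≠ 0 ∧ Ord 2 (p j - C c * X (Sum.inl j)) := fun j => by
    have e := pull_conj noConst_sig hΨ hΦ h1 h2 hconj (ep j)
    rw [pull_sig_ep, map_mul, pull_pull_siv hΨ] at e
    obtain ⟨c, hc, ho⟩ := exists_linear_part (k := Sum.inl j.castSucc) hΨ hΦ h1 hmu
      (by rw [constantCoeff_pull (hJ' j), map_pow, constantCoeff_ell]; rfl)
      (constantCoeff_ep j) (not_ord_two_ep j) e.symm
    refine ⟨c, hc, ?_⟩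
    have := ho.pull noConst_rsf
    rw [map_sub, map_mul, pull_C, pull_X noConst_rsf] at this
    rwa [← rsf_emb]
  have hqlin : ∀ j, ∃ c : ℂ, c ≠ 0 ∧ Ord 2 (q j - C c * X (Sum.inr j)) := fun j => by
    have e := pull_conj noConst_sig hΨ hΦ h1 h2 hconj (em j)
    rw [pull_sig_em, map_mul, pull_pull_siv hΨ] at e
    obtain ⟨c, hc, ho⟩ := exists_linear_part (k := Sum.inr j.castSucc) hΨ hΦ h1 hmu
      (by rw [constantCoeff_pull (hJ' j), map_pow, constantCoeff_elli, inv_pow]; rfl)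
      (constantCoeff_em j) (not_ord_two_em j) e.symm
    refine ⟨c, hc, ?_⟩
    have := ho.pull noConst_rsf
    rw [map_sub, map_mul, pull_C, pull_X noConst_rsf] at this
    rwa [← rsf_emb]
  choose c hc hpc using hplin
  choose d hd hqd using hqlin
  -- The first integral is a product of eigenfunctions with leading terms `c_j ξ_j` and `d_j η_j`,
  -- so in terms of `ζ` it begins with `c_j d_j ζ_j` and can be inverted.
  have hD : ∀ j, Ord 2 (dg (J j) - C (c j * d j) * X j) := fun j => by
    have h3 := ord_three_mul_sub (hpc j) (hqd j)
      (by rw [hq, rs, constantCoeff_pull noConst_rsf, constantCoeff_pull hΨ, constantCoeff_em])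
    rw [hpq] at h3
    intro k hk
    have e : (C (c j * d j) * X j : MvPowerSeries (Fin 2) ℂ) =
        dg (C (c j * d j) * (X (Sum.inl j) * X (Sum.inr j))) := by
      rw [← dg_pull_zeta (C (c j * d j) * X j), map_mul, pull_C, pull_X noConst_zeta]; rfl
    rw [e, ← dg_sub, coeff_dg]
    apply h3
    have : (Finsupp.sumElim k k).degree = k.degree + k.degree := by
      simp [Finsupp.degree_eq_sum, Fintype.sum_sum_type]
    omega
  obtain ⟨V, hV, -, hDV, hVc⟩ := exists_two_sided_inverse (fun j => mul_ne_zero (hc j) (hd j)) hD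
  have hD0 : NoConst fun j => dg (J j) := fun j => by
    have := hD j 0 (by simp)
    rw [map_sub, coeff_C_mul, coeff_zero_X, mul_zero, sub_zero] at this
    simpa using this
  have hzeta : ∀ l, zeta 2 l = pull J (V l) := fun l => by
    have := congrArg (pull (zeta 2)) (hDV l)
    rw [pull_X noConst_zeta, pull_pull hD0 noConst_zeta] at this
    rw [← this]
    congr 2
    funext j
    exact (hJw j).pull_zeta_dg
  have hinv : ∀ f, HasWt 0 f → pull (fun i => X i * v i) f = f := by
    intro f hf
    rw [← hf.pull_zeta_dg, pull_pull noConst_zeta (noConst_diag v)]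
    congr 2
    funext l
    rw [hzeta, pull_pull hJ0 (noConst_diag v), funext hJinv]
  -- The multiplier of `ξ_j` in the normal form, which converges, equals `ℓ_j(D_j)²`. Hence `D_j`
  -- converges, and so does the inverse of `D`.
  refine ⟨V, hV, hVc fun j => ?_, hzeta⟩
  refine Converges.of_pull_ell_sq (hD0 j) j.castSucc ?_
  have hM := hasWt_pull_unit (hJw j) (hJ0 j) (ell j.castSucc ^ 2)
  rw [← hM.2, ← multiplier_eq hvw hinv hM.1 (hc j) (hpc j) (hpe j)]
  exact (hvc _).dg

end Restriction

end CRSing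
end

noncomputable section

namespace CRSing

open MvPowerSeries
open scoped ENNReal NNReal

/-! ### The slice `z_3 = w_3 = 0` in the explicit normalizing coordinates. -/

section Slice

/-- The coordinate `w_j` in terms of the normalizing coordinates. -/
def wc (j : Fin 2) : PS₄ := kap (zc j)

theorem noConst_wc : NoConst wc := fun j => by rw [wc, constantCoeff_kap]; exact noConst_zc j

theorem sz_ell_add_elli (j : Fin 2) : sz j (ell j.castSucc) + sz j (elli j.castSucc) =
    C (tr j.castSucc) + zeta 2 j := by
  rw [← map_add, elli, add_sub_cancel, map_add, sz, pull_C, pull_X (noConst_sz j)]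

theorem sz_bser (j : Fin 2) : (sz j (ell j.castSucc) - sz j (elli j.castSucc)) *
    sz j (bser j.castSucc) = 1 := by
  rw [← map_sub, ← map_mul, bser_mul, map_one]

theorem wc_eq (j : Fin 2) : wc j = (sz j (ell j.castSucc) * X (Sum.inl j) -
    sz j (elli j.castSucc) * X (Sum.inr j)) * sz j (bser j.castSucc) := by
  rw [wc, zc, map_mul, map_sub, kap_X, kap_X, kap_sz]
  simp only [kapu, Sum.elim_inl, Sum.elim_inr]
  ring

theorem wc_sub_elli (j : Fin 2) : wc j - sz j (elli j.castSucc) * zc j = X (Sum.inl j) := by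
  rw [wc_eq, zc]; linear_combination X (Sum.inl j) * sz_bser j

theorem wc_sub_ell (j : Fin 2) : wc j - sz j (ell j.castSucc) * zc j = X (Sum.inr j) := by
  rw [wc_eq, zc]; linear_combination X (Sum.inr j) * sz_bser j

theorem kap_wc (j : Fin 2) : kap (wc j) = (C (tr j.castSucc) + zeta 2 j) * wc j - zc j := by
  have h := congrArg kap (wc_sub_elli j)
  rw [map_sub, map_mul, kap_sz, kap_X, ← wc] at h
  simp only [kapu, Sum.elim_inl] at h
  rw [← sz_ell_add_elli]
  linear_combination h - sz j (ell j.castSucc) * wc_sub_elli j - zc j * sz_ell_mul_elli j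

theorem kap_kap_wc (j : Fin 2) :
    kap (kap (wc j)) = (C (tr j.castSucc) + zeta 2 j) * kap (wc j) - wc j := by
  conv_lhs => rw [kap_wc]
  rw [map_sub, map_mul, map_add, kap_zeta, kap_C, ← wc]

/-- The parametrization of the subspace `z_3 = w_3 = 0` by the normalizing coordinates. -/
def iof : Fin 3 ⊕ Fin 3 → PS₄ := Sum.elim ![zc 0, zc 1, 0] ![wc 0, wc 1, 0]

theorem iof_emb (i : Fin 2 ⊕ Fin 2) : iof (emb i) = Sum.elim zc wc i := by
  rcases i with i | i <;> fin_cases i <;> rfl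

theorem iof_inl (j : Fin 2) : iof (Sum.inl j.castSucc) = zc j := iof_emb (Sum.inl j)

theorem iof_inr (j : Fin 2) : iof (Sum.inr j.castSucc) = wc j := iof_emb (Sum.inr j)

theorem iof_inl_two : iof (Sum.inl 2) = 0 := rfl

theorem iof_inr_two : iof (Sum.inr 2) = 0 := rfl

theorem noConst_iof : NoConst iof := by
  intro i
  induction i using emb_cases with
  | h i =>
    rw [iof_emb]
    rcases i with j | j
    · exact noConst_zc j
    · exact noConst_wc j
  | hl => rw [iof_inl_two]; simp
  | hr => rw [iof_inr_two]; simp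

/-- Restriction to the subspace `z_3 = w_3 = 0`, in the normalizing coordinates. -/
def iot : PS₆ →ₐ[ℂ] PS₄ := pull iof

theorem iot_X (i : Fin 3 ⊕ Fin 3) : iot (X i) = iof i := pull_X noConst_iof i

theorem iot_C (c : ℂ) : iot (C c) = C c := pull_C _ c

theorem iot_inva (j : Fin 2) : iot (inva j.castSucc) = zeta 2 j := by
  rw [iot, pull_inva_eq noConst_iof]
  rw [iof_inl, iof_inr, ← sz_ell_add_elli, zeta]
  linear_combination (wc j - sz j (elli j.castSucc) * zc j) * wc_sub_ell j +
    X (Sum.inr j) * wc_sub_elli j - (zc j) ^ 2 * sz_ell_mul_elli j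

variable {F : MvPowerSeries (Fin 2) ℂ}

theorem iot_pot'_two : iot (pot' F 2) = C (tr 2) + kap (pull zc F) := by
  rw [pot'_two, map_add, iot_C, iot, pull_pull noConst_wfst noConst_iof, kap,
    pull_pull noConst_zc (noConst_diag kapu)]
  congr 3
  funext k
  rw [wfst, pull_X noConst_iof, iof_inr]; rfl

theorem iot_sig_inl (j : Fin 2) : iot (sig F (Sum.inl j.castSucc)) = kap (wc j) := by
  rw [sig_inl_castSucc, map_sub, map_mul, map_add, iot_C, iot_inva, iot_X, iot_X, iof_inl, iof_inr,
    kap_wc]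

theorem iot_sig_inl_two : iot (sig F (Sum.inl 2)) = 0 := by
  rw [sig_inl, map_sub, map_mul, iot_X, iot_X, iof_inl_two, iof_inr_two]; ring

theorem iot_pull_deck'_pot_two :
    iot (pull (deck' F) (pot F 2)) = C (tr 2) + kap (kap (pull zc F)) := by
  have h : ∀ k, iot (pull (deck' F) (zfst k)) = kap (kap (zc k)) := fun k => by
    rw [zfst, pull_X noConst_deck', ← wc, ← iot_sig_inl (F := F), sig_inl]; rfl
  rw [pot_two, map_add, map_add, pull_C, iot_C, pull_pull noConst_zfst noConst_deck', iot,
    pull_pull (noConst_zfst.pull noConst_deck') noConst_iof, kap,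
    pull_pull noConst_zc (noConst_diag kapu), pull_pull (noConst_zc.pull (noConst_diag kapu))
      (noConst_diag kapu)]
  congr 3
  funext k
  exact h k

/-- The third pair is linear over the other two, so the slice is invariant; on it `σ` consists of
two half steps. -/
theorem iot_pull_sig (f : PS₆) : iot (pull (sig F) f) = kap (kap (iot f)) := by
  rw [iot, pull_pull noConst_sig noConst_iof, kap, pull_pull noConst_iof (noConst_diag kapu),
    pull_pull (noConst_iof.pull (noConst_diag kapu)) (noConst_diag kapu)]
  congr 2
  funext i
  change iot (sig F i) = kap (kap (iof i))
  rcases i with i | i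
  · induction i using fin_three_cases with
    | h j => rw [iot_sig_inl, iof_inl, wc]
    | h2 => rw [iot_sig_inl_two, iof_inl_two, map_zero, map_zero]
  · induction i using fin_three_cases with
    | h j =>
      rw [sig_inr_castSucc, map_sub, map_mul, map_add, iot_C, iot_inva, iot_X, iof_inr,
        iot_sig_inl, ← kap_kap_wc]
    | h2 =>
      rw [sig_inr, map_sub, map_mul, iot_sig_inl_two, iot_X, iof_inr_two, map_zero, map_zero]
      ring

theorem kap_kap_eq (f : PS₄) : kap (kap f) = pull (fun i => X i * kapu i ^ 2) f := by
  have h : (fun i => pull (fun k => X k * kapu k) (X i * kapu i)) =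
      fun i => X i * kapu i ^ 2 := by
    funext i
    change kap (X i * kapu i) = _
    rw [map_mul, kap_X, kap_of_hasWt_zero (hasWt_kapu i)]; ring
  rw [kap, pull_pull (noConst_diag kapu) (noConst_diag kapu), h]

theorem constantCoeff_kapu_sq (i : Fin 2 ⊕ Fin 2) : constantCoeff (kapu i ^ 2) = mu (emb i) := by
  rw [map_pow, constantCoeff_kapu]
  rcases i with i | i <;> simp [mu, emb]

/-- On the slice all multipliers are products of powers of 4 and 9, so none is a nontrivial power of
5. -/
theorem eq_zero_of_kap_kap {f g : PS₄} (h : kap (kap f) = g * f) {r : ℤ} (hr : r ≠ 0)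
    (hg : constantCoeff g = 5 ^ r) : f = 0 := by
  rw [kap_kap_eq] at h
  refine eq_zero_of_pull_diag_eq_mul (fun i => kapu i ^ 2) h fun m _ heq => ?_
  rw [funext constantCoeff_kapu_sq, hg] at heq
  exact hr (wt_eq_zero_of_mult heq).2

/-- The restriction to `z_3 = w_3 = 0` is determined by its expression in the normalizing
coordinates. -/
theorem rs_eq_zero_of_iot {f : PS₆} (h : iot f = 0) : rs f = 0 := by
  set G : Fin 2 ⊕ Fin 2 → PS₄ := Sum.elim (fun j => rs (ep j)) fun j => rs (em j) with hG
  have hGc : NoConst G := by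
    rintro (j | j)
    · simp [hG, rs, constantCoeff_pull noConst_rsf, constantCoeff_ep]
    · simp [hG, rs, constantCoeff_pull noConst_rsf, constantCoeff_em]
  have hsz : ∀ j f, pull G (sz j f) = rs (siv j f) := fun j f => by
    rw [sz, pull_pull (noConst_sz j) hGc, siv, rs, pull_pull (noConst_siv j) noConst_rsf]
    congr 2
    funext _
    rw [zeta, map_mul, pull_X hGc, pull_X hGc]
    change rs (ep j) * rs (em j) = rs (inva j.castSucc)
    rw [← map_mul, ep_mul_em]
  have hrX : ∀ i, rs (X i) = rsf i := fun i => pull_X noConst_rsf i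
  have hz : ∀ j, pull G (zc j) = rs (X (Sum.inl j.castSucc)) := fun j => by
    rw [zc, map_mul, map_sub, pull_X hGc, pull_X hGc, hsz]
    change (rs (ep j) - rs (em j)) * rs (siv j (bser j.castSucc)) = _
    rw [← map_sub, ← map_mul]
    congr 1
    rw [ep, em]
    linear_combination X (Sum.inl j.castSucc) * siv_bser j
  have hw : ∀ j, pull G (wc j) = rs (X (Sum.inr j.castSucc)) := fun j => by
    rw [wc_eq, map_mul, map_sub, map_mul, map_mul, pull_X hGc, pull_X hGc, hsz, hsz, hsz]
    change (_ * rs (ep j) - _ * rs (em j)) * rs (siv j (bser j.castSucc)) = _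
    rw [← map_mul, ← map_mul, ← map_sub, ← map_mul]
    congr 1
    rw [ep, em]
    linear_combination X (Sum.inr j.castSucc) * siv_bser j
  -- The eigenfunctions `ep`, `em` are the inverse of the parametrization: substituting them for
  -- `ξ`, `η` recovers `z_j` and `w_j` on the slice.
  have key : ∀ f, pull G (iot f) = rs f := fun f => by
    rw [iot, pull_pull noConst_iof hGc, rs]
    congr 2
    funext i
    rw [← hrX]
    rcases i with i | i
    · induction i using fin_three_cases with
      | h j => rw [iof_inl, hz]
      | h2 => rw [iof_inl_two, map_zero, hrX, rsf_inl_two]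
    · induction i using fin_three_cases with
      | h j => rw [iof_inr, hw]
      | h2 => rw [iof_inr_two, map_zero, hrX, rsf_inr_two]
  rw [← key, h, map_zero]

theorem mon_rsf_mapDomain (d : Fin 2 ⊕ Fin 2 →₀ ℕ) :
    mon rsf (d.mapDomain emb) = monomial d 1 := by
  induction d using finsupp_induction_add_single with
  | h0 => simp
  | hs i d ih =>
    rw [Finsupp.mapDomain_add, Finsupp.mapDomain_single, mon_add, ih, mon_single, pow_one, rsf_emb,
      X_def, monomial_mul_monomial, one_mul]

theorem coeff_mon_rsf (d : Fin 3 ⊕ Fin 3 →₀ ℕ) :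
    ∀ m, coeff m (mon rsf d) ≠ 0 → d = m.mapDomain emb := by
  classical
  induction d using finsupp_induction_add_single with
  | h0 =>
    intro m hm
    rw [mon_zero, coeff_one] at hm
    have : m = 0 := by
      by_contra hne
      rw [if_neg hne] at hm
      exact hm rfl
    simp [this]
  | hs i d ih =>
    intro m hm
    rw [mon_add, mon_single, pow_one] at hm
    induction i using emb_cases with
    | h i =>
      rw [rsf_emb, X_def, coeff_mul_monomial] at hm
      have hle : Finsupp.single i 1 ≤ m := by
        by_contra hne
        rw [if_neg hne] at hm
        exact hm rfl
      rw [if_pos hle, mul_one] at hm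
      rw [ih _ hm, ← Finsupp.mapDomain_single (f := emb), ← Finsupp.mapDomain_add,
        tsub_add_cancel_of_le hle]
    | hl => rw [rsf_inl_two, mul_zero] at hm; simp at hm
    | hr => rw [rsf_inr_two, mul_zero] at hm; simp at hm

theorem coeff_rs (f : PS₆) (m : Fin 2 ⊕ Fin 2 →₀ ℕ) :
    coeff m (rs f) = coeff (m.mapDomain emb) f := by
  classical
  rw [rs, coeff_pull_eq_sum noConst_rsf f m {m.mapDomain emb}, Finset.sum_singleton,
    mon_rsf_mapDomain, coeff_monomial_same, mul_one]
  intro d hd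
  rw [Finset.mem_singleton]
  exact coeff_mon_rsf d m (right_ne_zero_of_mul hd)

theorem emb_injective : Function.Injective emb :=
  Sum.map_injective.mpr ⟨Fin.castSucc_injective _, Fin.castSucc_injective _⟩

/-- A power series that vanishes for `z_3 = w_3 = 0` is in the ideal generated by `z_3, w_3`. -/
theorem exists_decomposition {f : PS₆} (h : rs f = 0) :
    ∃ α β : PS₆, f = X (Sum.inl 2) * α + X (Sum.inr 2) * β := by
  classical
  set α : PS₆ := fun m => coeff (Finsupp.single (Sum.inl 2) 1 + m) f with hα
  have hdvd : X (Sum.inr 2) ∣ f - X (Sum.inl 2) * α := by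
    rw [X_dvd_iff]
    intro m hm
    rw [map_sub, X_def, coeff_monomial_mul, one_mul]
    split_ifs with hle
    · have : coeff (m - Finsupp.single (Sum.inl 2) 1) α =
        coeff (Finsupp.single (Sum.inl 2) 1 + (m - Finsupp.single (Sum.inl 2) 1)) f := rfl
      rw [this, add_tsub_cancel_of_le hle, sub_self]
    · have hm2 : m (Sum.inl 2) = 0 := by
        rw [Finsupp.single_le_iff] at hle; omega
      have e : m = (m.comapDomain emb emb_injective.injOn).mapDomain emb := by
        ext i
        induction i using emb_cases with
        | h i => rw [Finsupp.mapDomain_apply emb_injective]; rfl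
        | hl =>
          rw [hm2, Finsupp.mapDomain_of_notMem_range]
          rintro ⟨i | i, hi⟩ <;> fin_cases i <;> simp [emb] at hi
        | hr =>
          rw [hm, Finsupp.mapDomain_of_notMem_range]
          rintro ⟨i | i, hi⟩ <;> fin_cases i <;> simp [emb] at hi
      rw [e, ← coeff_rs, h, map_zero, sub_zero]
  obtain ⟨β, hβ⟩ := hdvd
  exact ⟨α, β, by linear_combination hβ⟩

theorem X_dvd_of_relation {τ : Type} {i j : τ} (hij : i ≠ j) {a b : MvPowerSeries τ ℂ}
    (h : X i * a + X j * b = 0) : X j ∣ a := by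
  classical
  rw [X_dvd_iff]
  intro m hm
  have := congrArg (coeff (Finsupp.single i 1 + m)) h
  rw [map_add, X_def, coeff_add_monomial_mul, one_mul, X_def, coeff_monomial_mul, if_neg, map_zero,
    add_zero] at this
  · exact this
  · rw [Finsupp.single_le_iff]
    simp [hm, hij]

end Slice

/-! ### From a convergent normal form to a convergent Bloch multiplier. -/

section Potential

variable {F : MvPowerSeries (Fin 2) ℂ}

/-- A solution of the cocycle equation over the full step gives an eigenfunction of the half step.
    -/
theorem isEigen_of_cocycle {G L : MvPowerSeries (Fin 2) ℂ} {α β : PS₄}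
    (hL : L ^ 2 = G) (hL0 : constantCoeff L = 5) (hF : constantCoeff F = 0)
    (h1 : -(kap (kap α)) - (C (tr 2) + kap (kap (pull zc F))) * kap (kap β) =
      pull (zeta 2) G * α)
    (h2 : (C (tr 2) + kap (pull zc F)) * kap (kap α) +
      ((C (tr 2) + kap (kap (pull zc F))) * (C (tr 2) + kap (pull zc F)) - 1) * kap (kap β) =
      pull (zeta 2) G * β)
    (h0 : constantCoeff α ≠ 0 ∨ constantCoeff β ≠ 0) : ∃ β', IsEigen F L β' := by
  have hZ0 : constantCoeff (pull zc F) = 0 := by rw [constantCoeff_pull noConst_zc, hF]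
  have hΛ0 : constantCoeff (pull (zeta 2) L) = 5 := by rw [constantCoeff_pull noConst_zeta, hL0]
  have hΛk : kap (pull (zeta 2) L) = pull (zeta 2) L := kap_pull_zeta L
  rw [← hL, map_pow] at h1 h2
  set Λ := pull (zeta 2) L with hΛ
  -- Let `T` be the half step acting on the forms `z_3 α + w_3 β`. From `T² = Λ²` it follows that `T
  -- + Λ` maps to eigenvectors of `T` with eigenvalue `Λ`; `γ` is the `w_3`-component of the image.
  set γ := kap α + (C (tr 2) + kap (pull zc F)) * kap β + Λ * β with hγ
  have hγe : Λ ^ 2 * γ + kap (kap γ) = Λ * (C (tr 2) + kap (pull zc F)) * kap γ := by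
    have e1 : -(kap γ) = Λ * (-(kap β) + Λ * α) := by
      rw [hγ]
      simp only [map_add, map_mul, kap_C, hΛk]
      linear_combination h1
    have e2 : -(kap (kap γ)) = Λ * (-(kap (kap β)) + Λ * kap α) := by
      have := congrArg kap e1
      simpa only [map_neg, map_mul, map_add, hΛk] using this
    have e3 : kap γ = kap (kap α) + (C (tr 2) + kap (kap (pull zc F))) * kap (kap β) +
        Λ * kap β := by
      rw [hγ]
      simp only [map_add, map_mul, kap_C, hΛk]
    rw [hγ] at *
    linear_combination -e2 - Λ * h2 - Λ * (C (tr 2) + kap (pull zc F)) * e3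
  have hγ0 : constantCoeff γ ≠ 0 := by
    have c1 := congrArg constantCoeff h1
    simp only [map_sub, map_neg, map_mul, map_add, map_pow, constantCoeff_kap, constantCoeff_C,
      hZ0, hΛ0, tr_two] at c1
    -- At the origin the form is already the eigenvector of `T` with eigenvalue 5, so `γ(0) = 10
    -- β(0)` is not zero.
    have c2 : constantCoeff α = -(constantCoeff β / 5) := by linear_combination -c1 / 26
    rw [hγ]
    simp only [map_add, map_mul, constantCoeff_kap, constantCoeff_C, hZ0, hΛ0, tr_two, c2]
    intro h
    have hβ : constantCoeff β = 0 := by linear_combination h / 10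
    rw [hβ] at c2
    rcases h0 with h0 | h0
    · exact h0 (by rw [c2]; simp)
    · exact h0 hβ
  set g := dg (wproj 0 γ) with hg
  have hgw : pull (zeta 2) g = wproj 0 γ := (hasWt_wproj 0 γ).pull_zeta_dg
  have hg0 : constantCoeff g ≠ 0 := by
    have := constantCoeff_pull noConst_zeta g
    rw [hgw] at this
    rw [← this, ← coeff_zero_eq_constantCoeff_apply, coeff_wproj, if_pos wt_zero]
    simpa using hγ0
  set n := pull (zeta 2) g⁻¹ with hn
  have hnk : kap n = n := kap_pull_zeta _
  -- Dividing by the part of weight zero of `γ` achieves the normalization. This factor is invariant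
  -- under the half step, so the equation persists.
  refine ⟨n * γ, hL0, ?_, ?_⟩
  · rw [wproj_mul (hasWt_pull_zeta _), ← hgw, ← map_mul, MvPowerSeries.inv_mul_cancel _ hg0,
      map_one]
  · simp only [map_mul, hnk]
    linear_combination n * hγe

/-- If some Poincaré–Dulac normal form of `σ` converges, then the half-step cocycle has an
eigenfunction with a convergent multiplier. -/
theorem exists_convergent_isEigen {σ' : FormalMap (Fin 3 ⊕ Fin 3)} (hF : constantCoeff F = 0)
    (h : IsPoincareDulacNormalForm (sig F) σ') (hc : IsConvergent σ') :
    ∃ L β, IsEigen F L β ∧ Converges L := by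
  obtain ⟨Ψ, Φ, u, hΨ, hΦ, h1, h2, hu, hconj, hmu, hw⟩ := exists_normal_form hF h hc
  obtain ⟨V, hV, hVc, hzeta⟩ := exists_convergent_inverse hΨ hΦ h1 h2 hu hconj hmu hw
  have hslice : ∀ (i : Fin 3 ⊕ Fin 3) (r : ℤ), r ≠ 0 → mu i = 5 ^ r → iot (Φ i) = 0 := by
    intro i r hr hi
    have e := congrArg iot (hconj i)
    rw [map_mul, map_mul, pull_X hΦ, iot_pull_sig] at e
    refine eq_zero_of_kap_kap (g := iot (pull Φ (u i))) ?_ hr ?_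
    · rw [← e]; ring
    · rw [iot, constantCoeff_pull noConst_iof, constantCoeff_pull hΦ, hmu, hi]
  have hmul : mu (Sum.inl 2) = 5 ^ (2 : ℤ) := by simp [mu, lam]
  have hl := hslice (Sum.inl 2) 2 (by norm_num) hmul
  have hr := hslice (Sum.inr 2) (-2) (by norm_num) (by simp [mu, lam])
  have hΦi : NoConst fun i => iot (Φ i) := hΦ.pull noConst_iof
  have hiΦ : ∀ f, iot (pull Φ f) = pull (fun i => iot (Φ (emb i))) (rs f) := fun f => by
    rw [← pull_eq_pull_rs hΦi hl hr]
    exact pull_pull hΦ noConst_iof f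
  set g := dg (rs (u (Sum.inl 2))) with hg
  set G := pull V g with hG
  have hgc : Converges g := by
    refine Converges.dg (Converges.pull noConst_rsf (fun k => ?_) (hu _))
    induction k using emb_cases with
    | h i => rw [rsf_emb]; exact converges_X _
    | hl => rw [rsf_inl_two, ← map_zero C]; exact converges_C _
    | hr => rw [rsf_inr_two, ← map_zero C]; exact converges_C _
  have hGc : Converges G := Converges.pull hV hVc hgc
  have hW : NoConst fun i => iot (Φ (emb i)) := fun i => hΦi _
  have hJ0 : NoConst fun j : Fin 2 => rs (pull Ψ (inva j.castSucc)) := fun j => by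
    rw [rs, constantCoeff_pull noConst_rsf, constantCoeff_pull hΨ, constantCoeff_inva]
  -- On the slice the multiplier is a convergent series in the products of the normalizing
  -- coordinates. These are the convergent series `V` of the first integrals, which on the slice are
  -- the `ζ_j`.
  have hU : iot (pull Φ (u (Sum.inl 2))) = pull (zeta 2) G := by
    have e : ∀ l, pull (fun i => iot (Φ (emb i))) (zeta 2 l) = pull (zeta 2) (V l) := by
      intro l
      rw [hzeta l, pull_pull hJ0 hW]
      congr 2
      funext j
      rw [← hiΦ, pull_pull hΨ hΦ, funext h1, pull_X_self, iot_inva]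
    rw [hiΦ, ← (hw _).rs.pull_zeta_dg, pull_pull noConst_zeta hW, funext e, hG,
      pull_pull hV noConst_zeta]
  have hG0 : constantCoeff G = 25 := by
    rw [← constantCoeff_pull noConst_zeta, ← hU, iot, constantCoeff_pull noConst_iof,
      constantCoeff_pull hΦ, hmu, hmul]
    norm_num
  obtain ⟨L, hL, hL0⟩ := exists_sqrt (a := G) (s₀ := 5) (by norm_num) (by rw [hG0]; norm_num)
  have hLc : Converges L := Converges.of_sq (by rw [hL0]; norm_num) (by rw [hL]; exact hGc)
  -- The normalizing coordinate of multiplier 25 vanishes on the slice; its first order part in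
  -- `(z_3, w_3)` is a solution of the full-step cocycle equation.
  obtain ⟨α, β, hθ⟩ := exists_decomposition (rs_eq_zero_of_iot hl)
  have he := hconj (Sum.inl 2)
  rw [map_mul, pull_X hΦ, hθ, map_add, map_mul, map_mul, pull_X noConst_sig, pull_X noConst_sig,
    sig_inr, sig_inl] at he
  set U := pull Φ (u (Sum.inl 2)) with hUdef
  set T := pull (deck' F) (pot F 2) with hT
  have hrel : X (Sum.inl 2) * (-(pull (sig F) α) - T * pull (sig F) β - U * α) +
      X (Sum.inr 2) * (pot' F 2 * pull (sig F) α + (T * pot' F 2 - 1) * pull (sig F) β -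
        U * β) = 0 := by
    linear_combination -he
  -- The coefficients of `z_3` and `w_3` need not vanish separately, but each is divisible by the
  -- other variable and so vanishes on the slice.
  obtain ⟨a, ha⟩ := X_dvd_of_relation Sum.inl_ne_inr hrel
  obtain ⟨b, hb⟩ := X_dvd_of_relation (i := (Sum.inr 2 : Fin 3 ⊕ Fin 3))
    (j := (Sum.inl 2 : Fin 3 ⊕ Fin 3)) Sum.inr_ne_inl
    (by rw [add_comm]; exact hrel)
  have ea := congrArg iot ha
  have eb := congrArg iot hb
  simp only [map_sub, map_neg, map_mul, map_add, map_one, iot_X, iof_inl_two, iof_inr_two, zero_mul,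
    iot_pull_sig, hU] at ea eb
  rw [hT, iot_pull_deck'_pot_two] at ea eb
  rw [iot_pot'_two] at eb
  obtain ⟨β', hβ'⟩ := isEigen_of_cocycle (α := iot α) (β := iot β) hL hL0 hF
    (by linear_combination ea) (by linear_combination eb) (by
      by_contra! hcon
      rw [iot, constantCoeff_pull noConst_iof, constantCoeff_pull noConst_iof] at hcon
      have hX : ∀ i, Ord 1 (X i : PS₆) := fun i => ord_one_iff.mpr (by simp)
      -- If both coefficients vanished at the origin, a component of an invertible map would have
      -- order two.
      have ho : Ord 2 (Φ (Sum.inl 2)) := by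
        rw [hθ]
        exact ((hX _).mul (ord_one_iff.mpr hcon.1)).add ((hX _).mul (ord_one_iff.mpr hcon.2))
      have ho2 := ho.pull hΨ
      rw [h2] at ho2
      have := coeff_single_eq_zero_of_ord ho2 (Sum.inl 2)
      simp at this)
  exact ⟨L, β', hβ', hLc⟩

end Potential

/-- A power series in two variables with bounded coefficients converges. -/
theorem converges_of_bounded {f : MvPowerSeries (Fin 2) ℂ} (h : ∀ m, ‖coeff m f‖ ≤ 1) :
    Converges f := by
  refine ⟨1 / 2, by norm_num, ?_⟩
  have hg : Summable fun n : ℕ => ((1 : ℝ) / 2) ^ n := summable_geometric_two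
  have h2 := hg.mul_of_nonneg hg (fun n => by positivity) (fun n => by positivity)
  have h3 := ((Finsupp.equivFunOnFinite : (Fin 2 →₀ ℕ) ≃ _).trans
    (finTwoArrowEquiv ℕ)).summable_iff.mpr h2
  refine Summable.of_nonneg_of_le (fun m => by positivity) (fun m => ?_) h3
  simp only [Function.comp_apply, Equiv.trans_apply, finTwoArrowEquiv_apply,
    ← pow_add]
  rw [Finsupp.degree_eq_sum, Fin.sum_univ_two]
  exact mul_le_of_le_one_left (by positivity) (h m)

end CRSing
end

theorem theorem1p3 :
    ∃ (M : Set (Fin 3 ⊕ Fin 3 → ℂ)) (E : Fin 3 → MvPowerSeries (Fin 3 ⊕ Fin 3) ℂ)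
      (t : Fin 3 → CRSing.FormalMap (Fin 3 ⊕ Fin 3)),
      CRSing.IsRealAnalyticSubmanifold M E ∧
      CRSing.ConditionB E ∧
      CRSing.ConditionD E ∧
      CRSing.IsMoserWebsterFamily E t ∧
      CRSing.IsNonResonant (CRSing.sigma t) ∧
      CRSing.IsPurelyElliptic (CRSing.tau₁ t) ∧
      ∀ σ' : CRSing.FormalMap (Fin 3 ⊕ Fin 3),
        CRSing.IsPoincareDulacNormalForm (CRSing.sigma t) σ' → ¬ CRSing.IsConvergent σ' := by
  obtain ⟨F, hFb, hF1, hF⟩ := CRSing.exists_divergent_potential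
  have hF0 : MvPowerSeries.constantCoeff F = 0 := by simpa using hF1 0 (by simp)
  have hFc : CRSing.Converges F := CRSing.converges_of_bounded fun m => by
    obtain ⟨z, hz, hz1⟩ := hFb m
    rw [hz, Complex.norm_intCast]
    exact_mod_cast hz1
  -- The coefficients of `F` are integers, so `F` is real and `τ₂` has the explicit form `deck'`.
  have hFr : MvPowerSeries.map (starRingEnd ℂ) F = F := by
    ext m
    obtain ⟨z, hz, -⟩ := hFb m
    rw [MvPowerSeries.coeff_map, hz, map_intCast]
  obtain ⟨M, hM⟩ := CRSing.exists_submanifold hFc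
  refine ⟨M, CRSing.eqn F, fun j => CRSing.deck F {j}, hM, CRSing.conditionB_eqn F,
    CRSing.conditionD_eqn hFc, CRSing.isMoserWebsterFamily hFc, ?_, ?_, ?_⟩
  · rw [CRSing.sigma_deck hFr]; exact CRSing.isNonResonant_sig hF0
  · rw [CRSing.tau₁_deck]; exact CRSing.isPurelyElliptic_deck hF0
  · intro σ' hσ' hc
    rw [CRSing.sigma_deck hFr] at hσ'
    obtain ⟨L, β, hβ, hL⟩ := CRSing.exists_convergent_isEigen hF0 hσ' hc
    exact hF L β hβ hL
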